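/- Let $c,\lambda>0$, and let $(X,Y,Z)=\{(X(t),Y(t),Z(t))\}_{t\ge 0}$ be the orthogonal standard motion in $\mathbb R^3$ with speed $c$ and constant rate $\lambda$: a particle starts at the origin with a direction chosen uniformly among $\pm e_1,\pm e_2,\pm e_3$, moves with constant speed $c$, and at the events of a homogeneous Poisson process of rate $\lambda$ it switches to one of the four directions orthogonal to the current one, chosen uniformly and independently of the past and of the Poisson process. For $t>0$ let $G_t$ be the interior of the octahedron without the coordinate planes (which carry a singular part of the law), $$G_t=\{(x,y,z)\in\mathbb R^3:\ |x|+|y|+|z|<ct,\ xyz\ne 0\},$$ and let $G=\{(t,x,y,z):t>0,\ (x,y,z)\in G_t\}$. (i) The law of the position has inside the octahedron an absolutely continuous density: there is a function $p\ge 0$ of class $C^6$ on $G$ with $P\{(X(t),Y(t),Z(t))\in A\}=\int_A p(t,x,y,z)\,dx\,dy\,dz$ for every $t>0$ and every Borel set $A\subseteq G_t$. It satisfies, at every point of $G$, $$\Big[\big(\tfrac{\partial}{\partial t}+\lambda\big)^6-\tfrac{3\lambda^2}{4}\big(\tfrac{\partial}{\partial t}+\lambda\big)^4-\tfrac{\lambda^3}{4}\big(\tfrac{\partial}{\partial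 t}+\lambda\big)^3\Big]p = c^6\frac{\partial^6p}{\partial x^2\partial y^2\partial z^2}-c^4\big(\tfrac{\partial}{\partial t}+\lambda\big)^2\Big(\frac{\partial^4}{\partial x^2\partial y^2}+\frac{\partial^4}{\partial x^2\partial z^2}+\frac{\partial^4}{\partial y^2\partial z^2}\Big)p+c^2\Big[\big(\tfrac{\partial}{\partial t}+\lambda\big)^4-\tfrac{\lambda^2}{4}\big(\tfrac{\partial}{\partial t}+\lambda\big)^2\Big]\Delta p,\qquad(*)$$ where $\Delta=\partial_x^2+\partial_y^2+\partial_z^2$. Equivalently, the function $q$ defined by $p=e^{-\lambda t}q$ satisfies, at every point of $G$, $$(\partial_t^2-c^2\partial_x^2)(\partial_t^2-c^2\partial_y^2)(\partial_t^2-c^2\partial_z^2)\,q=\frac{3\lambda^2}{4}\,\partial_t^2\Big(\partial_t^2+\frac{\lambda}{3}\partial_t-\frac{c^2}{3}\Delta\Big)q .$$ (ii) The whole law of the position (with its singular parts) satisfies $(*)$ in the sense of distributions on $(0,\infty)\times\mathbb R^3$: for every $\varphi\in C_c^\infty((0,\infty)\times\mathbb R^3)$, $$\int_0^\infty E\big[(L^*\varphi)(t,X(t),Y(t),Z(t))\big]\,dt=0,$$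 where $L$ denotes the left-hand side of $(*)$ minus its right-hand side, as a linear differential operator, and $L^*$ is its formal adjoint, obtained from $L$ by replacing $\frac{\partial}{\partial t}+\lambda$ with $-\frac{\partial}{\partial t}+\lambda$. -/

import Mathlib

open MeasureTheory ProbabilityTheory

noncomputable section

namespace OrthogonalMotion

/-- Points `(t, x)` of space-time, with `x = (x 0, x 1, x 2)` the space coordinates. -/
abbrev SpaceTime : Type := ℝ × (Fin 3 → ℝ)

/-! ### The orthogonal standard motion -/

/-- The six directions `d_0, …, d_5`. -/
def direction : Fin 6 → Fin 3 → ℝ :=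
  ![![1, 0, 0], ![0, 1, 0], ![0, 0, 1], ![-1, 0, 0], ![0, -1, 0], ![0, 0, -1]]

/-- Switching probabilities of the standard motion: from `d_i` each of the four directions that are
orthogonal to `d_i` is chosen with probability `1 / 4`. -/
def switchProb (i j : Fin 6) : ℝ :=
  open Classical in if direction i ⬝ᵥ direction j = 0 then 1 / 4 else 0

variable {Ω : Type*}

/-- `switchTime τ n ω` is the time of the `n`-th switch (and `0` for `n = 0`), when `τ 0, τ 1, …`
are the waiting times between successive switches. -/
def switchTime (τ : ℕ → Ω → ℝ) (n : ℕ) (ω : Ω) : ℝ := ∑ k ∈ Finset.range n, τ k ω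

/-- The counting process: the number of switches in `(0, t]`. -/
def numSwitches (τ : ℕ → Ω → ℝ) (t : ℝ) (ω : Ω) : ℕ :=
  Set.ncard {k : ℕ | switchTime τ (k + 1) ω ≤ t}

/-- The position at time `t` of a particle that starts from the origin, moves with speed `c`, and
travels along the direction with index `V k ω` between its `k`-th and its `(k+1)`-st switch:
full displacements before the last switch, and the current, incomplete, displacement. -/
def position (c : ℝ) (τ : ℕ → Ω → ℝ) (V : ℕ → Ω → Fin 6) (t : ℝ) (ω : Ω) : Fin 3 → ℝ :=
  (∑ k ∈ Finset.range (numSwitches τ t ω), (c * τ k ω) • direction (V k ω)) +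
    (c * (t - switchTime τ (numSwitches τ t ω) ω)) • direction (V (numSwitches τ t ω) ω)

variable [MeasurableSpace Ω]

/-- The random data of an orthogonal standard motion with constant rate `lam`: the switches occur at
the times of a homogeneous Poisson process of rate `lam` (i.i.d. exponential waiting times `τ k`),
and, independently of it, the successive directions `V k` form a Markov chain with uniform
initial law and transition probabilities `switchProb`. -/
structure IsStandardMotion (P : Measure Ω) (lam : ℝ) (τ : ℕ → Ω → ℝ) (V : ℕ → Ω → Fin 6) :
    Prop where
  measurable_wait : ∀ k, Measurable (τ k)
  measurable_dir : ∀ k, Measurable (V k)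
  law_wait : ∀ k, P.map (τ k) = expMeasure lam
  indep_wait : iIndepFun τ P
  law_dir : ∀ (n : ℕ) (v : ℕ → Fin 6),
    P {ω | ∀ k ≤ n, V k ω = v k} =
      ENNReal.ofReal (1 / 6 * ∏ k ∈ Finset.range n, switchProb (v k) (v (k + 1)))
  indep_wait_dir : IndepFun (fun ω k => τ k ω) (fun ω k => V k ω) P

/-- The law of the position at time `t`. -/
def positionLaw (P : Measure Ω) (c : ℝ) (τ : ℕ → Ω → ℝ) (V : ℕ → Ω → Fin 6) (t : ℝ) :
    Measure (Fin 3 → ℝ) :=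
  P.map (position c τ V t)

/-! ### The region where the law has a density -/

/-- The interior of the octahedron `{|x| + |y| + |z| ≤ c t}`, without the three coordinate planes
(each of which carries a positive mass of the law). -/
def slice (c t : ℝ) : Set (Fin 3 → ℝ) := {x | ∑ i, |x i| < c * t ∧ ∀ i, x i ≠ 0}

/-- The corresponding space-time region. -/
def region (c : ℝ) : Set SpaceTime := {w | 0 < w.1 ∧ w.2 ∈ slice c w.1}

/-- `p ≥ 0` is, inside the octahedron, the density of the position at every time `t > 0`:
`P (position ∈ A) = ∫_A p(t, x) dx` for all Borel sets `A` contained in `slice c t`. -/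
structure IsInteriorDensity (P : Measure Ω) (c : ℝ) (τ : ℕ → Ω → ℝ) (V : ℕ → Ω → Fin 6)
    (p : SpaceTime → ℝ) : Prop where
  nonneg : ∀ w ∈ region c, 0 ≤ p w
  law_eq : ∀ t : ℝ, 0 < t →
    (positionLaw P c τ V t).restrict (slice c t) =
      (volume.restrict (slice c t)).withDensity (fun x => ENNReal.ofReal (p (t, x)))

/-! ### Differential operators on functions on space-time -/

/-- `∂u/∂t`. -/
def dt (u : SpaceTime → ℝ) : SpaceTime → ℝ := fun w => lineDeriv ℝ u w (1, 0)

/-- `∂u/∂x_i`. -/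
def dx (i : Fin 3) (u : SpaceTime → ℝ) : SpaceTime → ℝ :=
  fun w => lineDeriv ℝ u w (0, Pi.single i 1)

/-- `∂²u/∂x_i²`. -/
def dxx (i : Fin 3) (u : SpaceTime → ℝ) : SpaceTime → ℝ := dx i (dx i u)

/-- The Laplace operator in the space variables. -/
def laplace (u : SpaceTime → ℝ) : SpaceTime → ℝ := fun w => ∑ i, dxx i u w

/-- `(∂/∂t + lam) u`. -/
def dtPlus (lam : ℝ) (u : SpaceTime → ℝ) : SpaceTime → ℝ := fun w => dt u w + lam * u w

/-- `(-∂/∂t + lam) u`, the formal adjoint of `dtPlus lam`. -/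
def dtPlusAdj (lam : ℝ) (u : SpaceTime → ℝ) : SpaceTime → ℝ := fun w => -dt u w + lam * u w

/-- `∂⁴u/∂x²∂y² + ∂⁴u/∂x²∂z² + ∂⁴u/∂y²∂z²`. -/
def mixedFourth (u : SpaceTime → ℝ) : SpaceTime → ℝ :=
  fun w => dxx 0 (dxx 1 u) w + dxx 0 (dxx 2 u) w + dxx 1 (dxx 2 u) w

/-- Left-hand side minus right-hand side of the sixth-order equation, written with a first-order
operator `D`, which is `∂/∂t + lam` in the equation itself and `-∂/∂t + lam` in its formal adjoint
(all space derivatives have even order):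
`[D⁶ - (3lam²/4) D⁴ - (lam³/4) D³] u - { c⁶ ∂⁶u/∂x²∂y²∂z² - c⁴ D² (mixedFourth u)
  + c² [D⁴ - (lam²/4) D²] Δu }`. -/
def sixthOrder (D : (SpaceTime → ℝ) → SpaceTime → ℝ) (c lam : ℝ) (u : SpaceTime → ℝ) :
    SpaceTime → ℝ := fun w =>
  (D^[6] u w - 3 * lam ^ 2 / 4 * D^[4] u w - lam ^ 3 / 4 * D^[3] u w) -
    (c ^ 6 * dxx 0 (dxx 1 (dxx 2 u)) w - c ^ 4 * D^[2] (mixedFourth u) w +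
      c ^ 2 * (D^[4] (laplace u) w - lam ^ 2 / 4 * D^[2] (laplace u) w))

/-- The one-dimensional D'Alembert operator `∂²/∂t² - c² ∂²/∂x_i²`. -/
def dAlembert (c : ℝ) (i : Fin 3) (u : SpaceTime → ℝ) : SpaceTime → ℝ :=
  fun w => dt (dt u) w - c ^ 2 * dxx i u w

/-- The telegraph-type operator `∂²/∂t² + (lam/3) ∂/∂t - (c²/3) Δ`. -/
def telegraph (c lam : ℝ) (u : SpaceTime → ℝ) : SpaceTime → ℝ :=
  fun w => dt (dt u) w + lam / 3 * dt u w - c ^ 2 / 3 * laplace u w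

end OrthogonalMotion

end

namespace OrthogonalMotion

open Set Filter Topology ENNReal Measure

noncomputable section

/-! The central object is the occupation measure μ of the motion in space-time, μ(A) = ∫ P((t,
position at t) ∈ A) dt. Splitting according to the successive directions (`lintegral_occupation`)
writes μ as a sum over finite lists of directions. Each list contributes its switching weight times
e^{-λt} times a convolution of Lebesgue measures on the space-time rays spanned by the velocities
v_i = (1, c d_i). Both halves of the theorem come from this formula.

Equation in the sense of distributions. Let μ_i be the part of μ on which the current direction is
d_i. A renewal identity (`dirOccupation_eq_conv`) yields the weak Kolmogorov equations ∫ (∂_{v_i}φ -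
λφ) dμ_i = -λ Σ_j p_ji ∫ φ dμ_j for test functions φ vanishing at the origin. Hence ∫ ψ dμ = 0
whenever there are φ_i such that (∂_{v_i} - λ)φ_i + λ Σ_j p_ij φ_j is the same function ψ for all
six i. For ψ = L*u such φ_i are explicit: with E = -∂_t + λ and Y_k = E² + (λ/2)E - c²∂_k², take φ_i
= -(E + c∂_{d_i}) Y_l Y_m u, where l, m are the two axes other than that of d_i. Constant
coefficient operators commute, so the verification is polynomial algebra (`testPoly_kolmogorov`).

Density. Convolution is commutative, so a list matters only through the number of occurrences of
each direction. Fix an octant and let u, v be the times spent forward and backward along an axis: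
the net displacement is c(u - v) and the elapsed time is (u - v) + 2v. In the coordinates given by
the three net travel times and the total backward time (`octMap`), a binomial expansion
(`lintegral_halfLinePow_sub`) turns each list into finitely many monomials with nonnegative
coefficients. Convolution powers of order zero give the singular parts, which lie on the coordinate
planes or on the surface of the octahedron and are not seen inside an octant. So μ has there the
density e^{-λt} times a power series with nonnegative coefficients. Since μ gives mass at most T to
the times up to T, this series converges everywhere (`IsStandardMotion.isEntireSeries`), and the
density is the restriction of a smooth function on the whole of space-time. This identifies the law
for almost every time; right-continuity of the paths and continuity of the density give it for every
time (`IsStandardMotion.isInteriorDensity`).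

Testing the weak equation with functions supported in one octant and integrating by parts shows that
the density is a classical solution. Conjugation with e^{λt} replaces ∂_t + λ by ∂_t and gives the
equation for q. -/

/-! ### Convolution powers of Lebesgue measure on the half-line -/

/-- The `n`-fold convolution power of Lebesgue measure on `(0, ∞)`. -/
def halfLinePow : ℕ → Measure ℝ
  | 0 => dirac 0
  | n + 1 => (volume.restrict (Ioi 0)).withDensity fun x => ENNReal.ofReal (x ^ n / n.factorial)

instance (n : ℕ) : SFinite (halfLinePow n) := by
  cases n <;> unfold halfLinePow <;> infer_instance

lemma lintegral_halfLinePow_zero (f : ℝ → ℝ≥0∞) : ∫⁻ x, f x ∂halfLinePow 0 = f 0 := by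
  simp [halfLinePow]

lemma lintegral_halfLinePow_succ (n : ℕ) {f : ℝ → ℝ≥0∞} (hf : Measurable f) :
    ∫⁻ x, f x ∂halfLinePow (n + 1) =
      ∫⁻ x in Ioi 0, ENNReal.ofReal (x ^ n / n.factorial) * f x := by
  rw [halfLinePow, lintegral_withDensity_eq_lintegral_mul _ (by fun_prop) hf]
  rfl

lemma lintegral_halfLinePow_one {f : ℝ → ℝ≥0∞} (hf : Measurable f) :
    ∫⁻ x, f x ∂halfLinePow 1 = ∫⁻ x in Ioi 0, f x := by
  simpa using lintegral_halfLinePow_succ 0 hf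

lemma setLIntegral_Ioi_add (f : ℝ → ℝ≥0∞) (y : ℝ) :
    ∫⁻ x in Ioi 0, f (x + y) = ∫⁻ z in Ioi y, f z := by
  rw [← lintegral_indicator measurableSet_Ioi, ← lintegral_indicator measurableSet_Ioi,
    ← lintegral_add_right_eq_self ((Ioi y).indicator f) y]
  congr 1 with x
  simp [indicator]

lemma lintegral_triangle_swap {g : ℝ → ℝ → ℝ≥0∞} (hg : Measurable (Function.uncurry g)) :
    ∫⁻ y in Ioi 0, ∫⁻ z in Ioi y, g y z = ∫⁻ z in Ioi 0, ∫⁻ y in Ioo 0 z, g y z := by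
  have hS : MeasurableSet {q : ℝ × ℝ | 0 < q.1 ∧ q.1 < q.2} :=
    (measurableSet_lt measurable_const measurable_fst).inter
      (measurableSet_lt measurable_fst measurable_snd)
  have h1 : ∀ y, (Ioi (0 : ℝ)).indicator (fun y => ∫⁻ z in Ioi y, g y z) y =
      ∫⁻ z, {q : ℝ × ℝ | 0 < q.1 ∧ q.1 < q.2}.indicator (Function.uncurry g) (y, z) := by
    intro y
    by_cases hy : 0 < y
    · rw [indicator_of_mem (mem_Ioi.2 hy), ← lintegral_indicator measurableSet_Ioi]
      congr 1 with z
      simp [indicator, hy, Function.uncurry]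
    · simp [indicator, hy]
  have h2 : ∀ z, (Ioi (0 : ℝ)).indicator (fun z => ∫⁻ y in Ioo 0 z, g y z) z =
      ∫⁻ y, {q : ℝ × ℝ | 0 < q.1 ∧ q.1 < q.2}.indicator (Function.uncurry g) (y, z) := by
    intro z
    by_cases hz : 0 < z
    · rw [indicator_of_mem (mem_Ioi.2 hz), ← lintegral_indicator measurableSet_Ioo]
      congr 1 with y
    · have : ∀ y : ℝ, ¬ (0 < y ∧ y < z) := fun y h => hz (h.1.trans h.2)
      simp [indicator, hz, this]
  rw [← lintegral_indicator measurableSet_Ioi, ← lintegral_indicator measurableSet_Ioi]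
  simp_rw [h1, h2]
  exact lintegral_lintegral_swap ((hg.indicator hS).aemeasurable)

lemma setLIntegral_pow_div_factorial (n : ℕ) {z : ℝ} (hz : 0 < z) :
    ∫⁻ y in Ioo 0 z, ENNReal.ofReal (y ^ n / n.factorial) =
      ENNReal.ofReal (z ^ (n + 1) / (n + 1).factorial) := by
  rw [← restrict_congr_set (Ioo_ae_eq_Ioc (μ := volume) (a := (0 : ℝ)) (b := z)).symm,
    ← ofReal_integral_eq_lintegral_ofReal, ← intervalIntegral.integral_of_le hz.le]
  · congr 1
    rw [intervalIntegral.integral_div, integral_pow, Nat.factorial_succ]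
    push_cast
    field_simp
    simp
  · exact (Continuous.integrableOn_Icc (by fun_prop)).mono_set Ioc_subset_Icc_self
  · filter_upwards [ae_restrict_mem measurableSet_Ioc] with y hy
    have := hy.1.le
    positivity

/-- Convolving with Lebesgue measure on the half-line integrates the density: after Tonelli on the
triangle 0 < y < z, the primitive of y^n / n! is z^(n+1) / (n+1)!. -/
lemma lintegral_halfLinePow_one_add (n : ℕ) {f : ℝ → ℝ≥0∞} (hf : Measurable f) :
    ∫⁻ x, ∫⁻ y, f (x + y) ∂halfLinePow n ∂halfLinePow 1 = ∫⁻ z, f z ∂halfLinePow (n + 1) := by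
  cases n with
  | zero => simp [lintegral_halfLinePow_zero]
  | succ n =>
    rw [lintegral_lintegral_swap (by fun_prop), lintegral_halfLinePow_succ _ (by fun_prop),
      lintegral_halfLinePow_succ _ hf]
    have : ∀ y, ∫⁻ x, f (x + y) ∂halfLinePow 1 = ∫⁻ z in Ioi y, f z := fun y => by
      rw [lintegral_halfLinePow_one (by fun_prop), setLIntegral_Ioi_add]
    simp_rw [this, ← lintegral_const_mul _ hf]
    rw [lintegral_triangle_swap (by unfold Function.uncurry; fun_prop)]
    refine setLIntegral_congr_fun measurableSet_Ioi fun z hz => ?_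
    rw [lintegral_mul_const _ (by fun_prop), setLIntegral_pow_div_factorial n hz]

lemma lintegral_halfLinePow_add (a b : ℕ) {f : ℝ → ℝ≥0∞} (hf : Measurable f) :
    ∫⁻ x, ∫⁻ y, f (x + y) ∂halfLinePow b ∂halfLinePow a = ∫⁻ z, f z ∂halfLinePow (a + b) := by
  induction a generalizing f with
  | zero => simp [lintegral_halfLinePow_zero]
  | succ a ih =>
    rw [← lintegral_halfLinePow_one_add a (by fun_prop), show a + 1 + b = a + b + 1 by ring,
      ← lintegral_halfLinePow_one_add _ hf]
    refine lintegral_congr fun x => ?_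
    rw [← ih (by fun_prop)]
    simp_rw [add_assoc]

lemma halfLinePow_conv (a b : ℕ) :
    (halfLinePow a).conv (halfLinePow b) = halfLinePow (a + b) :=
  ext_of_lintegral _ fun f hf => by rw [lintegral_conv hf, lintegral_halfLinePow_add a b hf]

lemma ae_halfLinePow_nonneg (n : ℕ) : ∀ᵐ x ∂halfLinePow n, 0 ≤ x := by
  cases n with
  | zero => simp [halfLinePow]
  | succ n =>
    refine (withDensity_absolutelyContinuous _ _).ae_le ?_
    filter_upwards [ae_restrict_mem measurableSet_Ioi] with x hx using hx.le

/-- Multiplying the `b`-th convolution power by `x ^ j / j!` gives a multiple of the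
`(b + j)`-th one. -/
lemma lintegral_pow_mul_halfLinePow (b j : ℕ) {f : ℝ → ℝ≥0∞} (hf : Measurable f) :
    ∫⁻ x, ENNReal.ofReal (x ^ j / j.factorial) * f x ∂halfLinePow b =
      b.multichoose j * ∫⁻ x, f x ∂halfLinePow (b + j) := by
  cases b with
  -- Order zero is the unit mass at 0, where x^j / j! vanishes unless j = 0; this matches
  -- `Nat.multichoose 0 j`.
  | zero => cases j <;> simp [lintegral_halfLinePow_zero]
  | succ b =>
    rw [lintegral_halfLinePow_succ _ (by fun_prop), show b + 1 + j = b + j + 1 by ring,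
      lintegral_halfLinePow_succ _ hf, ← lintegral_const_mul _ (by fun_prop)]
    refine setLIntegral_congr_fun measurableSet_Ioi fun x hx => ?_
    have hx : 0 < x := hx
    rw [← mul_assoc, ← mul_assoc, ← ENNReal.ofReal_mul (by positivity),
      ← ENNReal.ofReal_natCast, ← ENNReal.ofReal_mul (by positivity)]
    congr 2
    -- The product of x^b / b! and x^j / j! is binom(b+j, j) x^(b+j) / (b+j)!, and this binomial
    -- coefficient is `(b + 1).multichoose j`.
    have := Nat.add_choose_mul_factorial_mul_factorial b j
    rw [Nat.multichoose_eq, show b + 1 + j - 1 = b + j by omega]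
    have h' : ((b + j).choose j : ℝ) * b.factorial * j.factorial = (b + j).factorial := by
      exact_mod_cast this
    rw [← h', pow_add]
    have h0 : ((b + j).choose j : ℝ) ≠ 0 := by
      exact_mod_cast (Nat.choose_pos (Nat.le_add_left j b)).ne'
    field_simp

lemma add_pow_div_factorial (n : ℕ) (x y : ℝ) :
    (x + y) ^ n / n.factorial =
      ∑ j ∈ Finset.range (n + 1), x ^ (n - j) / (n - j).factorial * (y ^ j / j.factorial) := by
  rw [add_comm, add_pow, Finset.sum_div]
  refine Finset.sum_congr rfl fun j hj => ?_
  have hj : j ≤ n := by simpa [Nat.lt_succ_iff] using hj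
  rw [← Nat.choose_mul_factorial_mul_factorial hj]
  have h0 : (n.choose j : ℝ) ≠ 0 := by exact_mod_cast (Nat.choose_pos hj).ne'
  push_cast
  field_simp

/-- The measure `halfLinePow a × halfLinePow b` on `{(u, v) | v < u}`, in the coordinates
`(u - v, v)`. -/
lemma lintegral_halfLinePow_sub (a b : ℕ) {f : ℝ → ℝ → ℝ≥0∞}
    (hf : Measurable (Function.uncurry f)) (hf0 : ∀ x r, x ≤ 0 → f x r = 0) :
    ∫⁻ u, ∫⁻ v, f (u - v) v ∂halfLinePow b ∂halfLinePow a =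
      ∑ j ∈ Finset.range a, b.multichoose j *
        ∫⁻ x, ∫⁻ r, f x r ∂halfLinePow (b + j) ∂halfLinePow (a - j) := by
  have hf1 : ∀ x, Measurable (f x) := fun x => hf.comp measurable_prodMk_left
  have hfc : ∀ {g h : ℝ × ℝ → ℝ}, Measurable g → Measurable h →
      Measurable fun q => f (g q) (h q) := fun hg hh => hf.comp (hg.prodMk hh)
  cases a with
  -- For a = 0 the variable u is 0, so the first argument of f is -v ≤ 0 and the integrand vanishes,
  -- in agreement with the empty sum.
  | zero =>
    simp only [lintegral_halfLinePow_zero, Finset.range_zero, Finset.sum_empty]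
    rw [lintegral_congr_ae (g := fun _ => 0), lintegral_zero]
    filter_upwards [ae_halfLinePow_nonneg b] with v hv
    exact hf0 _ _ (by linarith)
  | succ n =>
    have hm : Measurable (Function.uncurry fun u v : ℝ => f (u - v) v) :=
      hfc (g := fun q => q.1 - q.2) (by fun_prop) (by fun_prop)
    have hmm : Measurable (Function.uncurry fun x v : ℝ =>
        ENNReal.ofReal ((x + v) ^ n / n.factorial) * f x v) := by
      unfold Function.uncurry
      exact Measurable.mul (by fun_prop) hf
    have hm1 : ∀ v, Measurable fun x => f x v := fun v => hf.comp measurable_prodMk_right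
    -- Substitution u = x + v. The part x ≤ 0 disappears because f vanishes there, so only the range
    -- x > 0 remains, independently of v.
    have key : ∀ v, 0 ≤ v → ∫⁻ u, f (u - v) v ∂halfLinePow (n + 1) =
        ∫⁻ x in Ioi 0, ENNReal.ofReal ((x + v) ^ n / n.factorial) * f x v := by
      intro v hv
      rw [lintegral_halfLinePow_succ _ (by exact (hm1 v).comp (by fun_prop)),
        ← lintegral_indicator measurableSet_Ioi, ← lintegral_indicator measurableSet_Ioi,
        ← lintegral_add_right_eq_self _ v]
      congr 1 with x
      by_cases hx : 0 < x
      · simp [indicator, hx, show 0 < x + v by linarith]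
      · simp [indicator, hx, hf0 x v (not_lt.1 hx)]
    rw [lintegral_lintegral_swap hm.aemeasurable,
      lintegral_congr_ae (by filter_upwards [ae_halfLinePow_nonneg b] with v hv using key v hv),
      lintegral_lintegral_swap (f := fun v x =>
        ENNReal.ofReal ((x + v) ^ n / n.factorial) * f x v)
        (Measurable.aemeasurable (hmm.comp measurable_swap))]
    -- Binomial expansion of (x + v)^n / n!: the factor v^j / j! raises the order in v from b to b +
    -- j, while x^(n-j) / (n-j)! is the density of order n + 1 - j in x.
    have expand : ∀ x ∈ Ioi (0 : ℝ),
        ∫⁻ v, ENNReal.ofReal ((x + v) ^ n / n.factorial) * f x v ∂halfLinePow b =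
        ∑ j ∈ Finset.range (n + 1), ENNReal.ofReal (x ^ (n - j) / (n - j).factorial) *
          (b.multichoose j * ∫⁻ r, f x r ∂halfLinePow (b + j)) := by
      intro x hx
      have hx : 0 < x := hx
      simp_rw [← lintegral_pow_mul_halfLinePow b _ (hf1 x)]
      have hme : ∀ j : ℕ, Measurable fun v : ℝ =>
          ENNReal.ofReal (v ^ j / j.factorial) * f x v := fun j =>
        Measurable.mul (by fun_prop) (hf1 x)
      simp_rw [← lintegral_const_mul _ (hme _)]
      rw [← lintegral_finsetSum _ (fun j _ => (hme j).const_mul _)]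
      refine lintegral_congr_ae ?_
      filter_upwards [ae_halfLinePow_nonneg b] with v hv
      rw [add_pow_div_factorial, ENNReal.ofReal_sum_of_nonneg (fun j _ => by positivity),
        Finset.sum_mul]
      refine Finset.sum_congr rfl fun j _ => ?_
      rw [ENNReal.ofReal_mul (by positivity), mul_assoc]
    rw [setLIntegral_congr_fun measurableSet_Ioi expand]
    have hmi : ∀ k : ℕ, Measurable fun x => ∫⁻ r, f x r ∂halfLinePow k := fun k =>
      Measurable.lintegral_prod_right hf
    have hms : ∀ j, Measurable fun x => ENNReal.ofReal (x ^ (n - j) / (n - j).factorial) *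
        (b.multichoose j * ∫⁻ r, f x r ∂halfLinePow (b + j)) := fun j =>
      Measurable.mul (by fun_prop) ((hmi _).const_mul _)
    rw [lintegral_finsetSum _ fun j _ => hms j]
    refine Finset.sum_congr rfl fun j hj => ?_
    have hj : j ≤ n := by simpa [Nat.lt_succ_iff] using hj
    rw [show n + 1 - j = n - j + 1 by omega, lintegral_halfLinePow_succ _ (hmi _),
      ← lintegral_const_mul' _ _ (ENNReal.natCast_ne_top _)]
    refine lintegral_congr fun x => ?_
    ring

section

/-! ### Entire multivariate exponential series -/

section Series

variable {ι J : Type*} [Fintype ι]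

/-- The normalized monomial `∏ u_i ^ n_i / n_i!`. -/
def expMonomial (n : ι → ℕ) (u : ι → ℝ) : ℝ := ∏ i, u i ^ n i / (n i).factorial

/-- The series with coefficients `C` and exponents `n` converges absolutely everywhere. -/
def IsEntireSeries (C : J → ℝ) (n : J → ι → ℕ) : Prop :=
  ∀ R : ℝ, 0 < R → Summable fun j => |C j| * expMonomial (n j) fun _ => R

/-- The sum of the series of normalized monomials with coefficients `C` and exponents `n`. -/
def seriesSum (C : J → ℝ) (n : J → ι → ℕ) (u : ι → ℝ) : ℝ := ∑' j, C j * expMonomial (n j) u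

lemma expMonomial_nonneg (n : ι → ℕ) {u : ι → ℝ} (hu : ∀ i, 0 ≤ u i) : 0 ≤ expMonomial n u :=
  Finset.prod_nonneg fun i _ => by have := hu i; positivity

lemma abs_expMonomial_le (n : ι → ℕ) {u : ι → ℝ} {R : ℝ} (hu : ∀ i, |u i| ≤ R) :
    |expMonomial n u| ≤ expMonomial n fun _ => R := by
  unfold expMonomial
  rw [Finset.abs_prod]
  refine Finset.prod_le_prod (fun i _ => abs_nonneg _) fun i _ => ?_
  rw [abs_div, abs_pow, Nat.abs_cast]
  have := hu i
  gcongr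

lemma IsEntireSeries.summable {C : J → ℝ} {n : J → ι → ℕ} (h : IsEntireSeries C n) (u : ι → ℝ) :
    Summable fun j => C j * expMonomial (n j) u := by
  refine Summable.of_norm_bounded (h (‖u‖ + 1) (by positivity)) fun j => ?_
  rw [Real.norm_eq_abs, abs_mul]
  gcongr
  exact abs_expMonomial_le _ fun i => (norm_le_pi_norm u i).trans (by linarith)

variable [DecidableEq ι]

lemma expMonomial_update (n : ι → ℕ) (u : ι → ℝ) (i : ι) (m : ℕ) :
    expMonomial (Function.update n i m) u =
      (∏ k ∈ Finset.univ.erase i, u k ^ n k / (n k).factorial) * (u i ^ m / m.factorial) := by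
  unfold expMonomial
  rw [← Finset.prod_erase_mul _ _ (Finset.mem_univ i)]
  congr 1
  · refine Finset.prod_congr rfl fun k hk => ?_
    rw [Function.update_of_ne (Finset.ne_of_mem_erase hk)]
  · simp

lemma expMonomial_eq (n : ι → ℕ) (u : ι → ℝ) (i : ι) :
    expMonomial n u =
      (∏ k ∈ Finset.univ.erase i, u k ^ n k / (n k).factorial) *
        (u i ^ n i / (n i).factorial) := by
  rw [← expMonomial_update, Function.update_eq_self]

/-- The coefficients of the `i`-th partial derivative. -/
def derivCoeff (C : J → ℝ) (n : J → ι → ℕ) (i : ι) (j : J) : ℝ := if n j i = 0 then 0 else C j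

/-- The exponents of the `i`-th partial derivative. -/
def derivExponent (n : J → ι → ℕ) (i : ι) (j : J) : ι → ℕ :=
  Function.update (n j) i (n j i - 1)

/-- Lowering the exponent m + 1 costs a factor m + 1 ≤ 2^(m+1), so R^m / m! ≤ R⁻¹ (2R)^(m+1) /
(m+1)!: the series at 2R dominates the derived series at R. -/
lemma IsEntireSeries.deriv {C : J → ℝ} {n : J → ι → ℕ} (h : IsEntireSeries C n) (i : ι) :
    IsEntireSeries (derivCoeff C n i) (derivExponent n i) := by
  intro R hR
  have h2 := (h (2 * R) (by positivity)).mul_left R⁻¹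
  refine Summable.of_nonneg_of_le (fun j => ?_) (fun j => ?_) h2
  · exact mul_nonneg (abs_nonneg _) (expMonomial_nonneg _ fun _ => hR.le)
  · unfold derivCoeff
    split_ifs with h0
    · simp only [abs_zero, zero_mul]
      exact mul_nonneg (by positivity) (mul_nonneg (abs_nonneg _)
        (expMonomial_nonneg _ fun _ => by positivity))
    · obtain ⟨m, hm⟩ := Nat.exists_eq_succ_of_ne_zero h0
      rw [derivExponent, expMonomial_update, expMonomial_eq (n j) _ i, mul_left_comm R⁻¹]
      refine mul_le_mul_of_nonneg_left ?_ (abs_nonneg _)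
      rw [mul_left_comm]
      have hP : (∏ k ∈ Finset.univ.erase i, R ^ n j k / ((n j k).factorial : ℝ)) ≤
          ∏ k ∈ Finset.univ.erase i, (2 * R) ^ n j k / ((n j k).factorial : ℝ) := by
        refine Finset.prod_le_prod (fun k _ => by positivity) fun k _ => ?_
        gcongr
        linarith
      refine mul_le_mul hP ?_ (by positivity) (Finset.prod_nonneg fun k _ => by positivity)
      rw [hm, Nat.succ_sub_one, Nat.succ_eq_add_one, Nat.factorial_succ, mul_pow, pow_succ R]
      have h2 : ((m + 1 : ℕ) : ℝ) ≤ 2 ^ (m + 1) := by exact_mod_cast (Nat.lt_two_pow_self).le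
      have : R⁻¹ * (2 ^ (m + 1) * (R ^ m * R) / ((m + 1 : ℕ) * m.factorial : ℕ)) =
          (2 ^ (m + 1) / (m + 1 : ℕ)) * (R ^ m / m.factorial) := by
        push_cast
        field_simp
      rw [this]
      refine le_mul_of_one_le_left (by positivity) ?_
      rwa [one_le_div (by positivity)]

lemma hasFDerivAt_mul_expMonomial (C : J → ℝ) (n : J → ι → ℕ) (j : J) (u : ι → ℝ) :
    HasFDerivAt (fun u => C j * expMonomial (n j) u)
      (∑ i, (derivCoeff C n i j * expMonomial (derivExponent n i j) u) •
        (ContinuousLinearMap.proj i : (ι → ℝ) →L[ℝ] ℝ)) u := by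
  have hi : ∀ i, HasFDerivAt (fun u : ι → ℝ => u i ^ n j i / ((n j i).factorial : ℝ))
      ((if n j i = 0 then 0 else u i ^ (n j i - 1) / ((n j i - 1).factorial : ℝ)) •
        (ContinuousLinearMap.proj i : (ι → ℝ) →L[ℝ] ℝ)) u := by
    intro i
    have h1 : HasDerivAt (fun x : ℝ => x ^ n j i / ((n j i).factorial : ℝ))
        (if n j i = 0 then 0 else u i ^ (n j i - 1) / ((n j i - 1).factorial : ℝ)) (u i) := by
      convert! (hasDerivAt_pow (n j i) (u i)).div_const ((n j i).factorial : ℝ) using 1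
      split_ifs with h0
      · simp [h0]
      · obtain ⟨m, hm⟩ := Nat.exists_eq_succ_of_ne_zero h0
        rw [hm, Nat.succ_sub_one, Nat.succ_eq_add_one, Nat.factorial_succ]
        push_cast
        field_simp
    exact h1.comp_hasFDerivAt u
      (ContinuousLinearMap.hasFDerivAt (ContinuousLinearMap.proj i : (ι → ℝ) →L[ℝ] ℝ))
  convert! (HasFDerivAt.finsetProd (u := Finset.univ) fun i _ => hi i).const_mul (C j) using 1
  rw [Finset.smul_sum]
  refine Finset.sum_congr rfl fun i _ => ?_
  rw [smul_smul, smul_smul, derivExponent, expMonomial_update, derivCoeff]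
  congr 1
  split_ifs <;> ring

/-- Termwise differentiation on a ball of radius R = ‖u‖ + 1, with the partial derivative series at
R as uniform majorant. -/
lemma IsEntireSeries.hasFDerivAt {C : J → ℝ} {n : J → ι → ℕ} (h : IsEntireSeries C n)
    (u : ι → ℝ) :
    HasFDerivAt (seriesSum C n)
      (∑ i, seriesSum (derivCoeff C n i) (derivExponent n i) u •
        (ContinuousLinearMap.proj i : (ι → ℝ) →L[ℝ] ℝ)) u := by
  set R := ‖u‖ + 1 with hR
  have hR0 : 0 < R := by positivity
  have hsum : HasSum (fun j => ∑ i, (derivCoeff C n i j * expMonomial (derivExponent n i j) u) •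
        (ContinuousLinearMap.proj i : (ι → ℝ) →L[ℝ] ℝ))
      (∑ i, seriesSum (derivCoeff C n i) (derivExponent n i) u •
        (ContinuousLinearMap.proj i : (ι → ℝ) →L[ℝ] ℝ)) :=
    hasSum_sum fun i _ => ((h.deriv i).summable u).hasSum.smul_const _
  rw [← hsum.tsum_eq]
  refine hasFDerivAt_tsum_of_isPreconnected (s := Metric.ball 0 R) (x₀ := u)
    (summable_sum (s := Finset.univ) fun i _ => h.deriv i R hR0) Metric.isOpen_ball
    (convex_ball _ _).isPreconnected
    (fun j x _ => hasFDerivAt_mul_expMonomial C n j x) (fun j x hx => ?_) (by simp [hR])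
    (h.summable u) (by simp [hR])
  refine (norm_sum_le _ _).trans (Finset.sum_le_sum fun i _ => ?_)
  rw [norm_smul, Real.norm_eq_abs, abs_mul]
  have hp : ‖(ContinuousLinearMap.proj i : (ι → ℝ) →L[ℝ] ℝ)‖ ≤ 1 :=
    ContinuousLinearMap.opNorm_le_bound _ zero_le_one fun x => by
      simpa using norm_le_pi_norm x i
  have hx : ‖x‖ < R := by simpa using hx
  have hm := abs_expMonomial_le (derivExponent n i j) (u := x) (R := R)
    fun k => (norm_le_pi_norm x k).trans hx.le
  calc _ ≤ |derivCoeff C n i j| * (expMonomial (derivExponent n i j) fun _ => R) * 1 := by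
        gcongr
        exact mul_nonneg (abs_nonneg _) ((abs_nonneg _).trans hm)
    _ = _ := mul_one _

/-- The partial derivatives are again entire series, so the induction on the order runs over all
coefficients and exponents at once. -/
lemma IsEntireSeries.contDiff {C : J → ℝ} {n : J → ι → ℕ} (h : IsEntireSeries C n) :
    ContDiff ℝ (⊤ : ℕ∞) (seriesSum C n) := by
  rw [contDiff_infty]
  intro k
  induction k generalizing C n with
  | zero =>
    exact contDiff_zero.2 (continuous_iff_continuousAt.2 fun u => (h.hasFDerivAt u).continuousAt)
  | succ k ih =>
    rw [Nat.cast_succ, contDiff_succ_iff_fderiv]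
    refine ⟨fun u => (h.hasFDerivAt u).differentiableAt, by simp, ?_⟩
    rw [show fderiv ℝ (seriesSum C n) = _ from funext fun u => (h.hasFDerivAt u).fderiv]
    exact ContDiff.sum fun i _ => (ih (h.deriv i)).smul contDiff_const

end Series

end

section

/-! ### Path measures -/

/-- The space-time velocity of a particle that travels along the `i`-th direction. -/
def velocity (c : ℝ) (i : Fin 6) : SpaceTime := (1, c • direction i)

@[simp] lemma velocity_fst (c : ℝ) (i : Fin 6) : (velocity c i).1 = 1 := rfl

/-- The `n`-th convolution power of Lebesgue measure on the ray spanned by `velocity c i`. -/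
def rayPow (c : ℝ) (i : Fin 6) (n : ℕ) : Measure SpaceTime :=
  (halfLinePow n).map fun s => s • velocity c i

instance (c : ℝ) (i : Fin 6) (n : ℕ) : SFinite (rayPow c i n) := by
  unfold rayPow; infer_instance

/-- The convolution of Lebesgue measures on the rays of the directions in a list. -/
def pathMeasure (c : ℝ) : List (Fin 6) → Measure SpaceTime
  | [] => dirac 0
  | i :: l => (rayPow c i 1).conv (pathMeasure c l)

instance (c : ℝ) (l : List (Fin 6)) : SFinite (pathMeasure c l) := by
  induction l with
  | nil => unfold pathMeasure; infer_instance
  | cons i l ih => unfold pathMeasure; infer_instance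

lemma lintegral_pathMeasure_nil (c : ℝ) (F : SpaceTime → ℝ≥0∞) :
    ∫⁻ z, F z ∂pathMeasure c [] = F 0 := by
  simp [pathMeasure]

lemma lintegral_rayPow_one (c : ℝ) (i : Fin 6) {F : SpaceTime → ℝ≥0∞} (hF : Measurable F) :
    ∫⁻ z, F z ∂rayPow c i 1 = ∫⁻ s in Ioi (0 : ℝ), F (s • velocity c i) := by
  rw [rayPow, lintegral_map hF (by fun_prop), lintegral_halfLinePow_one (by fun_prop)]

lemma lintegral_pathMeasure_cons (c : ℝ) (i : Fin 6) (l : List (Fin 6))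
    {F : SpaceTime → ℝ≥0∞} (hF : Measurable F) :
    ∫⁻ z, F z ∂pathMeasure c (i :: l) =
      ∫⁻ z, ∫⁻ s in Ioi (0 : ℝ), F (z + s • velocity c i) ∂volume ∂pathMeasure c l := by
  rw [pathMeasure, conv_comm, lintegral_conv hF]
  refine lintegral_congr fun z => ?_
  rw [lintegral_rayPow_one c i (by fun_prop)]

/-! ### Histories of directions and their weights. -/

/-- The weight of a list of directions (the last direction comes first), for switches at
rate `lam`. -/
def pathWeight (lam : ℝ) : List (Fin 6) → ℝ≥0∞
  -- The particle always has a current direction; weight zero removes the empty history from sums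
  -- over all lists.
  | [] => 0
  | [_] => ENNReal.ofReal (1 / 6)
  | i :: j :: l => ENNReal.ofReal (lam * switchProb j i) * pathWeight lam (j :: l)

/-- The list of the first `n` terms of a sequence, in reverse order. -/
def history (v : ℕ → Fin 6) : ℕ → List (Fin 6)
  | 0 => []
  | n + 1 => v n :: history v n

lemma length_history (v : ℕ → Fin 6) (n : ℕ) : (history v n).length = n := by
  induction n with
  | zero => rfl
  | succ n ih => simp [history, ih]

lemma history_eq_iff (v w : ℕ → Fin 6) (n : ℕ) :
    history v n = history w n ↔ ∀ k < n, v k = w k := by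
  induction n with
  | zero => simp [history]
  | succ n ih =>
    rw [history, history, List.cons.injEq, ih, and_comm, Nat.forall_lt_succ_right]

lemma exists_history_eq (l : List (Fin 6)) : ∃ v, history v l.length = l := by
  induction l with
  | nil => exact ⟨fun _ => 0, rfl⟩
  | cons i l ih =>
    obtain ⟨v, hv⟩ := ih
    refine ⟨Function.update v l.length i, ?_⟩
    rw [List.length_cons, history, Function.update_self]
    congr 1
    conv_rhs => rw [← hv]
    rw [history_eq_iff]
    intro k hk
    rw [Function.update_of_ne hk.ne]

lemma switchProb_nonneg (i j : Fin 6) : 0 ≤ switchProb i j := by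
  unfold switchProb; split_ifs <;> norm_num

/-- Rates and directions separate: λ^n comes from the densities of the n completed waiting times,
and the other factor is the probability appearing in `law_dir`. -/
lemma pathWeight_history {lam : ℝ} (hlam : 0 < lam) (v : ℕ → Fin 6) (n : ℕ) :
    pathWeight lam (history v (n + 1)) = ENNReal.ofReal (lam ^ n) *
      ENNReal.ofReal (1 / 6 * ∏ k ∈ Finset.range n, switchProb (v k) (v (k + 1))) := by
  induction n with
  | zero => simp [history, pathWeight]
  | succ n ih =>
    have h0 : ∀ n, 0 ≤ ∏ k ∈ Finset.range n, switchProb (v k) (v (k + 1)) := fun n =>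
      Finset.prod_nonneg fun k _ => switchProb_nonneg _ _
    have := h0 n
    have := switchProb_nonneg (v n) (v (n + 1))
    rw [history, history, pathWeight, ← history, ih, ← ENNReal.ofReal_mul (by positivity),
      ← ENNReal.ofReal_mul (by positivity), ← ENNReal.ofReal_mul (by positivity),
      Finset.prod_range_succ]
    congr 1
    ring

/-- The space-time position after `n` complete displacements. -/
def pathSum (c : ℝ) (x : ℕ → ℝ) (v : ℕ → Fin 6) (n : ℕ) : SpaceTime :=
  ∑ k ∈ Finset.range n, x k • velocity c (v k)

lemma pathSum_succ (c : ℝ) (x : ℕ → ℝ) (v : ℕ → Fin 6) (n : ℕ) :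
    pathSum c x v (n + 1) = pathSum c x v n + x n • velocity c (v n) :=
  Finset.sum_range_succ _ _

lemma lintegral_expMeasure {lam : ℝ} {f : ℝ → ℝ≥0∞} (hf : Measurable f) :
    ∫⁻ x, f x ∂expMeasure lam =
      ∫⁻ x in Ioi (0 : ℝ), ENNReal.ofReal (lam * Real.exp (-lam * x)) * f x := by
  have h : expMeasure lam = volume.withDensity (exponentialPDF lam) := rfl
  have hm : Measurable (exponentialPDF lam) :=
    (measurable_exponentialPDFReal lam).ennreal_ofReal
  rw [h, lintegral_withDensity_eq_lintegral_mul _ hm hf,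
    ← lintegral_indicator measurableSet_Ioi]
  refine lintegral_congr_ae ?_
  filter_upwards [measure_eq_zero_iff_ae_notMem.1 (measure_singleton (μ := volume) (0 : ℝ))] with x hx
  rcases lt_trichotomy x 0 with h | h | h
  · simp [exponentialPDF_of_neg h, h.le]
  · exact absurd h hx
  · simp [exponentialPDF_of_nonneg h.le, h, neg_mul]

/-! ### Expectations along paths with given or random directions. -/

section Motion

variable {Ω : Type*} [MeasurableSpace Ω] {P : Measure Ω} {lam : ℝ} {τ : ℕ → Ω → ℝ}
  {V : ℕ → Ω → Fin 6}

lemma IsStandardMotion.measurable_pathSum (h : IsStandardMotion P lam τ V) (c : ℝ)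
    (v : ℕ → Fin 6) (n : ℕ) : Measurable fun ω => pathSum c (fun k => τ k ω) v n := by
  have := h.measurable_wait
  unfold pathSum
  fun_prop

/-- The point reached after n displacements depends only on the first n waiting times, hence is
independent of the next one, which can be integrated separately. -/
lemma IsStandardMotion.lintegral_pathSum_wait [IsProbabilityMeasure P]
    (h : IsStandardMotion P lam τ V) (c : ℝ)
    (v : ℕ → Fin 6) (n : ℕ) {G : SpaceTime → ℝ → ℝ≥0∞} (hG : Measurable (Function.uncurry G)) :
    ∫⁻ ω, G (pathSum c (fun k => τ k ω) v n) (τ n ω) ∂P =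
      ∫⁻ ω, ∫⁻ x, G (pathSum c (fun k => τ k ω) v n) x ∂expMeasure lam ∂P := by
  have hmv : ∀ k, Measurable fun x : ℝ => x • velocity c (v k) := fun k => by fun_prop
  have hind := h.indep_wait.comp (fun k x => x • velocity c (v k)) hmv
  -- Independence is applied to the displacement vectors; the waiting time itself is recovered as
  -- the time coordinate of the last one.
  have h1 := (hind.indepFun_finsetSum_of_notMem
    (fun k => (hmv k).comp (h.measurable_wait k)) (s := Finset.range n) (i := n)
    (by simp)).comp measurable_id (measurable_fst (α := ℝ) (β := Fin 3 → ℝ))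
  have h2 : IndepFun (fun ω => pathSum c (fun k => τ k ω) v n) (τ n) P := by
    convert h1 using 1
    · ext1 ω; simp [pathSum]
    · ext1 ω; simp
  have hS := h.measurable_pathSum c v n
  have h3 := (indepFun_iff_map_prod_eq_prod_map_map hS.aemeasurable
    (h.measurable_wait n).aemeasurable).1 h2
  have : IsProbabilityMeasure (expMeasure lam) := by
    rw [← h.law_wait n]; exact isProbabilityMeasure_map (h.measurable_wait n).aemeasurable
  rw [h.law_wait] at h3
  calc _ = ∫⁻ q, Function.uncurry G q
        ∂(P.map fun ω => (pathSum c (fun k => τ k ω) v n, τ n ω)) := by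
        rw [lintegral_map hG (hS.prodMk (h.measurable_wait n))]; rfl
    _ = _ := by
      rw [h3, lintegral_prod _ hG.aemeasurable,
        lintegral_map (f := fun z => ∫⁻ x, Function.uncurry G (z, x) ∂expMeasure lam)
          (Measurable.lintegral_prod_right hG) hS]
      rfl

lemma ofReal_exp_neg_add (a b lam : ℝ) : ENNReal.ofReal (Real.exp (-lam * (a + b))) =
    ENNReal.ofReal (Real.exp (-lam * a)) * ENNReal.ofReal (Real.exp (-lam * b)) := by
  rw [← ENNReal.ofReal_mul (Real.exp_nonneg _), ← Real.exp_add, mul_add]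

/-- The factor exp(-λt) is multiplicative under the addition of space-time points, so it splits
between the earlier path and the newest displacement. -/
lemma lintegral_exp_pathMeasure_cons (c lam : ℝ) (i : Fin 6) (l : List (Fin 6))
    {F : SpaceTime → ℝ≥0∞} (hF : Measurable F) :
    ∫⁻ z, ENNReal.ofReal (Real.exp (-lam * z.1)) * F z ∂pathMeasure c (i :: l) =
      ∫⁻ z, ENNReal.ofReal (Real.exp (-lam * z.1)) * ∫⁻ s in Ioi (0 : ℝ),
        ENNReal.ofReal (Real.exp (-lam * s)) * F (z + s • velocity c i) ∂volume ∂pathMeasure c l := by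
  rw [lintegral_pathMeasure_cons c i l (by fun_prop)]
  refine lintegral_congr fun z => ?_
  rw [← lintegral_const_mul _ (by fun_prop)]
  refine lintegral_congr fun s => ?_
  rw [← mul_assoc, ← ofReal_exp_neg_add]
  simp

/-- The joint density λ^n exp(-λ Σ τ_k) of the waiting times depends on them only through the total
time, which is the time coordinate of the end point. So the law of the end point is a weighted path
measure. -/
lemma IsStandardMotion.lintegral_pathSum [IsProbabilityMeasure P] (hlam : 0 < lam)
    (h : IsStandardMotion P lam τ V) (c : ℝ)
    (v : ℕ → Fin 6) (n : ℕ) {F : SpaceTime → ℝ≥0∞} (hF : Measurable F) :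
    ∫⁻ ω, F (pathSum c (fun k => τ k ω) v n) ∂P = ENNReal.ofReal (lam ^ n) *
      ∫⁻ z, ENNReal.ofReal (Real.exp (-lam * z.1)) * F z ∂pathMeasure c (history v n) := by
  induction n generalizing F with
  | zero => simp [pathSum, history, lintegral_pathMeasure_nil]
  | succ n ih =>
    simp_rw [pathSum_succ]
    rw [h.lintegral_pathSum_wait c v n (G := fun z x => F (z + x • velocity c (v n)))
      (by unfold Function.uncurry; fun_prop)]
    have : IsProbabilityMeasure (expMeasure lam) := isProbabilityMeasure_expMeasure hlam
    rw [ih (F := fun z => ∫⁻ x, F (z + x • velocity c (v n)) ∂expMeasure lam)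
      (Measurable.lintegral_prod_right (by unfold Function.uncurry; fun_prop)), history,
      lintegral_exp_pathMeasure_cons _ _ _ _ hF, pow_succ, ENNReal.ofReal_mul (by positivity),
      mul_assoc]
    congr 1
    rw [← lintegral_const_mul' _ _ ENNReal.ofReal_ne_top]
    refine lintegral_congr fun z => ?_
    rw [lintegral_expMeasure (by fun_prop), mul_left_comm]
    congr 1
    rw [← lintegral_const_mul' _ _ ENNReal.ofReal_ne_top]
    refine lintegral_congr fun s => ?_
    rw [ENNReal.ofReal_mul hlam.le, mul_assoc]

/-- The total time that the incomplete displacement after the path `v` spends in a set,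
integrated version. -/
lemma IsStandardMotion.lintegral_pathSum_segment [IsProbabilityMeasure P] (hlam : 0 < lam)
    (h : IsStandardMotion P lam τ V) (c : ℝ)
    (v : ℕ → Fin 6) (n : ℕ) {F : SpaceTime → ℝ≥0∞} (hF : Measurable F) :
    ∫⁻ ω, ∫⁻ s in Ioi (0 : ℝ), (if s < τ n ω then
        F (pathSum c (fun k => τ k ω) v n + s • velocity c (v n)) else 0) ∂volume ∂P =
      ENNReal.ofReal (lam ^ n) * ∫⁻ z, ENNReal.ofReal (Real.exp (-lam * z.1)) * F z
        ∂pathMeasure c (history v (n + 1)) := by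
  have hG : Measurable fun q : (SpaceTime × ℝ) × ℝ => if q.2 < q.1.2 then
        F (q.1.1 + q.2 • velocity c (v n)) else 0 :=
    Measurable.ite (measurableSet_lt (by fun_prop) (by fun_prop)) (by fun_prop) measurable_const
  rw [h.lintegral_pathSum_wait c v n (G := fun z x => ∫⁻ s in Ioi (0 : ℝ), if s < x then
        F (z + s • velocity c (v n)) else 0) (Measurable.lintegral_prod_right hG)]
  have : IsProbabilityMeasure (expMeasure lam) := isProbabilityMeasure_expMeasure hlam
  -- Integrating out the waiting time replaces the constraint s < τ_n by its probability exp(-λs);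
  -- this is why the incomplete displacement carries no factor λ.
  have key : ∀ z, ∫⁻ x, ∫⁻ s in Ioi (0 : ℝ), (if s < x then
        F (z + s • velocity c (v n)) else 0) ∂volume ∂expMeasure lam =
      ∫⁻ s in Ioi (0 : ℝ), ENNReal.ofReal (Real.exp (-lam * s)) *
        F (z + s • velocity c (v n)) := by
    intro z
    have hG' : Measurable fun q : ℝ × ℝ => if q.2 < q.1 then
        F (z + q.2 • velocity c (v n)) else 0 :=
      Measurable.ite (measurableSet_lt (by fun_prop) (by fun_prop)) (by fun_prop) measurable_const
    rw [lintegral_lintegral_swap hG'.aemeasurable]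
    refine setLIntegral_congr_fun measurableSet_Ioi fun s hs => ?_
    have hs : 0 < s := hs
    have : ∀ x : ℝ, (if s < x then F (z + s • velocity c (v n)) else 0) =
        (Ioi s).indicator (fun _ => F (z + s • velocity c (v n))) x := fun x => by
      simp [indicator]
    simp_rw [this]
    rw [lintegral_indicator measurableSet_Ioi, setLIntegral_const, mul_comm]
    congr 1
    have hcdf : expMeasure lam (Iic s) = ENNReal.ofReal (1 - Real.exp (-(lam * s))) := by
      rw [← ofReal_cdf, cdf_expMeasure_eq hlam, if_pos hs.le]
    rw [← compl_Iic, prob_compl_eq_one_sub measurableSet_Iic, hcdf, ← ENNReal.ofReal_one,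
      ← ENNReal.ofReal_sub _ (by simp; positivity)]
    congr 1
    simp [neg_mul]
  simp_rw [key]
  rw [h.lintegral_pathSum hlam c v n (F := fun z => ∫⁻ s in Ioi (0 : ℝ),
      ENNReal.ofReal (Real.exp (-lam * s)) * F (z + s • velocity c (v n)))
      (Measurable.lintegral_prod_right (by unfold Function.uncurry; fun_prop)), history,
      lintegral_exp_pathMeasure_cons _ _ _ _ hF]

lemma IsStandardMotion.prob_history (h : IsStandardMotion P lam τ V) (v : ℕ → Fin 6) (n : ℕ) :
    P {ω | history (fun k => V k ω) (n + 1) = history v (n + 1)} =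
      ENNReal.ofReal (1 / 6 * ∏ k ∈ Finset.range n, switchProb (v k) (v (k + 1))) := by
  rw [← h.law_dir n v]
  congr 1 with ω
  simp [history_eq_iff]

lemma measurableSet_history_eq (v : ℕ → Fin 6) (n : ℕ) :
    MeasurableSet {w : ℕ → Fin 6 | history w n = history v n} := by
  have : {w : ℕ → Fin 6 | history w n = history v n} =
      ⋂ k, ⋂ (_ : k < n), (fun w : ℕ → Fin 6 => w k) ⁻¹' {v k} := by
    ext w; simp [history_eq_iff]
  rw [this]
  exact MeasurableSet.iInter fun k => MeasurableSet.iInter fun _ =>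
    measurable_pi_apply k (measurableSet_singleton (v k))

/-- Splitting an expectation according to the first directions of the motion. -/
lemma IsStandardMotion.lintegral_history [IsProbabilityMeasure P] (hlam : 0 < lam)
    (h : IsStandardMotion P lam τ V) (c : ℝ) (n : ℕ)
    {F : SpaceTime → ℝ≥0∞} (hF : Measurable F) :
    ∫⁻ ω, ∫⁻ s in Ioi (0 : ℝ), (if s < τ n ω then
        F (pathSum c (fun k => τ k ω) (fun k => V k ω) n + s • velocity c (V n ω)) else 0) ∂volume ∂P =
      ∑' l : List (Fin 6), if l.length = n + 1 then pathWeight lam l *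
        ∫⁻ z, ENNReal.ofReal (Real.exp (-lam * z.1)) * F z ∂pathMeasure c l else 0 := by
  -- Each list is realised by a deterministic sequence of directions, to which the formulas for
  -- fixed directions apply.
  choose rep hrep using exists_history_eq
  set K : List (Fin 6) → (ℕ → ℝ) → ℝ≥0∞ := fun l x => ∫⁻ s in Ioi (0 : ℝ), (if s < x n then
        F (pathSum c x (rep l) n + s • velocity c (rep l n)) else 0) with hK
  have hKm : ∀ l, Measurable (K l) := fun l => by
    refine Measurable.lintegral_prod_right (Measurable.ite
      (measurableSet_lt (by fun_prop) (by fun_prop)) ?_ measurable_const)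
    refine hF.comp ?_
    simp only [pathSum]
    fun_prop
  set S : List (Fin 6) → Set (ℕ → Fin 6) := fun l =>
    if l.length = n + 1 then {w | history w (n + 1) = l} else ∅ with hS
  have hSm : ∀ l, MeasurableSet (S l) := fun l => by
    simp only [hS]
    split_ifs with hl
    · have := measurableSet_history_eq (rep l) (n + 1)
      rwa [← hl, hrep, hl] at this
    · exact MeasurableSet.empty
  have hVm : Measurable fun ω k => V k ω := measurable_pi_lambda _ h.measurable_dir
  have hτm : Measurable fun ω k => τ k ω := measurable_pi_lambda _ h.measurable_wait
  have hpt : ∀ ω, ∫⁻ s in Ioi (0 : ℝ), (if s < τ n ω then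
        F (pathSum c (fun k => τ k ω) (fun k => V k ω) n + s • velocity c (V n ω)) else 0) =
      ∑' l, (S l).indicator (fun _ => (1 : ℝ≥0∞)) (fun k => V k ω) * K l (fun k => τ k ω) := by
    intro ω
    set l₀ := history (fun k => V k ω) (n + 1) with hl₀
    have hlen : l₀.length = n + 1 := length_history _ _
    rw [tsum_eq_single l₀]
    · have hmem : (fun k => V k ω) ∈ S l₀ := by simp [hS, hlen, ← hl₀]
      rw [indicator_of_mem hmem, one_mul, hK]
      have hr := hrep l₀
      rw [hlen, hl₀, history_eq_iff] at hr
      have e1 : rep l₀ n = V n ω := hr n (by simp)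
      have e2 : pathSum c (fun k => τ k ω) (rep l₀) n =
          pathSum c (fun k => τ k ω) (fun k => V k ω) n := by
        refine Finset.sum_congr rfl fun k hk => ?_
        rw [hr k (by have := Finset.mem_range.1 hk; omega)]
      simp only [e1, e2]
    · intro l hl
      rw [indicator_of_notMem, zero_mul]
      simp only [hS]
      split_ifs
      · exact fun hh => hl hh.symm
      · simp
  simp_rw [hpt]
  have hprod : ∀ l, AEMeasurable (fun ω => (S l).indicator (fun _ => (1 : ℝ≥0∞)) (fun k => V k ω) *
      K l (fun k => τ k ω)) P := fun l =>
    (((measurable_const.indicator (hSm l)).comp hVm).mul ((hKm l).comp hτm)).aemeasurable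
  rw [lintegral_tsum hprod]
  congr 1 with l
  -- The indicator depends on the directions and K on the waiting times, so independence factorizes
  -- the expectation.
  have hmul := lintegral_mul_eq_lintegral_mul_lintegral_of_indepFun (μ := P)
    ((measurable_const.indicator (hSm l)).comp hVm) ((hKm l).comp hτm)
    ((h.indep_wait_dir.symm).comp (measurable_const.indicator (hSm l)) (hKm l))
    (f := (S l).indicator (fun _ => (1 : ℝ≥0∞)) ∘ fun ω k => V k ω)
  refine hmul.trans ?_
  by_cases hl : l.length = n + 1
  · have hr := hrep l
    rw [hl] at hr
    have h1 : ∫⁻ ω, K l (fun k => τ k ω) ∂P = ENNReal.ofReal (lam ^ n) *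
        ∫⁻ z, ENNReal.ofReal (Real.exp (-lam * z.1)) * F z ∂pathMeasure c l := by
      rw [← hr, ← h.lintegral_pathSum_segment hlam c _ n hF, hr]
    have h2 : ∫⁻ ω, ((S l).indicator (fun _ => (1 : ℝ≥0∞)) ∘ fun ω k => V k ω) ω ∂P =
        P {ω | history (fun k => V k ω) (n + 1) = history (rep l) (n + 1)} := by
      have : ((S l).indicator (fun _ => (1 : ℝ≥0∞)) ∘ fun ω k => V k ω) =
          ((fun ω k => V k ω) ⁻¹' S l).indicator 1 := rfl
      rw [this, lintegral_indicator_one (hVm (hSm l)), hr]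
      simp [hS, hl]
    rw [if_pos hl]
    simp only [Function.comp_def] at h2 ⊢
    rw [h1, h2, h.prob_history, ← mul_assoc]
    conv_rhs => rw [← hr, pathWeight_history hlam, hr]
    ring
  · simp [hS, hl]

end Motion

end

section

/-! ### The occupation measure -/

section Path

variable {Ω : Type*} {τ : ℕ → Ω → ℝ} {V : ℕ → Ω → Fin 6}

lemma switchTime_succ (τ : ℕ → Ω → ℝ) (n : ℕ) (ω : Ω) :
    switchTime τ (n + 1) ω = switchTime τ n ω + τ n ω :=
  Finset.sum_range_succ _ _

@[simp] lemma switchTime_zero (τ : ℕ → Ω → ℝ) (ω : Ω) : switchTime τ 0 ω = 0 := rfl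

lemma strictMono_switchTime {ω : Ω} (h : ∀ k, 0 < τ k ω) :
    StrictMono fun n => switchTime τ n ω :=
  strictMono_nat_of_lt_succ fun n => by rw [switchTime_succ]; linarith [h n]

/-- No explosion: infinitely many waiting times longer than 1 push the switching times beyond every
bound. -/
lemma exists_lt_switchTime {ω : Ω} (h : ∀ k, 0 < τ k ω) (hf : ∃ᶠ k in atTop, 1 < τ k ω)
    (t : ℝ) : ∃ n, t < switchTime τ n ω := by
  have hm : ∀ m : ℕ, ∃ n, (m : ℝ) ≤ switchTime τ n ω := by
    intro m
    induction m with
    | zero => exact ⟨0, by simp⟩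
    | succ m ih =>
      obtain ⟨n, hn⟩ := ih
      obtain ⟨k, hk, hk1⟩ := frequently_atTop.1 hf n
      refine ⟨k + 1, ?_⟩
      have : switchTime τ n ω ≤ switchTime τ k ω := (strictMono_switchTime h).monotone hk
      rw [switchTime_succ]
      push_cast
      linarith
  obtain ⟨m, hm'⟩ := exists_nat_gt t
  obtain ⟨n, hn⟩ := hm m
  exact ⟨n, hm'.trans_le hn⟩

lemma numSwitches_eq {ω : Ω} (h : ∀ k, 0 < τ k ω) {t : ℝ} {n : ℕ}
    (h1 : switchTime τ n ω ≤ t) (h2 : t < switchTime τ (n + 1) ω) :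
    numSwitches τ t ω = n := by
  have hS := strictMono_switchTime h
  have : {k : ℕ | switchTime τ (k + 1) ω ≤ t} = (Finset.range n : Set ℕ) := by
    ext k
    simp only [mem_ofPred_eq, Finset.coe_range, mem_Iio]
    constructor
    · intro hk
      have := hS.lt_iff_lt.1 (hk.trans_lt h2)
      omega
    · intro hk
      exact (hS.monotone hk).trans h1
  rw [numSwitches, this, ncard_coe_finset, Finset.card_range]

lemma pathSum_fst (c : ℝ) (v : ℕ → Fin 6) (n : ℕ) (ω : Ω) :
    (pathSum c (fun k => τ k ω) v n).1 = switchTime τ n ω := by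
  simp [pathSum, switchTime, Prod.fst_sum]

lemma mk_position_eq {ω : Ω} (c : ℝ) (h : ∀ k, 0 < τ k ω) {t : ℝ} {n : ℕ}
    (h1 : switchTime τ n ω ≤ t) (h2 : t < switchTime τ (n + 1) ω) :
    (t, position c τ V t ω) = pathSum c (fun k => τ k ω) (fun k => V k ω) n +
      (t - switchTime τ n ω) • velocity c (V n ω) := by
  rw [position, numSwitches_eq h h1 h2]
  refine Prod.ext ?_ ?_
  · simp [pathSum_fst]
  · simp [pathSum, velocity, Prod.snd_sum, smul_smul, mul_comm]

/-- The switching times cut the half-line into intervals on which the path is a straight segment;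
each interval is shifted to start at time 0, and endpoints are null sets. -/
lemma lintegral_path_eq_tsum {ω : Ω} (c : ℝ) (h : ∀ k, 0 < τ k ω)
    (ht : ∀ t, ∃ n, t < switchTime τ n ω) {F : SpaceTime → ℝ≥0∞} :
    ∫⁻ t in Ioi (0 : ℝ), F (t, position c τ V t ω) =
      ∑' n, ∫⁻ s in Ioi (0 : ℝ), (if s < τ n ω then
        F (pathSum c (fun k => τ k ω) (fun k => V k ω) n + s • velocity c (V n ω)) else 0) := by
  have hS := strictMono_switchTime h
  have hU : Ici (0 : ℝ) = ⋃ n, Ico (switchTime τ n ω) (switchTime τ (n + 1) ω) := by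
    ext t
    simp only [mem_Ici, mem_iUnion, mem_Ico]
    constructor
    · intro h0
      classical
      have hex := ht t
      obtain ⟨m, hm⟩ := Nat.exists_eq_succ_of_ne_zero (n := Nat.find hex) (by
        intro h1
        have := Nat.find_spec hex
        rw [h1, switchTime_zero] at this
        linarith)
      refine ⟨m, not_lt.1 (Nat.find_min hex (m := m) (by omega)), ?_⟩
      have := Nat.find_spec hex
      rwa [hm] at this
    · rintro ⟨n, hn, -⟩
      exact le_trans (by simpa using hS.monotone (Nat.zero_le n)) hn
  conv_lhs => rw [restrict_congr_set (Ioi_ae_eq_Ici (μ := volume) (a := (0 : ℝ))), hU]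
  rw [lintegral_iUnion (s := fun n => Ico (switchTime τ n ω) (switchTime τ (n + 1) ω))
      (fun n => measurableSet_Ico) hS.monotone.pairwise_disjoint_on_Ico_succ]
  congr 1 with n
  rw [← restrict_congr_set (Ioo_ae_eq_Ico (μ := volume)), ← lintegral_indicator measurableSet_Ioo,
    ← lintegral_indicator measurableSet_Ioi, ← lintegral_add_right_eq_self _ (switchTime τ n ω)]
  congr 1 with s
  simp only [indicator, mem_Ioo, mem_Ioi, switchTime_succ, lt_add_iff_pos_left]
  simp only [add_comm s, add_lt_add_iff_left]
  by_cases hs : 0 < s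
  · by_cases hs2 : s < τ n ω
    · simp only [hs, hs2, and_self, if_true]
      rw [mk_position_eq c h (n := n) (by linarith) (by rw [switchTime_succ]; linarith)]
      simp
    · simp [hs2]
  · simp [hs]

end Path

/-! ### Almost sure properties, measurability and the occupation formula. -/

section Motion

variable {Ω : Type*} [MeasurableSpace Ω] {P : Measure Ω} {lam : ℝ} {τ : ℕ → Ω → ℝ}
  {V : ℕ → Ω → Fin 6}

lemma IsStandardMotion.ae_wait_pos [IsProbabilityMeasure P] (h : IsStandardMotion P lam τ V) :
    ∀ᵐ ω ∂P, ∀ k, 0 < τ k ω := by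
  rw [ae_all_iff]
  intro k
  have h0 : ∀ᵐ x ∂expMeasure lam, 0 < x := by
    have hc : {x : ℝ | ¬ 0 < x} = Iic 0 := by ext; simp
    rw [ae_iff, hc, ← lintegral_indicator_one measurableSet_Iic, lintegral_expMeasure
      (measurable_one.indicator measurableSet_Iic), setLIntegral_congr_fun (g := fun _ => 0)
      measurableSet_Ioi, lintegral_zero]
    intro x hx
    have : ¬ x ≤ 0 := not_le.2 hx
    simp [indicator, this]
  rw [← h.law_wait k] at h0
  exact ae_of_ae_map (h.measurable_wait k).aemeasurable h0

/-- Second Borel–Cantelli lemma: the events are independent and all have the same positive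
probability exp(-λ). -/
lemma IsStandardMotion.ae_frequently_one_lt_wait [IsProbabilityMeasure P] (hlam : 0 < lam)
    (h : IsStandardMotion P lam τ V) : ∀ᵐ ω ∂P, ∃ᶠ k in atTop, 1 < τ k ω := by
  set s : ℕ → Set Ω := fun k => τ k ⁻¹' Ioi 1 with hs
  have hsm : ∀ k, MeasurableSet (s k) := fun k => h.measurable_wait k measurableSet_Ioi
  have hind : iIndepSet s P := by
    rw [iIndepSet_iff_meas_biInter hsm]
    intro S
    exact h.indep_wait.measure_inter_preimage_eq_mul S fun _ _ => measurableSet_Ioi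
  have : IsProbabilityMeasure (expMeasure lam) := isProbabilityMeasure_expMeasure hlam
  have hp : ∀ k, P (s k) = ENNReal.ofReal (Real.exp (-lam)) := by
    intro k
    have hcdf : expMeasure lam (Iic 1) = ENNReal.ofReal (1 - Real.exp (-(lam * 1))) := by
      rw [← ofReal_cdf, cdf_expMeasure_eq hlam, if_pos zero_le_one]
    rw [hs, ← map_apply (h.measurable_wait k) measurableSet_Ioi, h.law_wait, ← compl_Iic,
      prob_compl_eq_one_sub measurableSet_Iic, hcdf, ← ENNReal.ofReal_one,
      ← ENNReal.ofReal_sub _ (by simp; positivity)]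
    simp
  have hsum : ∑' k, P (s k) = ∞ := by
    simp_rw [hp]
    exact ENNReal.tsum_const_eq_top_of_ne_zero (by simp [Real.exp_pos])
  have hlim := measure_limsup_eq_one hsm hind hsum
  have hae : ∀ᵐ ω ∂P, ω ∈ limsup s atTop :=
    (prob_compl_eq_zero_iff (MeasurableSet.measurableSet_limsup hsm)).2 hlim
  filter_upwards [hae] with ω hω
  exact mem_limsup_iff_frequently_mem.1 hω

/-- A value n ≠ 0 means that the set of switches is one of the countably many finite sets with n
elements. Since `Set.ncard` is 0 on infinite sets too, the fibre over 0 is treated as the complement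
of the others. -/
lemma IsStandardMotion.measurable_numSwitches (h : IsStandardMotion P lam τ V) :
    Measurable fun q : ℝ × Ω => numSwitches τ q.1 q.2 := by
  have hS : ∀ n, Measurable fun q : ℝ × Ω => switchTime τ n q.2 := fun n => by
    have := h.measurable_wait
    unfold switchTime
    fun_prop
  have hk : ∀ k, MeasurableSet {q : ℝ × Ω | switchTime τ (k + 1) q.2 ≤ q.1} := fun k =>
    measurableSet_le (hS _) measurable_fst
  have hT : ∀ T : Finset ℕ, MeasurableSet
      {q : ℝ × Ω | {k : ℕ | switchTime τ (k + 1) q.2 ≤ q.1} = T} := by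
    intro T
    have : {q : ℝ × Ω | {k : ℕ | switchTime τ (k + 1) q.2 ≤ q.1} = T} =
        ⋂ k, {q : ℝ × Ω | switchTime τ (k + 1) q.2 ≤ q.1 ↔ k ∈ T} := by
      ext q; simp [Set.ext_iff]
    rw [this]
    refine MeasurableSet.iInter fun k => ?_
    by_cases hkT : k ∈ T
    · simpa [hkT] using hk k
    · convert (hk k).compl using 1
      ext q
      simp [hkT]
  have hsucc : ∀ n, n ≠ 0 → MeasurableSet {q : ℝ × Ω | numSwitches τ q.1 q.2 = n} := by
    intro n hn
    have : {q : ℝ × Ω | numSwitches τ q.1 q.2 = n} = ⋃ T ∈ {T : Finset ℕ | T.card = n},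
        {q : ℝ × Ω | {k : ℕ | switchTime τ (k + 1) q.2 ≤ q.1} = T} := by
      ext q
      simp only [mem_ofPred_eq, mem_iUnion, exists_prop, numSwitches]
      constructor
      · intro hq
        have hfin := finite_of_ncard_ne_zero (hq.trans_ne hn)
        exact ⟨hfin.toFinset, by rw [← ncard_eq_toFinset_card _ hfin, hq], by simp⟩
      · rintro ⟨T, hTc, hTe⟩
        rw [hTe, ncard_coe_finset, hTc]
    rw [this]
    exact MeasurableSet.biUnion (to_countable _) fun T _ => hT T
  refine measurable_to_countable' fun n => ?_
  rcases eq_or_ne n 0 with rfl | hn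
  · have : (fun q : ℝ × Ω => numSwitches τ q.1 q.2) ⁻¹' {0} =
        (⋃ n ∈ {n : ℕ | n ≠ 0}, {q : ℝ × Ω | numSwitches τ q.1 q.2 = n})ᶜ := by
      ext q
      simp only [mem_preimage, mem_singleton_iff, mem_compl_iff, mem_iUnion, mem_ofPred_eq]
      constructor
      · rintro h0 ⟨n, hn, hq⟩
        exact hn (hq ▸ h0)
      · intro hq
        by_contra h0
        exact hq ⟨_, h0, rfl⟩
    rw [this]
    exact (MeasurableSet.biUnion (to_countable _) fun n hn => hsucc n hn).compl
  · exact hsucc n hn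

lemma IsStandardMotion.measurable_position (h : IsStandardMotion P lam τ V) (c : ℝ) :
    Measurable fun q : ℝ × Ω => position c τ V q.1 q.2 := by
  have hw := h.measurable_wait
  have hd : ∀ n, Measurable fun ω => direction (V n ω) := fun n =>
    (measurable_of_countable direction).comp (h.measurable_dir n)
  have hn : ∀ n : ℕ, Measurable fun q : ℝ × Ω =>
      (∑ k ∈ Finset.range n, (c * τ k q.2) • direction (V k q.2)) +
        (c * (q.1 - switchTime τ n q.2)) • direction (V n q.2) := fun n => by
    have hd2 : ∀ n, Measurable fun q : ℝ × Ω => direction (V n q.2) := fun n =>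
      (hd n).comp measurable_snd
    unfold switchTime
    fun_prop
  have := measurable_from_prod_countable_right (f := fun r : ℕ × (ℝ × Ω) =>
      (∑ k ∈ Finset.range r.1, (c * τ k r.2.2) • direction (V k r.2.2)) +
        (c * (r.2.1 - switchTime τ r.1 r.2.2)) • direction (V r.1 r.2.2)) hn
  exact this.comp (h.measurable_numSwitches.prodMk measurable_id)

variable (P τ V) in
/-- The occupation measure of the motion in space-time. -/
def occupation (c : ℝ) : Measure SpaceTime :=
  ((volume.restrict (Ioi 0)).prod P).map fun q => (q.1, position c τ V q.1 q.2)

lemma IsStandardMotion.lintegral_occupation' [IsProbabilityMeasure P]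
    (h : IsStandardMotion P lam τ V) (c : ℝ)
    {F : SpaceTime → ℝ≥0∞} (hF : Measurable F) :
    ∫⁻ z, F z ∂occupation P τ V c =
      ∫⁻ t in Ioi (0 : ℝ), ∫⁻ ω, F (t, position c τ V t ω) ∂P := by
  have hp := measurable_fst.prodMk (h.measurable_position c)
  rw [occupation, lintegral_map hF hp,
    lintegral_prod (fun q => F (q.1, position c τ V q.1 q.2)) (hF.comp hp).aemeasurable]

/-- The segments are summed over the number of completed displacements. A nonempty list has exactly
one such number, so the double sum over numbers and lists collapses to a sum over lists. -/
theorem IsStandardMotion.lintegral_occupation [IsProbabilityMeasure P] (hlam : 0 < lam)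
    (h : IsStandardMotion P lam τ V) (c : ℝ)
    {F : SpaceTime → ℝ≥0∞} (hF : Measurable F) :
    ∫⁻ z, F z ∂occupation P τ V c = ∑' l : List (Fin 6), pathWeight lam l *
        ∫⁻ z, ENNReal.ofReal (Real.exp (-lam * z.1)) * F z ∂pathMeasure c l := by
  have hp := measurable_fst.prodMk (h.measurable_position c)
  rw [h.lintegral_occupation' c hF, lintegral_lintegral_swap
    (f := fun t ω => F (t, position c τ V t ω)) (hF.comp hp).aemeasurable]
  have hae : ∀ᵐ ω ∂P, ∫⁻ t in Ioi (0 : ℝ), F (t, position c τ V t ω) =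
      ∑' n, ∫⁻ s in Ioi (0 : ℝ), (if s < τ n ω then
        F (pathSum c (fun k => τ k ω) (fun k => V k ω) n + s • velocity c (V n ω)) else 0) := by
    filter_upwards [h.ae_wait_pos, h.ae_frequently_one_lt_wait hlam] with ω h1 h2
    exact lintegral_path_eq_tsum c h1 (exists_lt_switchTime h1 h2)
  rw [lintegral_congr_ae hae, lintegral_tsum]
  · simp_rw [h.lintegral_history hlam c _ hF]
    rw [ENNReal.tsum_comm]
    congr 1 with l
    cases l with
    | nil => simp [pathWeight]
    | cons i l =>
      rw [tsum_eq_single l.length]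
      · simp
      · intro n hn
        simp [hn.symm]
  · intro n
    have hw := h.measurable_wait
    have hd : ∀ n, Measurable fun ω => velocity c (V n ω) := fun n =>
      (measurable_of_countable (velocity c)).comp (h.measurable_dir n)
    have hm : Measurable fun q : Ω × ℝ => if q.2 < τ n q.1 then
        F (pathSum c (fun k => τ k q.1) (fun k => V k q.1) n + q.2 • velocity c (V n q.1))
        else 0 := by
      refine Measurable.ite (measurableSet_lt (by fun_prop) (by fun_prop)) (hF.comp ?_)
        measurable_const
      have hd2 : ∀ n, Measurable fun q : Ω × ℝ => velocity c (V n q.1) := fun n =>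
        (hd n).comp measurable_fst
      unfold pathSum
      fun_prop
    exact (Measurable.lintegral_prod_right hm).aemeasurable

end Motion

end

/-! ### The transport equations in weak form -/

lemma tsum_list_eq (f : List (Fin 6) → ℝ≥0∞) :
    ∑' l, f l = f [] + ∑ i, ∑' l, f (i :: l) := by
  have hinj : Function.Injective fun q : Fin 6 × List (Fin 6) => q.1 :: q.2 := by
    rintro ⟨i, l⟩ ⟨j, m⟩ h
    simpa using h
  have h1 : ∑' q : Fin 6 × List (Fin 6), f (q.1 :: q.2) = ∑ i, ∑' l, f (i :: l) :=
    ENNReal.tsum_prod'.trans (tsum_fintype _)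
  rw [ENNReal.tsum_eq_add_tsum_ite [], ← h1, ← hinj.tsum_eq]
  · exact congrArg _ (tsum_congr fun q => if_neg (List.cons_ne_nil _ _))
  · intro l hl
    cases l with
    | nil => exact absurd (if_pos rfl) hl
    | cons i l => exact ⟨(i, l), rfl⟩

/-- The part of the occupation measure where the particle travels along the `i`-th direction. -/
def dirOccupation (c lam : ℝ) (i : Fin 6) : Measure SpaceTime :=
  Measure.sum fun l : List (Fin 6) => pathWeight lam (i :: l) •
    (pathMeasure c (i :: l)).withDensity fun z => ENNReal.ofReal (Real.exp (-lam * z.1))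

instance (c lam : ℝ) (i : Fin 6) : SFinite (dirOccupation c lam i) := by
  unfold dirOccupation; infer_instance

lemma lintegral_dirOccupation (c lam : ℝ) (i : Fin 6) {F : SpaceTime → ℝ≥0∞}
    (hF : Measurable F) :
    ∫⁻ z, F z ∂dirOccupation c lam i = ∑' l : List (Fin 6), pathWeight lam (i :: l) *
        ∫⁻ z, ENNReal.ofReal (Real.exp (-lam * z.1)) * F z ∂pathMeasure c (i :: l) := by
  rw [dirOccupation, lintegral_sum_measure]
  congr 1 with l
  rw [lintegral_smul_measure, lintegral_withDensity_eq_lintegral_mul _ (by fun_prop) hF]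
  rfl

lemma IsStandardMotion.occupation_eq_sum {Ω : Type*} [MeasurableSpace Ω] {P : Measure Ω}
    [IsProbabilityMeasure P] {lam : ℝ} {τ : ℕ → Ω → ℝ} {V : ℕ → Ω → Fin 6} (hlam : 0 < lam)
    (h : IsStandardMotion P lam τ V) (c : ℝ) :
    occupation P τ V c = ∑ i, dirOccupation c lam i := by
  refine ext_of_lintegral _ fun F hF => ?_
  rw [h.lintegral_occupation hlam c hF, tsum_list_eq, lintegral_finsetSum_measure]
  simp only [pathWeight, zero_mul, zero_add]
  simp_rw [lintegral_dirOccupation c lam _ hF]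

/-- Each time slice carries mass one. This a priori bound gives local finiteness of the occupation
measure and, later, convergence of the density series. -/
lemma IsStandardMotion.occupation_Iic_le {Ω : Type*} [MeasurableSpace Ω] {P : Measure Ω}
    [IsProbabilityMeasure P] {lam : ℝ} {τ : ℕ → Ω → ℝ} {V : ℕ → Ω → Fin 6}
    (h : IsStandardMotion P lam τ V) (c : ℝ) (T : ℝ) :
    occupation P τ V c {z | z.1 ≤ T} ≤ ENNReal.ofReal T := by
  have hm : MeasurableSet {z : SpaceTime | z.1 ≤ T} := measurableSet_le (by fun_prop) (by fun_prop)
  rw [← lintegral_indicator_one hm, h.lintegral_occupation' c (measurable_one.indicator hm)]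
  have : ∀ t, ∫⁻ ω, {z : SpaceTime | z.1 ≤ T}.indicator 1 (t, position c τ V t ω) ∂P =
      (Iic T).indicator 1 t := by
    intro t
    by_cases ht : t ≤ T <;> simp [indicator, ht]
  simp_rw [this]
  rw [lintegral_indicator_one measurableSet_Iic, Measure.restrict_apply measurableSet_Iic, inter_comm,
    Ioi_inter_Iic, Real.volume_Ioc, sub_zero]

lemma IsStandardMotion.isFiniteMeasureOnCompacts_occupation {Ω : Type*} [MeasurableSpace Ω]
    {P : Measure Ω} [IsProbabilityMeasure P] {lam : ℝ} {τ : ℕ → Ω → ℝ} {V : ℕ → Ω → Fin 6}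
    (h : IsStandardMotion P lam τ V) (c : ℝ) :
    IsFiniteMeasureOnCompacts (occupation P τ V c) := by
  refine ⟨fun K hK => ?_⟩
  obtain ⟨T, hT⟩ := (hK.image continuous_fst).bddAbove
  refine lt_of_le_of_lt (measure_mono fun z hz => ?_)
    ((h.occupation_Iic_le c T).trans_lt ENNReal.ofReal_lt_top)
  exact hT ⟨z, hz, rfl⟩

lemma IsStandardMotion.isFiniteMeasureOnCompacts_dirOccupation {Ω : Type*} [MeasurableSpace Ω]
    {P : Measure Ω} [IsProbabilityMeasure P] {lam : ℝ} {τ : ℕ → Ω → ℝ} {V : ℕ → Ω → Fin 6}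
    (hlam : 0 < lam) (h : IsStandardMotion P lam τ V) (c : ℝ) (i : Fin 6) :
    IsFiniteMeasureOnCompacts (dirOccupation c lam i) := by
  have := h.isFiniteMeasureOnCompacts_occupation c
  refine ⟨fun K hK => lt_of_le_of_lt ?_ (hK.measure_lt_top (μ := occupation P τ V c))⟩
  rw [h.occupation_eq_sum hlam, finsetSum_apply]
  exact Finset.single_le_sum (f := fun i => dirOccupation c lam i K) (fun _ _ => zero_le)
    (Finset.mem_univ i)

/-- The occupation measure of one displacement along the `i`-th direction. -/
def segmentMeasure (c lam : ℝ) (i : Fin 6) : Measure SpaceTime :=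
  ((volume.restrict (Ioi 0)).withDensity fun s : ℝ =>
    ENNReal.ofReal (Real.exp (-lam * s))).map fun s => s • velocity c i

instance (c lam : ℝ) (i : Fin 6) : SFinite (segmentMeasure c lam i) := by
  unfold segmentMeasure; infer_instance

/-- The law of the space-time points where displacements along the `i`-th direction start. -/
def startMeasure (c lam : ℝ) (i : Fin 6) : Measure SpaceTime :=
  ENNReal.ofReal (1 / 6) • dirac 0 +
    ∑ j, ENNReal.ofReal (lam * switchProb j i) • dirOccupation c lam j

instance (c lam : ℝ) (i : Fin 6) : SFinite (startMeasure c lam i) := by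
  have : SFinite (∑ j, ENNReal.ofReal (lam * switchProb j i) • dirOccupation c lam j) := by
    rw [← sum_fintype]; infer_instance
  unfold startMeasure; infer_instance

/-- Renewal argument: a point visited in direction i is a starting point of such a displacement plus
a partial segment. The start is the origin, with probability 1/6, or a switch from direction j,
occurring at rate λ p_ji along the occupation in direction j. -/
lemma dirOccupation_eq_conv (c lam : ℝ) (i : Fin 6) :
    dirOccupation c lam i = (startMeasure c lam i).conv (segmentMeasure c lam i) := by
  refine ext_of_lintegral _ fun F hF => ?_
  have hseg : ∀ z, ∫⁻ w, F (z + w) ∂segmentMeasure c lam i = ∫⁻ s in Ioi (0 : ℝ),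
      ENNReal.ofReal (Real.exp (-lam * s)) * F (z + s • velocity c i) := fun z => by
    rw [segmentMeasure, lintegral_map (by fun_prop) (by fun_prop),
      lintegral_withDensity_eq_lintegral_mul _ (by fun_prop) (by fun_prop)]
    rfl
  have hK : Measurable fun z => ∫⁻ s in Ioi (0 : ℝ),
      ENNReal.ofReal (Real.exp (-lam * s)) * F (z + s • velocity c i) :=
    Measurable.lintegral_prod_right (by unfold Function.uncurry; fun_prop)
  rw [lintegral_conv hF, lintegral_dirOccupation c lam i hF]
  simp_rw [hseg, lintegral_exp_pathMeasure_cons c lam i _ hF]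
  rw [tsum_list_eq, startMeasure, lintegral_add_measure, lintegral_smul_measure,
    lintegral_finsetSum_measure, lintegral_dirac' _ hK]
  congr 1
  · rw [lintegral_pathMeasure_nil]
    simp [pathWeight]
  · refine Finset.sum_congr rfl fun j _ => ?_
    rw [lintegral_smul_measure, lintegral_dirOccupation c lam j hK, smul_eq_mul,
      ← ENNReal.tsum_mul_left]
    simp_rw [pathWeight, mul_assoc]

/-- The integrand with its weight is the derivative of s ↦ exp(-λs) φ(z + s v) along the ray;
compact support kills the end at infinity, and s = 0 leaves -φ(z). -/
lemma integral_segmentMeasure (c lam : ℝ) (i : Fin 6) {φ : SpaceTime → ℝ} (hφ : ContDiff ℝ 1 φ)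
    (hc : HasCompactSupport φ) (z : SpaceTime) :
    ∫ w, (lineDeriv ℝ φ (z + w) (velocity c i) - lam * φ (z + w)) ∂segmentMeasure c lam i =
      -φ z := by
  have hld : Continuous fun w => lineDeriv ℝ φ w (velocity c i) := by
    have : (fun w => lineDeriv ℝ φ w (velocity c i)) = fun w => fderiv ℝ φ w (velocity c i) :=
      funext fun w => (hφ.differentiable one_ne_zero w).lineDeriv_eq_fderiv
    rw [this]
    exact (hφ.continuous_fderiv one_ne_zero).clm_apply continuous_const
  have hφc := hφ.continuous
  rw [segmentMeasure, integral_map (by fun_prop)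
    (Continuous.aestronglyMeasurable (by fun_prop)),
    integral_withDensity_eq_integral_toReal_smul (by fun_prop) (by simp)]
  set f : ℝ → ℝ := fun s => Real.exp (-lam * s) * φ (z + s • velocity c i) with hf
  have hline : ContDiff ℝ 1 fun s : ℝ => z + s • velocity c i := by fun_prop
  have hf1 : ContDiff ℝ 1 f := ContDiff.mul (by fun_prop) (hφ.comp hline)
  have hfs : HasCompactSupport f := by
    have hv : velocity c i ≠ 0 := fun h => by simpa using congrArg Prod.fst h
    exact (hc.comp_isClosedEmbedding ((Homeomorph.addLeft z).isClosedEmbedding.comp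
      (isClosedEmbedding_smul_left hv))).mul_left
  have hder : ∀ s, deriv f s = Real.exp (-lam * s) *
      (lineDeriv ℝ φ (z + s • velocity c i) (velocity c i) - lam * φ (z + s • velocity c i)) := by
    intro s
    have h1 : HasDerivAt (fun s : ℝ => φ (z + s • velocity c i))
        (lineDeriv ℝ φ (z + s • velocity c i) (velocity c i)) s := by
      have hd := hφ.differentiable one_ne_zero (z + s • velocity c i)
      rw [hd.lineDeriv_eq_fderiv]
      have h2 : HasDerivAt (fun s : ℝ => z + s • velocity c i) (velocity c i) s := by
        simpa using ((hasDerivAt_id s).smul_const (velocity c i)).const_add z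
      exact hd.hasFDerivAt.comp_hasDerivAt s h2
    have h3 : HasDerivAt (fun s : ℝ => Real.exp (-lam * s)) (Real.exp (-lam * s) * (-lam)) s := by
      simpa using ((hasDerivAt_id s).const_mul (-lam)).exp
    rw [show f = (fun s => Real.exp (-lam * s)) * fun s => φ (z + s • velocity c i) from rfl,
      (h3.mul h1).deriv]
    ring
  have := hfs.integral_Ioi_deriv_eq hf1 0
  simp_rw [hder] at this
  simp only [hf, mul_zero, Real.exp_zero, one_mul, zero_smul, add_zero] at this
  rw [← this]
  refine integral_congr_ae (ae_of_all _ fun s => ?_)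
  simp [ENNReal.toReal_ofReal (Real.exp_nonneg _)]

/-- The transport equation for one direction, in weak form. -/
lemma IsStandardMotion.integral_dirOccupation {Ω : Type*} [MeasurableSpace Ω]
    {P : Measure Ω} [IsProbabilityMeasure P] {lam : ℝ} {τ : ℕ → Ω → ℝ} {V : ℕ → Ω → Fin 6}
    (hlam : 0 < lam) (h : IsStandardMotion P lam τ V) (c : ℝ) (i : Fin 6)
    {φ : SpaceTime → ℝ} (hφ : ContDiff ℝ 1 φ) (hc : HasCompactSupport φ) (h0 : φ 0 = 0) :
    ∫ z, (lineDeriv ℝ φ z (velocity c i) - lam * φ z) ∂dirOccupation c lam i =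
      -∑ j, lam * switchProb j i * ∫ z, φ z ∂dirOccupation c lam j := by
  have hfin := h.isFiniteMeasureOnCompacts_dirOccupation hlam c
  have hld : (fun w => lineDeriv ℝ φ w (velocity c i)) = fun w => fderiv ℝ φ w (velocity c i) :=
    funext fun w => (hφ.differentiable one_ne_zero w).lineDeriv_eq_fderiv
  have hcont : Continuous fun w => lineDeriv ℝ φ w (velocity c i) := by
    rw [hld]
    exact (hφ.continuous_fderiv one_ne_zero).clm_apply continuous_const
  have hcs : HasCompactSupport fun w => lineDeriv ℝ φ w (velocity c i) := by
    rw [hld]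
    exact hc.fderiv_apply ℝ (velocity c i)
  have hint : Integrable (fun z => lineDeriv ℝ φ z (velocity c i) - lam * φ z)
      (dirOccupation c lam i) :=
    (hcont.integrable_of_hasCompactSupport hcs).sub
      ((hφ.continuous.integrable_of_hasCompactSupport hc).const_mul lam)
  have hφi : ∀ j, Integrable φ (dirOccupation c lam j) := fun j =>
    hφ.continuous.integrable_of_hasCompactSupport hc
  rw [dirOccupation_eq_conv] at hint ⊢
  rw [integral_conv hint]
  simp_rw [integral_segmentMeasure c lam i hφ hc]
  -- The initial mass at the origin contributes nothing because φ vanishes there.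
  rw [integral_neg, startMeasure, integral_add_measure, integral_smul_measure, integral_dirac, h0,
    smul_zero, zero_add, integral_finsetSum_measure]
  · congr 1
    refine Finset.sum_congr rfl fun j _ => ?_
    rw [integral_smul_measure, ENNReal.toReal_ofReal
      (mul_nonneg hlam.le (switchProb_nonneg _ _)), smul_eq_mul]
  · exact fun j _ => (hφi j).smul_measure ENNReal.ofReal_ne_top
  · exact (integrable_dirac (by simp)).smul_measure ENNReal.ofReal_ne_top
  · exact integrable_finsetSum_measure.2 fun j _ => (hφi j).smul_measure ENNReal.ofReal_ne_top

/-- The Kolmogorov equations of the motion, in weak form. -/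
theorem IsStandardMotion.sum_integral_dirOccupation {Ω : Type*} [MeasurableSpace Ω]
    {P : Measure Ω} [IsProbabilityMeasure P] {lam : ℝ} {τ : ℕ → Ω → ℝ} {V : ℕ → Ω → Fin 6}
    (hlam : 0 < lam) (h : IsStandardMotion P lam τ V) (c : ℝ)
    {φ : Fin 6 → SpaceTime → ℝ} (hφ : ∀ i, ContDiff ℝ 1 (φ i))
    (hc : ∀ i, HasCompactSupport (φ i)) (h0 : ∀ i, φ i 0 = 0) {ψ : SpaceTime → ℝ}
    (hψ : ∀ i z, lineDeriv ℝ (φ i) z (velocity c i) - lam * φ i z +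
      lam * ∑ j, switchProb i j * φ j z = ψ z) :
    ∫ z, ψ z ∂occupation P τ V c = 0 := by
  have hfin := h.isFiniteMeasureOnCompacts_dirOccupation hlam c
  have hφi : ∀ i j, Integrable (φ i) (dirOccupation c lam j) := fun i j =>
    (hφ i).continuous.integrable_of_hasCompactSupport (hc i)
  have hli : ∀ i, Integrable (fun z => lineDeriv ℝ (φ i) z (velocity c i) - lam * φ i z)
      (dirOccupation c lam i) := by
    intro i
    have hld : (fun w => lineDeriv ℝ (φ i) w (velocity c i)) =
        fun w => fderiv ℝ (φ i) w (velocity c i) :=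
      funext fun w => ((hφ i).differentiable one_ne_zero w).lineDeriv_eq_fderiv
    refine Integrable.sub ?_ ((hφi i i).const_mul lam)
    rw [hld]
    exact (((hφ i).continuous_fderiv one_ne_zero).clm_apply
      continuous_const).integrable_of_hasCompactSupport ((hc i).fderiv_apply ℝ _)
  have hsi : ∀ i, Integrable (fun z => lam * ∑ j, switchProb i j * φ j z)
      (dirOccupation c lam i) := fun i =>
    (integrable_finsetSum _ fun j _ => (hφi j i).const_mul _).const_mul _
  have hpart : ∀ i, ∫ z, ψ z ∂dirOccupation c lam i =
      -(∑ j, lam * switchProb j i * ∫ z, φ i z ∂dirOccupation c lam j) +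
        ∑ j, lam * switchProb i j * ∫ z, φ j z ∂dirOccupation c lam i := by
    intro i
    simp_rw [← hψ i]
    rw [integral_add (hli i) (hsi i), h.integral_dirOccupation hlam c i (hφ i) (hc i) (h0 i),
      integral_const_mul, integral_finsetSum _ fun j _ => (hφi j i).const_mul _, Finset.mul_sum]
    simp_rw [integral_const_mul, mul_assoc]
  have hψi : ∀ i, Integrable ψ (dirOccupation c lam i) := fun i =>
    ((hli i).add (hsi i)).congr (ae_of_all _ fun z => hψ i z)
  rw [h.occupation_eq_sum hlam, integral_finsetSum_measure fun i _ => hψi i]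
  simp_rw [hpart]
  -- After summation over i the two double sums differ only by the names of the indices, so gain and
  -- loss cancel.
  rw [Finset.sum_add_distrib, Finset.sum_neg_distrib, Finset.sum_comm, neg_add_cancel]

/-! ### Constant coefficient differential operators -/

lemma two_le_infty : (1 : WithTop ℕ∞) + 1 ≤ ((⊤ : ℕ∞) : WithTop ℕ∞) :=
  WithTop.coe_le_coe.2 (le_top : (1 : ℕ∞) + 1 ≤ ⊤)

/-- The space of smooth functions on space-time. -/
def smoothFunctions : Submodule ℝ (SpaceTime → ℝ) where
  carrier := {u | ContDiff ℝ (⊤ : ℕ∞) u}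
  add_mem' hu hv := by
    rw [mem_ofPred_eq] at *
    exact hu.add hv
  zero_mem' := by
    rw [mem_ofPred_eq]
    exact contDiff_const
  smul_mem' r _ hu := by
    rw [mem_ofPred_eq] at *
    exact hu.const_smul r

/-- The type of smooth functions on space-time. -/
def SmoothFun : Type := smoothFunctions

instance : AddCommGroup SmoothFun := inferInstanceAs (AddCommGroup smoothFunctions)

instance : Module ℝ SmoothFun := inferInstanceAs (Module ℝ smoothFunctions)

instance : FunLike SmoothFun SpaceTime ℝ := ⟨fun u => u.1, Subtype.val_injective⟩

/-- A smooth function as an element of `SmoothFun`. -/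
def SmoothFun.mk (u : SpaceTime → ℝ) (hu : ContDiff ℝ (⊤ : ℕ∞) u) : SmoothFun :=
  ⟨u, by simp only [smoothFunctions]; exact hu⟩

@[simp] lemma SmoothFun.coe_mk (u : SpaceTime → ℝ) (hu : ContDiff ℝ (⊤ : ℕ∞) u) :
    ⇑(SmoothFun.mk u hu) = u := rfl

@[simp] lemma SmoothFun.coe_add (u v : SmoothFun) : ⇑(u + v) = u + v := rfl

@[simp] lemma SmoothFun.coe_sub (u v : SmoothFun) : ⇑(u - v) = u - v := rfl

@[simp] lemma SmoothFun.coe_neg (u : SmoothFun) : ⇑(-u) = -u := rfl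

@[simp] lemma SmoothFun.coe_smul (r : ℝ) (u : SmoothFun) : ⇑(r • u) = r • ⇑u := rfl

lemma SmoothFun.ext {u v : SmoothFun} (h : ∀ w, u w = v w) : u = v :=
  DFunLike.ext _ _ h

lemma SmoothFun.contDiff (u : SmoothFun) : ContDiff ℝ (⊤ : ℕ∞) ⇑u := by
  have := u.2
  simp only [smoothFunctions] at this
  exact this

lemma SmoothFun.differentiable (u : SmoothFun) : Differentiable ℝ ⇑u :=
  u.contDiff.differentiable (by simp)

/-- The derivative in the direction `v`. -/
def dirDeriv (v : SpaceTime) : Module.End ℝ SmoothFun where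
  toFun u := SmoothFun.mk (fun w => fderiv ℝ u w v)
    ((u.contDiff.fderiv_right (by simp)).clm_apply contDiff_const)
  map_add' u u' := SmoothFun.ext fun w => by
    simp [fderiv_add (u.differentiable w) (u'.differentiable w)]
  map_smul' r u := SmoothFun.ext fun w => by
    simp [fderiv_const_smul (u.differentiable w) r]

lemma dirDeriv_apply (v : SpaceTime) (u : SmoothFun) (w : SpaceTime) :
    dirDeriv v u w = fderiv ℝ u w v := rfl

lemma dirDeriv_comm (v v' : SpaceTime) :
    dirDeriv v * dirDeriv v' = dirDeriv v' * dirDeriv v := by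
  have key : ∀ (v v' : SpaceTime) (u : SmoothFun) (w : SpaceTime),
      dirDeriv v (dirDeriv v' u) w = fderiv ℝ (fderiv ℝ u) w v v' := by
    intro v v' u w
    rw [dirDeriv_apply, show ⇑(dirDeriv v' u) = fun w => fderiv ℝ u w v' from
      funext fun w => dirDeriv_apply v' u w]
    have hd : DifferentiableAt ℝ (fderiv ℝ u) w :=
      (u.contDiff.fderiv_right (m := 1) two_le_infty).differentiable one_ne_zero w
    rw [fderiv_clm_apply hd (differentiableAt_const _)]
    simp
  refine LinearMap.ext fun u => SmoothFun.ext fun w => ?_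
  simp only [Module.End.mul_apply]
  rw [key, key]
  exact (u.contDiff.contDiffAt.isSymmSndFDerivAt (by simpa [one_add_one_eq_two] using two_le_infty)).eq v v'

/-- The algebra of constant coefficient differential operators. -/
def diffOps : Subalgebra ℝ (Module.End ℝ SmoothFun) :=
  Algebra.adjoin ℝ (range dirDeriv)

/-- The generators commute by symmetry of second derivatives, hence so does the algebra they
generate; identities between operators then become identities in a commutative ring. -/
lemma diffOps_mul_comm (a b : diffOps) : a * b = b * a := by
  have := Algebra.isMulCommutative_adjoin ℝ (s := range dirDeriv) (by
    rintro _ ⟨v, rfl⟩ _ ⟨v', rfl⟩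
    exact dirDeriv_comm v v')
  exact this.is_comm.comm a b

instance : CommRing diffOps :=
  { Subalgebra.toRing diffOps with mul_comm := diffOps_mul_comm }

/-- The derivative in the direction `v`, as a differential operator. -/
def pd (v : SpaceTime) : diffOps := ⟨dirDeriv v, Algebra.subset_adjoin ⟨v, rfl⟩⟩

/-- The action of a differential operator on smooth functions. -/
def op (a : diffOps) (u : SmoothFun) : SmoothFun := (a : Module.End ℝ SmoothFun) u

lemma op_add (a b : diffOps) (u : SmoothFun) : op (a + b) u = op a u + op b u := rfl

lemma op_sub (a b : diffOps) (u : SmoothFun) : op (a - b) u = op a u - op b u := rfl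

lemma op_neg (a : diffOps) (u : SmoothFun) : op (-a) u = -op a u := rfl

lemma op_mul (a b : diffOps) (u : SmoothFun) : op (a * b) u = op a (op b u) := rfl

lemma op_smul (r : ℝ) (a : diffOps) (u : SmoothFun) : op (r • a) u = r • op a u := rfl

lemma op_algebraMap (r : ℝ) (u : SmoothFun) : op (algebraMap ℝ diffOps r) u = r • u := rfl

lemma op_zero (u : SmoothFun) : op 0 u = 0 := rfl

lemma op_sum {ι : Type*} (s : Finset ι) (a : ι → diffOps) (u : SmoothFun) :
    op (∑ i ∈ s, a i) u = ∑ i ∈ s, op (a i) u := by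
  classical
  induction s using Finset.induction_on with
  | empty => simp [op_zero]
  | insert i s hi ih => rw [Finset.sum_insert hi, Finset.sum_insert hi, op_add, ih]

lemma op_pd (v : SpaceTime) (u : SmoothFun) (w : SpaceTime) :
    op (pd v) u w = lineDeriv ℝ u w v :=
  ((u.differentiable w).lineDeriv_eq_fderiv).symm

lemma op_pd' (v : SpaceTime) (u : SmoothFun) (w : SpaceTime) :
    op (pd v) u w = fderiv ℝ u w v := rfl

lemma pd_add (v v' : SpaceTime) : pd (v + v') = pd v + pd v' := by
  refine Subtype.ext (LinearMap.ext fun u => SmoothFun.ext fun w => ?_)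
  change op (pd (v + v')) u w =
    op (pd v) u w + op (pd v') u w
  simp only [op_pd', map_add]

lemma pd_smul (r : ℝ) (v : SpaceTime) : pd (r • v) = r • pd v := by
  refine Subtype.ext (LinearMap.ext fun u => SmoothFun.ext fun w => ?_)
  change op (pd (r • v)) u w = r • op (pd v) u w
  simp only [op_pd', map_smul]

/-- Properties that hold for directional derivatives and are compatible with the operations hold
for all differential operators. -/
lemma op_induction {p : diffOps → Prop} (h1 : ∀ r, p (algebraMap ℝ diffOps r)) (h2 : ∀ v, p (pd v))
    (h3 : ∀ a b, p a → p b → p (a + b)) (h4 : ∀ a b, p a → p b → p (a * b)) (a : diffOps) :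
    p a := by
  obtain ⟨a, ha⟩ := a
  refine Algebra.adjoin_induction (p := fun x hx => p ⟨x, hx⟩) ?_ (fun r => h1 r)
    (fun x y hx hy hpx hpy => h3 _ _ hpx hpy) (fun x y hx hy hpx hpy => h4 _ _ hpx hpy) ha
  rintro _ ⟨v, rfl⟩
  exact h2 v

lemma tsupport_op_subset (a : diffOps) (u : SmoothFun) :
    tsupport ⇑(op a u) ⊆ tsupport ⇑u := by
  induction a using op_induction generalizing u with
  | h1 r => exact closure_mono (Function.support_const_smul_subset r ⇑u)
  | h2 v =>
    rw [show ⇑(op (pd v) u) = fun w => fderiv ℝ u w v from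
      funext fun w => op_pd' v u w]
    exact tsupport_fderiv_apply_subset ℝ v
  | h3 a b ha hb => exact (tsupport_add _ _).trans (union_subset (ha u) (hb u))
  | h4 a b ha hb => exact (ha (op b u)).trans (hb u)

lemma hasCompactSupport_op (a : diffOps) {u : SmoothFun}
    (hu : HasCompactSupport ⇑u) :
    HasCompactSupport ⇑(op a u) :=
  hu.mono' (subset_tsupport _ |>.trans (tsupport_op_subset a u))

section

/-! ### The sixth-order operator -/

/-- The operator `sixthOrder` as a polynomial in commuting operators. -/
def sixthPoly {B : Type*} [CommRing B] [Algebra ℝ B] (c lam : ℝ) (D : B) (X : Fin 3 → B) : B :=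
  (D ^ 6 - (3 * lam ^ 2 / 4) • D ^ 4 - (lam ^ 3 / 4) • D ^ 3) -
    (c ^ 6 • (X 0 ^ 2 * (X 1 ^ 2 * X 2 ^ 2)) -
      c ^ 4 • (D ^ 2 * (X 0 ^ 2 * X 1 ^ 2 + X 0 ^ 2 * X 2 ^ 2 + X 1 ^ 2 * X 2 ^ 2)) +
      c ^ 2 • (D ^ 4 * (∑ i, X i ^ 2) - (lam ^ 2 / 4) • (D ^ 2 * ∑ i, X i ^ 2)))

section Algebra

variable {B : Type*} [CommRing B] [Algebra ℝ B] (c lam : ℝ) (D : B) (X : Fin 3 → B)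

lemma sixthPoly_mem {S : Subalgebra ℝ B} {D : B} {X : Fin 3 → B} (hD : D ∈ S)
    (hX : ∀ i, X i ∈ S) : sixthPoly c lam D X ∈ S := by
  unfold sixthPoly
  have hX2 : ∀ i, X i ^ 2 ∈ S := fun i => pow_mem (hX i) 2
  have hs : ∑ i, X i ^ 2 ∈ S := sum_mem fun i _ => hX2 i
  have hm : ∀ i j, X i ^ 2 * X j ^ 2 ∈ S := fun i j => mul_mem (hX2 i) (hX2 j)
  refine sub_mem (sub_mem (sub_mem (pow_mem hD _) (S.smul_mem (pow_mem hD _) _))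
    (S.smul_mem (pow_mem hD _) _)) (add_mem (sub_mem (S.smul_mem (mul_mem (hX2 0) (hm 1 2)) _)
      (S.smul_mem (mul_mem (pow_mem hD _) (add_mem (add_mem (hm 0 1) (hm 0 2)) (hm 1 2))) _))
      (S.smul_mem (sub_mem (mul_mem (pow_mem hD _) hs)
        (S.smul_mem (mul_mem (pow_mem hD _) hs) _)) _))

lemma sixthPoly_neg : sixthPoly c lam D (-X) = sixthPoly c lam D X := by
  simp [sixthPoly]

lemma sixthPoly_fst {B' : Type*} [CommRing B'] [Algebra ℝ B'] (D : B × B') (X : Fin 3 → B × B') :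
    (sixthPoly c lam D X).1 = sixthPoly c lam D.1 fun i => (X i).1 := by
  simp [sixthPoly, Prod.fst_sum]

lemma sixthPoly_snd {B' : Type*} [CommRing B'] [Algebra ℝ B'] (D : B × B') (X : Fin 3 → B × B') :
    (sixthPoly c lam D X).2 = sixthPoly c lam D.2 fun i => (X i).2 := by
  simp [sixthPoly, Prod.snd_sum]

/-- The factorized form which, for D = ∂_t, yields the equation for q. -/
lemma sixthPoly_eq_dAlembert :
    sixthPoly c lam D X =
      (D ^ 2 - c ^ 2 • X 0 ^ 2) * ((D ^ 2 - c ^ 2 • X 1 ^ 2) * (D ^ 2 - c ^ 2 • X 2 ^ 2)) -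
        (3 * lam ^ 2 / 4) • (D ^ 2 *
          (D ^ 2 + (lam / 3) • D - (c ^ 2 / 3) • ∑ i, X i ^ 2)) := by
  have e1 : (3 * lam ^ 2 / 4) • (D ^ 2 *
      (D ^ 2 + (lam / 3) • D - (c ^ 2 / 3) • ∑ i, X i ^ 2)) =
      (3 * lam ^ 2 / 4) • D ^ 4 + (lam ^ 3 / 4) • D ^ 3 -
        c ^ 2 • (lam ^ 2 / 4) • (D ^ 2 * ∑ i, X i ^ 2) := by
    rw [mul_sub, mul_add, smul_sub, smul_add, mul_smul_comm, mul_smul_comm, smul_smul, smul_smul,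
      smul_smul]
    congr 2
    · congr 2
      ring
    · congr 1
      · ring
      · ring
    · ring
  have e2 : ∀ (n : ℕ) (x : B), c ^ n • x = algebraMap ℝ B c ^ n * x := fun n x => by
    rw [Algebra.smul_def, map_pow]
  rw [e1, sixthPoly, Fin.sum_univ_three, smul_sub]
  simp only [e2]
  ring

/-- The potentials which turn a solution of the Kolmogorov equations into a solution of the
sixth-order equation. -/
def potential (k : Fin 3) : B :=
  -((D ^ 2 + (lam / 2) • D - c ^ 2 • X (k + 1) ^ 2) *
    (D ^ 2 + (lam / 2) • D - c ^ 2 • X (k + 2) ^ 2))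

/-- The axis of a direction. -/
def axis : Fin 6 → Fin 3 := ![0, 1, 2, 0, 1, 2]

/-- The space derivative in a direction. -/
def spaceDeriv (i : Fin 6) : B := ∑ k, direction i k • X k

/-- The test functions for the Kolmogorov equations. -/
def testPoly (i : Fin 6) : B := (D + c • spaceDeriv X i) * potential c lam D X (axis i)

lemma switchProb_eq (i j : Fin 6) : switchProb i j = if axis i = axis j then 0 else 1 / 4 := by
  unfold switchProb
  fin_cases i <;> fin_cases j <;>
    simp [direction, axis]

lemma spaceDeriv_eq (i : Fin 6) : (spaceDeriv X i : B) =
    if (i : ℕ) < 3 then X (axis i) else -X (axis i) := by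
  unfold spaceDeriv
  fin_cases i <;> simp [direction, axis, Fin.sum_univ_three]

/-- Put Y_k = D² + (λ/2)D - c²X_k². If direction i lies on axis k, the difference of squares gives
(-D + cs)(D + cs) = c²X_k² - D² = (λ/2)D - Y_k, where s is its space derivative. In the switching
sum only the D-part of each pair of opposite directions survives, giving -(λ/2)D times the products
Y_l Y_m other than the one omitting k. Altogether this is Y_0Y_1Y_2 - (λ/2)D(Y_0Y_1 + Y_1Y_2 +
Y_0Y_2), which is symmetric in the axes, hence the same for all directions, and expands to
`sixthPoly`. -/
lemma testPoly_kolmogorov (i : Fin 6) :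
    (-D + c • spaceDeriv X i) * testPoly c lam D X i +
      lam • ∑ j, switchProb i j • testPoly c lam D X j = sixthPoly c lam D X := by
  -- All scalars are expressed through c and l = λ/2, using 3λ²/4 = 3l², λ³/4 = 2l³ and λ²/4 = l²,
  -- so that only ring identities in B remain.
  set C := algebraMap ℝ B c with hC
  set l := algebraMap ℝ B (lam / 2) with hl
  have e1 : ∀ x : B, c • x = C * x := fun x => Algebra.smul_def _ _
  have e2 : ∀ x : B, (lam / 2) • x = l * x := fun x => Algebra.smul_def _ _
  have e3 : ∀ x : B, lam • ((1 / 4 : ℝ) • (2 * x)) = l * x := fun x => by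
    rw [← e2, two_mul, ← two_smul ℝ x, smul_smul, smul_smul]; congr 1; ring
  have e4 : ∀ x : B, (3 * lam ^ 2 / 4) • x = 3 * l ^ 2 * x := fun x => by
    rw [Algebra.smul_def, hl, show 3 * lam ^ 2 / 4 = 3 * (lam / 2) ^ 2 by ring]; simp [map_ofNat]
  have e5 : ∀ x : B, (lam ^ 3 / 4) • x = 2 * l ^ 3 * x := fun x => by
    rw [Algebra.smul_def, hl, show lam ^ 3 / 4 = 2 * (lam / 2) ^ 3 by ring]; simp [map_ofNat]
  have e6 : ∀ x : B, (lam ^ 2 / 4) • x = l ^ 2 * x := fun x => by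
    rw [Algebra.smul_def, hl, show lam ^ 2 / 4 = (lam / 2) ^ 2 by ring]; simp
  have e7 : ∀ (n : ℕ) (x : B), c ^ n • x = C ^ n * x := fun n x => by
    rw [Algebra.smul_def, map_pow]
  -- Opposite directions share the potential and have opposite space derivatives, so each axis other
  -- than that of i contributes 2D times its potential.
  have hsum : ∑ j, switchProb i j • testPoly c lam D X j =
      (1 / 4 : ℝ) • (2 * ∑ k, if axis i = k then 0 else D * potential c lam D X k) := by
    simp only [switchProb_eq, Fin.sum_univ_six, Fin.sum_univ_three, testPoly, spaceDeriv_eq, ite_smul,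
      zero_smul]
    fin_cases i <;> simp [axis] <;> simp only [← smul_add] <;> congr 1 <;> ring
  rw [hsum, e3]
  simp only [testPoly, potential, spaceDeriv_eq, sixthPoly, e1, e2, e4, e5, e6, e7,
    Fin.sum_univ_three]
  fin_cases i <;> simp [axis] <;> ring

end Algebra

end

/-! ### The sixth-order equation in the sense of distributions -/

/-- The time derivative as a differential operator. -/
def timeOp : diffOps := pd (1, 0)

/-- The space derivatives as differential operators. -/
def spaceOp (i : Fin 3) : diffOps := pd (0, Pi.single i 1)

lemma dt_coe (u : SmoothFun) : dt ⇑u = op timeOp u := funext fun w => (op_pd _ u w).symm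

lemma dx_coe (i : Fin 3) (u : SmoothFun) : dx i ⇑u = op (spaceOp i) u :=
  funext fun w => (op_pd _ u w).symm

lemma dxx_coe (i : Fin 3) (u : SmoothFun) : dxx i ⇑u = op (spaceOp i ^ 2) u := by
  rw [dxx, dx_coe, dx_coe, pow_two, op_mul]

lemma laplace_coe (u : SmoothFun) : laplace ⇑u = op (∑ i, spaceOp i ^ 2) u := by
  funext w
  simp only [laplace, dxx_coe, Fin.sum_univ_three, op_add, SmoothFun.coe_add, Pi.add_apply]

lemma mixedFourth_coe (u : SmoothFun) : mixedFourth ⇑u = op (spaceOp 0 ^ 2 * spaceOp 1 ^ 2 +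
    spaceOp 0 ^ 2 * spaceOp 2 ^ 2 + spaceOp 1 ^ 2 * spaceOp 2 ^ 2) u := by
  funext w
  simp only [mixedFourth, dxx_coe, op_add, op_mul, SmoothFun.coe_add, Pi.add_apply]

lemma dtPlus_coe (lam : ℝ) (u : SmoothFun) :
    dtPlus lam ⇑u = op (timeOp + algebraMap ℝ diffOps lam) u := by
  funext w
  simp only [dtPlus, dt_coe, op_add, op_algebraMap, SmoothFun.coe_add, Pi.add_apply,
    SmoothFun.coe_smul, Pi.smul_apply, smul_eq_mul]

lemma dtPlusAdj_coe (lam : ℝ) (u : SmoothFun) :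
    dtPlusAdj lam ⇑u = op (-timeOp + algebraMap ℝ diffOps lam) u := by
  funext w
  simp only [dtPlusAdj, dt_coe, op_add, op_neg, op_algebraMap, SmoothFun.coe_add, Pi.add_apply,
    SmoothFun.coe_smul, Pi.smul_apply, smul_eq_mul, SmoothFun.coe_neg, Pi.neg_apply]

lemma iterate_coe {D : (SpaceTime → ℝ) → SpaceTime → ℝ} {a : diffOps}
    (h : ∀ u : SmoothFun, D ⇑u = op a u) (n : ℕ) (u : SmoothFun) : D^[n] ⇑u = op (a ^ n) u := by
  induction n with
  | zero => rfl
  | succ n ih => rw [Function.iterate_succ_apply', ih, h, pow_succ', op_mul]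

lemma sixthOrder_coe {D : (SpaceTime → ℝ) → SpaceTime → ℝ} {a : diffOps}
    (h : ∀ u : SmoothFun, D ⇑u = op a u) (c lam : ℝ) (u : SmoothFun) :
    sixthOrder D c lam ⇑u = op (sixthPoly c lam a spaceOp) u := by
  funext w
  simp only [sixthOrder, laplace_coe, mixedFourth_coe, dxx_coe, iterate_coe h]
  simp only [sixthPoly, op_sub,
    op_add, op_smul, op_mul, SmoothFun.coe_add, SmoothFun.coe_sub, SmoothFun.coe_smul,
    Pi.add_apply, Pi.sub_apply, Pi.smul_apply, smul_eq_mul]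

lemma dAlembert_coe (c : ℝ) (i : Fin 3) (u : SmoothFun) :
    dAlembert c i ⇑u = op (timeOp ^ 2 - c ^ 2 • spaceOp i ^ 2) u := by
  funext w
  simp only [dAlembert, dt_coe, dxx_coe, op_sub, op_smul, pow_two timeOp, op_mul,
    SmoothFun.coe_sub, SmoothFun.coe_smul, Pi.sub_apply, Pi.smul_apply, smul_eq_mul]

lemma telegraph_coe (c lam : ℝ) (u : SmoothFun) : telegraph c lam ⇑u =
    op (timeOp ^ 2 + (lam / 3) • timeOp - (c ^ 2 / 3) • ∑ i, spaceOp i ^ 2) u := by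
  funext w
  simp only [telegraph, dt_coe, laplace_coe, op_sub, op_add, op_smul, pow_two timeOp, op_mul,
    SmoothFun.coe_add, SmoothFun.coe_sub, SmoothFun.coe_smul, Pi.add_apply, Pi.sub_apply,
    Pi.smul_apply, smul_eq_mul]

/-! ### Formal adjoints and conjugation with exponentials in time. -/

instance : (volume : Measure SpaceTime).IsAddHaarMeasure :=
  inferInstanceAs ((volume : Measure ℝ).prod (volume : Measure (Fin 3 → ℝ))).IsAddHaarMeasure

lemma integrable_op_mul_op (p q : diffOps) (u : SmoothFun) {v : SmoothFun}
    (hv : HasCompactSupport ⇑v) : Integrable fun w => op p u w * op q v w :=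
  Continuous.integrable_of_hasCompactSupport
    ((op p u).contDiff.continuous.mul (op q v).contDiff.continuous)
    (hasCompactSupport_op q hv).mul_left

/-- Pairs of formally adjoint differential operators. -/
def adjointPairs : Subalgebra ℝ (diffOps × diffOps) where
  carrier := {a | ∀ u v : SmoothFun, HasCompactSupport ⇑v →
    ∫ w, op a.1 u w * v w = ∫ w, u w * op a.2 v w}
  mul_mem' {a b} ha hb := by
    rw [mem_ofPred_eq] at *
    intro u v hv
    -- Taking adjoints reverses products; commutativity of the operators restores the order, so
    -- adjoint pairs are closed under componentwise products.
    rw [Prod.fst_mul, Prod.snd_mul, op_mul, ha _ _ hv, hb _ _ (hasCompactSupport_op _ hv),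
      ← op_mul, mul_comm]
  add_mem' {a b} ha hb := by
    rw [mem_ofPred_eq] at *
    intro u v hv
    have h1 : ∀ p, Integrable fun w => op p u w * v w := fun p =>
      integrable_op_mul_op p 1 u hv
    have h2 : ∀ q, Integrable fun w => u w * op q v w := fun q =>
      integrable_op_mul_op 1 q u hv
    simp only [Prod.fst_add, Prod.snd_add, op_add, SmoothFun.coe_add, Pi.add_apply, add_mul,
      mul_add]
    rw [integral_add (h1 _) (h1 _), integral_add (h2 _) (h2 _), ha u v hv, hb u v hv]
  algebraMap_mem' r := by
    rw [mem_ofPred_eq]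
    intro u v _
    refine integral_congr_ae (ae_of_all _ fun w => ?_)
    simp [op_algebraMap]
    ring

lemma pd_mem_adjointPairs (v : SpaceTime) : (pd v, -pd v) ∈ adjointPairs := by
  intro u w hw
  have := integral_mul_fderiv_eq_neg_fderiv_mul_of_integrable (μ := volume) (v := v) (f := ⇑u)
    (g := ⇑w) (integrable_op_mul_op (pd v) 1 u hw) (integrable_op_mul_op 1 (pd v) u hw)
    (integrable_op_mul_op 1 1 u hw)
    (fun z _ => u.differentiable z) (fun z _ => w.differentiable z)
  simp only [op_neg, op_pd', SmoothFun.coe_neg, Pi.neg_apply, mul_neg]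
  rw [integral_neg, this, neg_neg]

/-- Adjoint pairs form a subalgebra, so it is enough to know them for first derivatives, where they
come from integration by parts. The signs of the space derivatives disappear because only even
powers occur. -/
lemma sixthPoly_mem_adjointPairs (c lam : ℝ) :
    (sixthPoly c lam (timeOp + algebraMap ℝ diffOps lam) spaceOp,
      sixthPoly c lam (-timeOp + algebraMap ℝ diffOps lam) spaceOp) ∈ adjointPairs := by
  have := sixthPoly_mem c lam (S := adjointPairs)
    (D := (timeOp + algebraMap ℝ diffOps lam, -timeOp + algebraMap ℝ diffOps lam))
    (X := fun i => (spaceOp i, -spaceOp i))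
    (add_mem (pd_mem_adjointPairs _) (adjointPairs.algebraMap_mem lam))
    (fun i => pd_mem_adjointPairs _)
  convert this using 1
  refine Prod.ext ?_ ?_
  · rw [sixthPoly_fst]
  · rw [sixthPoly_snd]
    exact (sixthPoly_neg c lam _ spaceOp).symm

lemma contDiff_exp_time (lam : ℝ) :
    ContDiff ℝ (⊤ : ℕ∞) fun w : SpaceTime => Real.exp (lam * w.1) :=
  (contDiff_const.mul contDiff_fst).exp

/-- Multiplication by `exp (lam * t)`. -/
def expMul (lam : ℝ) (u : SmoothFun) : SmoothFun :=
  SmoothFun.mk (fun w => Real.exp (lam * w.1) * u w) ((contDiff_exp_time lam).mul u.contDiff)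

lemma expMul_apply (lam : ℝ) (u : SmoothFun) (w : SpaceTime) :
    expMul lam u w = Real.exp (lam * w.1) * u w := rfl

/-- Pairs of differential operators which are conjugate by multiplication with `exp (lam * t)`. -/
def conjugatePairs (lam : ℝ) : Subalgebra ℝ (diffOps × diffOps) where
  carrier := {a | ∀ u : SmoothFun, expMul lam (op a.1 u) = op a.2 (expMul lam u)}
  mul_mem' {a b} ha hb := by
    rw [mem_ofPred_eq] at *
    intro u
    rw [Prod.fst_mul, Prod.snd_mul, op_mul, ha, hb, op_mul]
  add_mem' {a b} ha hb := by
    rw [mem_ofPred_eq] at *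
    intro u
    rw [Prod.fst_add, Prod.snd_add, op_add, op_add, ← ha, ← hb]
    refine SmoothFun.ext fun w => ?_
    simp only [expMul_apply, SmoothFun.coe_add, Pi.add_apply, mul_add]
  algebraMap_mem' r := by
    rw [mem_ofPred_eq]
    intro u
    refine SmoothFun.ext fun w => ?_
    simp only [Prod.algebraMap_apply, op_algebraMap, expMul_apply, SmoothFun.coe_smul,
      Pi.smul_apply, smul_eq_mul]
    ring

/-- Product rule: ∂_v(e^{λt}u) = e^{λt}(∂_v u + λ v_t u), where v_t is the time component of v. -/
lemma pd_mem_conjugatePairs (lam : ℝ) (v : SpaceTime) :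
    (pd v + algebraMap ℝ diffOps (lam * v.1), pd v) ∈ conjugatePairs lam := by
  intro u
  refine SmoothFun.ext fun w => ?_
  have h1 : HasFDerivAt (fun w : SpaceTime => Real.exp (lam * w.1))
      (Real.exp (lam * w.1) • lam • ContinuousLinearMap.fst ℝ ℝ (Fin 3 → ℝ)) w :=
    (((ContinuousLinearMap.fst ℝ ℝ (Fin 3 → ℝ)).hasFDerivAt (x := w)).const_mul lam).exp
  have h2 := h1.mul (u.differentiable w).hasFDerivAt
  have h3 : fderiv ℝ (⇑(expMul lam u)) w = _ := h2.fderiv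
  simp only [op_add, op_pd', op_algebraMap, expMul_apply, SmoothFun.coe_add, Pi.add_apply,
    SmoothFun.coe_smul, Pi.smul_apply, smul_eq_mul, h3]
  simp
  ring

lemma sixthPoly_mem_conjugatePairs (c lam : ℝ) :
    (sixthPoly c lam (timeOp + algebraMap ℝ diffOps lam) spaceOp,
      sixthPoly c lam timeOp spaceOp) ∈ conjugatePairs lam := by
  have := sixthPoly_mem c lam (S := conjugatePairs lam)
    (D := (timeOp + algebraMap ℝ diffOps lam, timeOp)) (X := fun i => (spaceOp i, spaceOp i))
    (by simpa [timeOp] using pd_mem_conjugatePairs lam (1, 0))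
    (fun i => by simpa [spaceOp] using pd_mem_conjugatePairs lam (0, Pi.single i 1))
  convert this using 1
  refine Prod.ext ?_ ?_
  · rw [sixthPoly_fst]
  · rw [sixthPoly_snd]

lemma pd_velocity (c : ℝ) (i : Fin 6) : pd (velocity c i) = timeOp + c • spaceDeriv spaceOp i := by
  have : velocity c i = (1, 0) + c • ∑ k, direction i k • ((0, Pi.single k 1) : SpaceTime) := by
    refine Prod.ext ?_ (funext fun k => ?_)
    · simp [velocity, Prod.fst_sum]
    · simp only [velocity, Prod.snd_add, Prod.smul_snd, Prod.snd_sum, Pi.add_apply, Pi.smul_apply,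
        Finset.sum_apply, Pi.zero_apply, zero_add]
      simp [Pi.single_apply]
  have hsum : ∀ (s : Finset (Fin 3)) (f : Fin 3 → SpaceTime), pd (∑ k ∈ s, f k) = ∑ k ∈ s, pd (f k) := by
    intro s f
    have h0 : pd 0 = 0 := by simpa using pd_smul 0 0
    exact map_sum (⟨⟨pd, h0⟩, pd_add⟩ : SpaceTime →+ diffOps) f s
  rw [this, pd_add, pd_smul, hsum]
  simp_rw [pd_smul]
  rfl

/-- The occupation measure solves the sixth-order equation in the sense of distributions. -/
theorem IsStandardMotion.integral_sixthOrder_occupation {Ω : Type*} [MeasurableSpace Ω]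
    {P : Measure Ω} [IsProbabilityMeasure P] {lam : ℝ} {τ : ℕ → Ω → ℝ} {V : ℕ → Ω → Fin 6}
    (hlam : 0 < lam) (h : IsStandardMotion P lam τ V) (c : ℝ) (u : SmoothFun)
    (hu : HasCompactSupport ⇑u) (hu0 : tsupport ⇑u ⊆ {w : SpaceTime | 0 < w.1}) :
    ∫ w, sixthOrder (dtPlusAdj lam) c lam ⇑u w ∂occupation P τ V c = 0 := by
  set E : diffOps := -timeOp + algebraMap ℝ diffOps lam with hE
  set φ : Fin 6 → SmoothFun := fun i => op (testPoly c lam E spaceOp i) u with hφ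
  refine h.sum_integral_dirOccupation hlam c (φ := fun i => φ i)
    (fun i => (φ i).contDiff.of_le (mod_cast le_top)) (fun i => hasCompactSupport_op _ hu)
    (fun i => image_eq_zero_of_notMem_tsupport fun h0 => ?_) (fun i z => ?_)
  · exact lt_irrefl (0 : ℝ) (hu0 (tsupport_op_subset _ _ h0))
  · rw [sixthOrder_coe (dtPlusAdj_coe lam), ← testPoly_kolmogorov c lam E spaceOp i, op_add,
      op_mul, op_smul, op_sum]
    -- The shift by λ matches the term -λφ in the Kolmogorov equations: ∂_velocity - λ is -E plus c
    -- times the space derivative, the first factor in `testPoly_kolmogorov`.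
    have hvel : pd (velocity c i) = -E + c • spaceDeriv spaceOp i + algebraMap ℝ diffOps lam := by
      rw [pd_velocity, hE]; ring
    have h1 : lineDeriv ℝ ⇑(φ i) z (velocity c i) =
        op (-E + c • spaceDeriv spaceOp i) (φ i) z + lam * φ i z := by
      rw [← op_pd, hvel, op_add, op_algebraMap]
      simp
    have h2 : (∑ j, op (switchProb i j • testPoly c lam E spaceOp j) u : SmoothFun) z =
        ∑ j, switchProb i j * φ j z := by
      simp only [Fin.sum_univ_six, SmoothFun.coe_add, Pi.add_apply, op_smul, SmoothFun.coe_smul,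
        Pi.smul_apply, smul_eq_mul, hφ]
    rw [h1, SmoothFun.coe_add, Pi.add_apply, SmoothFun.coe_smul, Pi.smul_apply, h2]
    simp [hφ]

lemma IsStandardMotion.measurable_position_apply {Ω : Type*} [MeasurableSpace Ω]
    {P : Measure Ω} {lam : ℝ} {τ : ℕ → Ω → ℝ} {V : ℕ → Ω → Fin 6}
    (h : IsStandardMotion P lam τ V) (c t : ℝ) : Measurable (position c τ V t) := by
  have h1 : Measurable fun ω : Ω => (t, ω) := measurable_const.prodMk measurable_id
  have h2 := (h.measurable_position c).comp h1
  exact h2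

lemma IsStandardMotion.integral_positionLaw {Ω : Type*} [MeasurableSpace Ω]
    {P : Measure Ω} {lam : ℝ} {τ : ℕ → Ω → ℝ} {V : ℕ → Ω → Fin 6}
    (h : IsStandardMotion P lam τ V) (c : ℝ) {f : (Fin 3 → ℝ) → ℝ} (hf : Continuous f) (t : ℝ) :
    ∫ x, f x ∂positionLaw P c τ V t = ∫ ω, f (position c τ V t ω) ∂P := by
  exact integral_map (h.measurable_position_apply c t).aemeasurable hf.aestronglyMeasurable

lemma IsStandardMotion.integral_occupation {Ω : Type*} [MeasurableSpace Ω]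
    {P : Measure Ω} [IsProbabilityMeasure P] {lam : ℝ} {τ : ℕ → Ω → ℝ} {V : ℕ → Ω → Fin 6}
    (h : IsStandardMotion P lam τ V) (c : ℝ) {f : SpaceTime → ℝ} (hf : Continuous f)
    (hc : HasCompactSupport f) :
    ∫ z, f z ∂occupation P τ V c = ∫ t in Ioi (0 : ℝ), ∫ x, f (t, x) ∂positionLaw P c τ V t := by
  have hfin := h.isFiniteMeasureOnCompacts_occupation c
  have hint : Integrable f (occupation P τ V c) := hf.integrable_of_hasCompactSupport hc
  have hp := (measurable_fst.prodMk (h.measurable_position c)).aemeasurable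
    (μ := (volume.restrict (Ioi 0)).prod P)
  have hint' := (integrable_map_measure hf.aestronglyMeasurable hp).1 hint
  have h1 : ∫ z, f z ∂occupation P τ V c = _ := integral_map hp hf.aestronglyMeasurable
  have h2 := integral_prod _ hint'
  have h3 : ∀ t, ∫ x, f (t, x) ∂positionLaw P c τ V t = ∫ ω, f (t, position c τ V t ω) ∂P :=
    fun t => h.integral_positionLaw c (f := fun x => f (t, x)) (by fun_prop) t
  simp_rw [h3]
  rw [h1]
  exact h2

/-! ### Path measures in the octants -/

/-- The commutative monoid of s-finite measures on space-time under convolution. -/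
def ConvMonoid : Type := {μ : Measure SpaceTime // SFinite μ}

instance (μ : ConvMonoid) : SFinite μ.1 := μ.2

instance : CommMonoid ConvMonoid where
  mul μ ν := ⟨μ.1.conv ν.1, inferInstance⟩
  one := ⟨dirac 0, inferInstance⟩
  mul_assoc μ ν ρ := Subtype.ext (conv_assoc μ.1 ν.1 ρ.1)
  one_mul μ := Subtype.ext (dirac_zero_conv μ.1)
  mul_one μ := Subtype.ext (conv_dirac_zero μ.1)
  mul_comm μ ν := Subtype.ext (conv_comm μ.1 ν.1)

/-- `rayPow` as an element of the convolution monoid. -/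
def rayMon (c : ℝ) (i : Fin 6) (n : ℕ) : ConvMonoid := ⟨rayPow c i n, inferInstance⟩

lemma rayMon_zero (c : ℝ) (i : Fin 6) : rayMon c i 0 = 1 := by
  refine Subtype.ext ?_
  change (halfLinePow 0).map (fun s => s • velocity c i) = dirac 0
  rw [halfLinePow, Measure.map_dirac' (by fun_prop)]
  simp

lemma rayMon_add (c : ℝ) (i : Fin 6) (m n : ℕ) :
    rayMon c i (m + n) = rayMon c i m * rayMon c i n := by
  refine Subtype.ext ?_
  change rayPow c i (m + n) = (rayPow c i m).conv (rayPow c i n)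
  have := map_conv_continuousLinearMap (μ := halfLinePow m) (ν := halfLinePow n)
    (ContinuousLinearMap.toSpanSingleton ℝ (velocity c i))
  rw [halfLinePow_conv] at this
  exact this

/-- Displacements may be reordered under convolution, so those in equal directions are collected
into one convolution power. -/
lemma pathMeasure_eq_prod (c : ℝ) (l : List (Fin 6)) :
    pathMeasure c l = (∏ i, rayMon c i (l.count i)).1 := by
  induction l with
  | nil => simp only [List.count_nil, rayMon_zero, Finset.prod_const_one]; rfl
  | cons j l ih =>
    have h : ∀ i, rayMon c i ((j :: l).count i) =
        (if i = j then rayMon c j 1 else 1) * rayMon c i (l.count i) := by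
      intro i
      rw [List.count_cons, add_comm, rayMon_add]
      by_cases hij : i = j
      · subst hij; simp
      · simp [hij, Ne.symm hij, rayMon_zero]
    simp_rw [h]
    rw [Finset.prod_mul_distrib, Finset.prod_ite_eq' Finset.univ j fun _ => rayMon c j 1,
      if_pos (Finset.mem_univ j), pathMeasure, ih]
    rfl

/-- The index of the direction along the `k`-th axis with sign `b`. -/
def dirIndex (k : Fin 3) (b : Bool) : Fin 6 := ⟨if b then k else k + 3, by split_ifs <;> omega⟩

/-- The sign of an orientation. -/
def sgn (b : Bool) : ℝ := if b then 1 else -1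

lemma direction_dirIndex (k : Fin 3) (b : Bool) :
    direction (dirIndex k b) = Pi.single k (sgn b) := by
  cases b <;> fin_cases k <;> ext j <;> fin_cases j <;>
    simp [direction, dirIndex, sgn]

lemma prod_fin_six_eq {M : Type*} [CommMonoid M] (f : Fin 6 → M) (σ : Fin 3 → Bool) :
    ∏ i, f i = (f (dirIndex 0 (σ 0)) * f (dirIndex 0 (!σ 0))) *
      ((f (dirIndex 1 (σ 1)) * f (dirIndex 1 (!σ 1))) *
        (f (dirIndex 2 (σ 2)) * f (dirIndex 2 (!σ 2)))) := by
  have h : ∀ k : Fin 3, f (dirIndex k (σ k)) * f (dirIndex k (!σ k)) =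
      f (dirIndex k true) * f (dirIndex k false) := by
    intro k
    cases σ k
    · exact mul_comm _ _
    · rfl
  rw [h, h, h, Fin.prod_univ_six]
  change f 0 * f 1 * f 2 * f 3 * f 4 * f 5 = (f 0 * f 3) * ((f 1 * f 4) * (f 2 * f 5))
  simp only [mul_assoc, mul_left_comm]

/-- The linear parametrization of the octant with signs `σ`: the particle is at the point with
coordinates `c * σ k * x k` at time `x 0 + x 1 + x 2 + 2 * ρ`. -/
def octMap (c : ℝ) (σ : Fin 3 → Bool) : SpaceTime →ₗ[ℝ] SpaceTime where
  toFun q := (∑ k, q.2 k + 2 * q.1, fun k => c * sgn (σ k) * q.2 k)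
  map_add' p q := by
    refine Prod.ext ?_ (funext fun k => ?_)
    · simp [Finset.sum_add_distrib]; ring
    · simp; ring
  map_smul' r q := by
    refine Prod.ext ?_ (funext fun k => ?_)
    · simp [← Finset.mul_sum]; ring
    · simp; ring

lemma octMap_apply (c : ℝ) (σ : Fin 3 → Bool) (q : SpaceTime) :
    octMap c σ q = (∑ k, q.2 k + 2 * q.1, fun k => c * sgn (σ k) * q.2 k) := rfl

lemma measurable_octMap (c : ℝ) (σ : Fin 3 → Bool) : Measurable (octMap c σ) :=
  (LinearMap.continuous_of_finiteDimensional _).measurable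

lemma lintegral_rayPow_pair (c : ℝ) (i j : Fin 6) (m n : ℕ) {F : SpaceTime → ℝ≥0∞}
    (hF : Measurable F) :
    ∫⁻ z, F z ∂(rayPow c i m).conv (rayPow c j n) =
      ∫⁻ u, ∫⁻ v, F (u • velocity c i + v • velocity c j) ∂halfLinePow n ∂halfLinePow m := by
  rw [lintegral_conv hF, rayPow, lintegral_map (by fun_prop) (by fun_prop)]
  refine lintegral_congr fun u => ?_
  rw [rayPow, lintegral_map (by fun_prop) (by fun_prop)]

/-- On one axis, time u forward and v backward give displacement c(u - v) in the chosen sense and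
take time u + v = (u - v) + 2v. The backward times enter only through their sum. -/
lemma sum_velocity_eq (c : ℝ) (σ : Fin 3 → Bool) (u0 v0 u1 v1 u2 v2 : ℝ) :
    u0 • velocity c (dirIndex 0 (σ 0)) + v0 • velocity c (dirIndex 0 (!σ 0)) +
      (u1 • velocity c (dirIndex 1 (σ 1)) + v1 • velocity c (dirIndex 1 (!σ 1)) +
        (u2 • velocity c (dirIndex 2 (σ 2)) + v2 • velocity c (dirIndex 2 (!σ 2)))) =
      octMap c σ (v0 + (v1 + v2), ![u0 - v0, u1 - v1, u2 - v2]) := by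
  have hs : ∀ b, sgn (!b) = -sgn b := fun b => by cases b <;> simp [sgn]
  refine Prod.ext ?_ (funext fun k => ?_)
  · simp [octMap_apply, Fin.sum_univ_three]
    ring
  · simp only [octMap_apply, velocity, direction_dirIndex, hs]
    fin_cases k <;> simp <;> ring

lemma lintegral_pathMeasure_oct (c : ℝ) (σ : Fin 3 → Bool) (l : List (Fin 6))
    {F : SpaceTime → ℝ≥0∞} (hF : Measurable F) :
    ∫⁻ z, F z ∂pathMeasure c l =
      ∫⁻ u0, ∫⁻ v0, ∫⁻ u1, ∫⁻ v1, ∫⁻ u2, ∫⁻ v2,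
        F (octMap c σ (v0 + (v1 + v2), ![u0 - v0, u1 - v1, u2 - v2]))
        ∂halfLinePow (l.count (dirIndex 2 (!σ 2))) ∂halfLinePow (l.count (dirIndex 2 (σ 2)))
        ∂halfLinePow (l.count (dirIndex 1 (!σ 1))) ∂halfLinePow (l.count (dirIndex 1 (σ 1)))
        ∂halfLinePow (l.count (dirIndex 0 (!σ 0))) ∂halfLinePow (l.count (dirIndex 0 (σ 0))) := by
  rw [pathMeasure_eq_prod, prod_fin_six_eq _ σ]
  set A := fun k => (rayPow c (dirIndex k (σ k)) (l.count (dirIndex k (σ k)))).conv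
    (rayPow c (dirIndex k (!σ k)) (l.count (dirIndex k (!σ k)))) with hA
  change ∫⁻ z, F z ∂(A 0).conv ((A 1).conv (A 2)) = _
  rw [lintegral_conv hF]
  have hin : ∀ z, ∫⁻ w, F (z + w) ∂(A 1).conv (A 2) =
      ∫⁻ w, ∫⁻ w', F (z + (w + w')) ∂A 2 ∂A 1 := fun z => by
    rw [lintegral_conv (by fun_prop)]
  simp_rw [hin]
  rw [hA]
  simp only
  rw [lintegral_rayPow_pair _ _ _ _ _ (by fun_prop)]
  refine lintegral_congr fun u0 => lintegral_congr fun v0 => ?_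
  rw [lintegral_rayPow_pair _ _ _ _ _ (by fun_prop)]
  refine lintegral_congr fun u1 => lintegral_congr fun v1 => ?_
  rw [lintegral_rayPow_pair _ _ _ _ _ (by fun_prop)]
  refine lintegral_congr fun u2 => lintegral_congr fun v2 => ?_
  rw [sum_velocity_eq]

/-! ### The density in an octant -/

/-- The change of variables `lintegral_halfLinePow_sub` is used on each axis, from the innermost
outwards. Since G sees the backward times only through their sum, their three convolution powers
merge into a single one. -/
lemma lintegral_pair_sums (a b : Fin 3 → ℕ) {G : ℝ → ℝ → ℝ → ℝ → ℝ≥0∞}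
    (hG : Measurable fun q : ℝ × ℝ × ℝ × ℝ => G q.1 q.2.1 q.2.2.1 q.2.2.2)
    (h0 : ∀ r x y z, x ≤ 0 → G r x y z = 0) (h1 : ∀ r x y z, y ≤ 0 → G r x y z = 0)
    (h2 : ∀ r x y z, z ≤ 0 → G r x y z = 0) :
    ∫⁻ u0, ∫⁻ v0, ∫⁻ u1, ∫⁻ v1, ∫⁻ u2, ∫⁻ v2,
        G (v0 + (v1 + v2)) (u0 - v0) (u1 - v1) (u2 - v2)
        ∂halfLinePow (b 2) ∂halfLinePow (a 2) ∂halfLinePow (b 1) ∂halfLinePow (a 1)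
        ∂halfLinePow (b 0) ∂halfLinePow (a 0) =
      ∑ i ∈ Finset.range (a 0), ∑ j ∈ Finset.range (a 1), ∑ k ∈ Finset.range (a 2),
        (b 0).multichoose i * ((b 1).multichoose j * ((b 2).multichoose k *
        ∫⁻ x, ∫⁻ y, ∫⁻ z, ∫⁻ r, G r x y z
          ∂halfLinePow ((b 0 + i) + ((b 1 + j) + (b 2 + k)))
          ∂halfLinePow (a 2 - k) ∂halfLinePow (a 1 - j) ∂halfLinePow (a 0 - i))) := by
  have hc : ∀ {E : Type} [MeasurableSpace E] {e f g h : E → ℝ}, Measurable e → Measurable f →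
      Measurable g → Measurable h → Measurable fun q => G (e q) (f q) (g q) (h q) :=
    fun he hf hg hh => hG.comp (he.prodMk (hf.prodMk (hg.prodMk hh)))
  obtain ⟨H, hH, rfl⟩ : ∃ H : ℝ × ℝ × ℝ × ℝ → ℝ≥0∞, Measurable H ∧
      G = fun r x y z => H (r, x, y, z) := ⟨_, hG, rfl⟩
  clear hG hc
  have e2 : ∀ r x y : ℝ, ∫⁻ u2, ∫⁻ v2, H (r + v2, x, y, u2 - v2)
      ∂halfLinePow (b 2) ∂halfLinePow (a 2) = ∑ k ∈ Finset.range (a 2), (b 2).multichoose k *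
        ∫⁻ z, ∫⁻ s, H (r + s, x, y, z) ∂halfLinePow (b 2 + k) ∂halfLinePow (a 2 - k) := by
    intro r x y
    exact lintegral_halfLinePow_sub (a 2) (b 2) (f := fun z s => H (r + s, x, y, z))
      (by unfold Function.uncurry; fun_prop) fun z s hz => h2 _ _ _ _ hz
  have e1 : ∀ r x : ℝ, ∫⁻ u1, ∫⁻ v1, ∫⁻ u2, ∫⁻ v2, H (r + (v1 + v2), x, u1 - v1, u2 - v2)
      ∂halfLinePow (b 2) ∂halfLinePow (a 2) ∂halfLinePow (b 1) ∂halfLinePow (a 1) =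
      ∑ j ∈ Finset.range (a 1), ∑ k ∈ Finset.range (a 2),
        (b 1).multichoose j * ((b 2).multichoose k *
        ∫⁻ y, ∫⁻ z, ∫⁻ s, H (r + s, x, y, z) ∂halfLinePow ((b 1 + j) + (b 2 + k))
          ∂halfLinePow (a 2 - k) ∂halfLinePow (a 1 - j)) := by
    intro r x
    simp_rw [← add_assoc r, e2]
    rw [lintegral_halfLinePow_sub (a 1) (b 1) (f := fun y s => ∑ k ∈ Finset.range (a 2),
      (b 2).multichoose k * ∫⁻ z, ∫⁻ s', H (r + s + s', x, y, z) ∂halfLinePow (b 2 + k)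
        ∂halfLinePow (a 2 - k)) (by unfold Function.uncurry; fun_prop)]
    · refine Finset.sum_congr rfl fun j _ => ?_
      rw [← Finset.mul_sum]
      congr 1
      have : ∀ y, ∫⁻ s, ∑ k ∈ Finset.range (a 2), (b 2).multichoose k *
          ∫⁻ z, ∫⁻ s', H (r + s + s', x, y, z) ∂halfLinePow (b 2 + k)
            ∂halfLinePow (a 2 - k) ∂halfLinePow (b 1 + j) =
          ∑ k ∈ Finset.range (a 2), (b 2).multichoose k *
            ∫⁻ z, ∫⁻ s, H (r + s, x, y, z) ∂halfLinePow ((b 1 + j) + (b 2 + k))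
              ∂halfLinePow (a 2 - k) := by
        intro y
        rw [lintegral_finsetSum _ fun k _ => by fun_prop]
        refine Finset.sum_congr rfl fun k _ => ?_
        rw [lintegral_const_mul' _ _ (ENNReal.natCast_ne_top _),
          lintegral_lintegral_swap (by unfold Function.uncurry; fun_prop)]
        congr 1
        refine lintegral_congr fun z => ?_
        rw [← lintegral_halfLinePow_add (b 1 + j) (b 2 + k) (by fun_prop)]
        simp_rw [add_assoc r]
      simp_rw [this]
      rw [lintegral_finsetSum _ fun k _ => by fun_prop]
      refine Finset.sum_congr rfl fun k _ => ?_
      rw [lintegral_const_mul' _ _ (ENNReal.natCast_ne_top _)]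
    · intro y s hy
      simp only [h1 _ _ _ _ hy, lintegral_zero, mul_zero, Finset.sum_const_zero]
  simp_rw [e1]
  rw [lintegral_halfLinePow_sub (a 0) (b 0) (f := fun x s => ∑ j ∈ Finset.range (a 1),
      ∑ k ∈ Finset.range (a 2), (b 1).multichoose j * ((b 2).multichoose k *
        ∫⁻ y, ∫⁻ z, ∫⁻ s', H (s + s', x, y, z) ∂halfLinePow ((b 1 + j) + (b 2 + k))
          ∂halfLinePow (a 2 - k) ∂halfLinePow (a 1 - j)))
        (by unfold Function.uncurry; fun_prop)]
  · refine Finset.sum_congr rfl fun i _ => ?_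
    simp_rw [← Finset.mul_sum]
    congr 1
    have : ∀ x, ∫⁻ s, ∑ j ∈ Finset.range (a 1), (b 1).multichoose j *
        ∑ k ∈ Finset.range (a 2), (b 2).multichoose k *
        ∫⁻ y, ∫⁻ z, ∫⁻ s', H (s + s', x, y, z) ∂halfLinePow ((b 1 + j) + (b 2 + k))
          ∂halfLinePow (a 2 - k) ∂halfLinePow (a 1 - j) ∂halfLinePow (b 0 + i) =
        ∑ j ∈ Finset.range (a 1), (b 1).multichoose j *
          ∑ k ∈ Finset.range (a 2), (b 2).multichoose k *
          ∫⁻ y, ∫⁻ z, ∫⁻ s, H (s, x, y, z)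
            ∂halfLinePow ((b 0 + i) + ((b 1 + j) + (b 2 + k)))
            ∂halfLinePow (a 2 - k) ∂halfLinePow (a 1 - j) := by
      intro x
      rw [lintegral_finsetSum _ fun k _ => by fun_prop]
      refine Finset.sum_congr rfl fun j _ => ?_
      rw [lintegral_const_mul' _ _ (ENNReal.natCast_ne_top _),
        lintegral_finsetSum _ fun k _ => by fun_prop]
      congr 1
      refine Finset.sum_congr rfl fun k _ => ?_
      rw [lintegral_const_mul' _ _ (ENNReal.natCast_ne_top _),
        lintegral_lintegral_swap (by unfold Function.uncurry; fun_prop)]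
      congr 1
      refine lintegral_congr fun y => ?_
      rw [lintegral_lintegral_swap (by unfold Function.uncurry; fun_prop)]
      refine lintegral_congr fun z => ?_
      rw [← lintegral_halfLinePow_add (b 0 + i) _ (by fun_prop)]
    simp_rw [this]
    rw [lintegral_finsetSum _ fun k _ => by fun_prop]
    refine Finset.sum_congr rfl fun j _ => ?_
    rw [lintegral_const_mul' _ _ (ENNReal.natCast_ne_top _),
      lintegral_finsetSum _ fun k _ => by fun_prop]
    congr 1
    refine Finset.sum_congr rfl fun k _ => ?_
    rw [lintegral_const_mul' _ _ (ENNReal.natCast_ne_top _)]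
  · intro x s hx
    simp only [h0 _ _ _ _ hx, lintegral_zero, mul_zero, Finset.sum_const_zero]

/-- The density of `halfLinePow n` on the positive half-line. -/
def powDensity (n : ℕ) (x : ℝ) : ℝ := if n = 0 then 0 else x ^ (n - 1) / (n - 1).factorial

@[fun_prop]
lemma measurable_powDensity (n : ℕ) : Measurable (powDensity n) := by
  unfold powDensity
  split_ifs <;> fun_prop

/-- For n = 0 the measure is the unit mass at 0, invisible to g; this is how the singular parts of
the law drop out. -/
lemma lintegral_halfLinePow_eq (n : ℕ) {g : ℝ → ℝ≥0∞} (hg : Measurable g)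
    (hg0 : ∀ x ≤ 0, g x = 0) :
    ∫⁻ x, g x ∂halfLinePow n = ∫⁻ x, ENNReal.ofReal (powDensity n x) * g x := by
  cases n with
  | zero => simp [lintegral_halfLinePow_zero, hg0, powDensity]
  | succ n =>
    rw [lintegral_halfLinePow_succ n hg, ← lintegral_indicator measurableSet_Ioi]
    refine lintegral_congr fun x => ?_
    by_cases hx : 0 < x
    · simp [indicator, hx, powDensity]
    · simp [hg0 x (not_lt.1 hx)]

lemma lintegral_spaceTime {K : ℝ → ℝ → ℝ → ℝ → ℝ≥0∞}
    (hK : Measurable fun q : ℝ × ℝ × ℝ × ℝ => K q.1 q.2.1 q.2.2.1 q.2.2.2) :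
    ∫⁻ q : SpaceTime, K q.1 (q.2 0) (q.2 1) (q.2 2) =
      ∫⁻ x, ∫⁻ y, ∫⁻ z, ∫⁻ r, K r x y z := by
  obtain ⟨H, hH, rfl⟩ : ∃ H : ℝ × ℝ × ℝ × ℝ → ℝ≥0∞, Measurable H ∧
      K = fun r x y z => H (r, x, y, z) := ⟨_, hK, rfl⟩
  have h3 : ∀ g : ℝ × ℝ × ℝ → ℝ≥0∞, Measurable g →
      ∫⁻ x : Fin 3 → ℝ, g (x 0, x 1, x 2) = ∫⁻ x, ∫⁻ y, ∫⁻ z, g (x, y, z) := by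
    intro g hg
    have e1 := (volume_preserving_piFinSuccAbove (fun _ : Fin 3 => ℝ) 0).lintegral_comp
      (f := fun q : ℝ × (Fin 2 → ℝ) => g (q.1, q.2 0, q.2 1)) (by fun_prop)
    have e2 : ∀ x, ∫⁻ v : Fin 2 → ℝ, g (x, v 0, v 1) = ∫⁻ q : ℝ × ℝ, g (x, q.1, q.2) := fun x =>
      (volume_preserving_finTwoArrow ℝ).lintegral_comp
        (f := fun q : ℝ × ℝ => g (x, q.1, q.2)) (by fun_prop)
    refine Eq.trans ?_ (e1.trans ?_)
    · rfl
    · rw [volume_eq_prod, lintegral_prod _ (by fun_prop)]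
      refine lintegral_congr fun x => ?_
      rw [e2, volume_eq_prod, lintegral_prod _ (by fun_prop)]
  rw [volume_eq_prod, lintegral_prod_symm _ (by fun_prop)]
  exact h3 (fun q => ∫⁻ r, H (r, q.1, q.2.1, q.2.2)) (by fun_prop)

/-! ### The power series of the density in an octant. -/

/-- The coordinates `(ρ, x 0, x 1, x 2)` of a point of the parameter space of an octant. -/
def octCoord (q : SpaceTime) : Fin 4 → ℝ := ![q.1, q.2 0, q.2 1, q.2 2]

/-- Indices of the series for the density in an octant: a history and, for each axis, the number
of backward steps that are absorbed by the forward ones. -/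
abbrev OctIndex : Type := List (Fin 6) × ℕ × ℕ × ℕ

/-- The order of the convolution power that governs the time lost in moving back and forth. -/
def loopOrder (σ : Fin 3 → Bool) (J : OctIndex) : ℕ :=
  (J.1.count (dirIndex 0 (!σ 0)) + J.2.1) +
    ((J.1.count (dirIndex 1 (!σ 1)) + J.2.2.1) + (J.1.count (dirIndex 2 (!σ 2)) + J.2.2.2))

/-- The orders of the convolution powers that govern the displacement along the three axes. -/
def axisOrder (σ : Fin 3 → Bool) (J : OctIndex) : Fin 3 → ℕ :=
  ![J.1.count (dirIndex 0 (σ 0)) - J.2.1, J.1.count (dirIndex 1 (σ 1)) - J.2.2.1,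
    J.1.count (dirIndex 2 (σ 2)) - J.2.2.2]

/-- Exponents of the series for the density in an octant. -/
def octExponent (σ : Fin 3 → Bool) (J : OctIndex) : Fin 4 → ℕ :=
  ![loopOrder σ J - 1, axisOrder σ J 0 - 1, axisOrder σ J 1 - 1, axisOrder σ J 2 - 1]

/-- The combinatorial factor of a term of the series. -/
def octMultiplicity (σ : Fin 3 → Bool) (J : OctIndex) : ℕ :=
  (J.1.count (dirIndex 0 (!σ 0))).multichoose J.2.1 *
    ((J.1.count (dirIndex 1 (!σ 1))).multichoose J.2.2.1 *
      (J.1.count (dirIndex 2 (!σ 2))).multichoose J.2.2.2)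

/-- Coefficients of the series for the density in an octant. -/
def octCoeff (lam : ℝ) (σ : Fin 3 → Bool) (J : OctIndex) : ℝ :=
  -- An order zero means a unit mass on the boundary of the parameter octant. Such terms must be
  -- cancelled by hand, because the truncated subtraction in `octExponent` would turn them into a
  -- spurious constant factor.
  if loopOrder σ J = 0 ∨ ∃ k, axisOrder σ J k = 0 then 0
  else (pathWeight lam J.1).toReal * octMultiplicity σ J

lemma octCoeff_nonneg (lam : ℝ) (σ : Fin 3 → Bool) (J : OctIndex) : 0 ≤ octCoeff lam σ J := by
  unfold octCoeff
  split_ifs <;> positivity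

lemma pathWeight_ne_top (lam : ℝ) (l : List (Fin 6)) : pathWeight lam l ≠ ∞ := by
  induction l with
  | nil => simp [pathWeight]
  | cons i l ih =>
    cases l with
    | nil => simp [pathWeight]
    | cons j l => exact ENNReal.mul_ne_top ENNReal.ofReal_ne_top ih

lemma octCoeff_mul_expMonomial (lam : ℝ) (σ : Fin 3 → Bool) (J : OctIndex) (q : SpaceTime) :
    octCoeff lam σ J * expMonomial (octExponent σ J) (octCoord q) =
      (pathWeight lam J.1).toReal * octMultiplicity σ J *
        (powDensity (axisOrder σ J 0) (q.2 0) * (powDensity (axisOrder σ J 1) (q.2 1) *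
          (powDensity (axisOrder σ J 2) (q.2 2) * powDensity (loopOrder σ J) q.1))) := by
  by_cases h : loopOrder σ J = 0 ∨ ∃ k, axisOrder σ J k = 0
  · rw [octCoeff, if_pos h, zero_mul]
    rcases h with h | ⟨k, h⟩
    · simp [powDensity, h]
    · fin_cases k <;> simp only [Fin.zero_eta, Fin.mk_one, Fin.reduceFinMk] at h <;>
        simp [powDensity, h]
  · rw [octCoeff, if_neg h]
    push Not at h
    simp only [powDensity, h.1, h.2 0, h.2 1, h.2 2, if_false, expMonomial, Fin.prod_univ_four,
      octExponent, octCoord]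
    simp
    exact Or.inl (by ring)

lemma powDensity_nonneg (n : ℕ) {x : ℝ} (hx : 0 ≤ x) : 0 ≤ powDensity n x := by
  unfold powDensity
  split_ifs <;> positivity

lemma ofReal_octTerm (lam : ℝ) (σ : Fin 3 → Bool) (J : OctIndex) {q : SpaceTime}
    (hq : 0 < q.1 ∧ ∀ k, 0 < q.2 k) :
    ENNReal.ofReal (octCoeff lam σ J * expMonomial (octExponent σ J) (octCoord q)) =
      pathWeight lam J.1 * octMultiplicity σ J *
        (ENNReal.ofReal (powDensity (axisOrder σ J 0) (q.2 0)) *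
          (ENNReal.ofReal (powDensity (axisOrder σ J 1) (q.2 1)) *
            (ENNReal.ofReal (powDensity (axisOrder σ J 2) (q.2 2)) *
              ENNReal.ofReal (powDensity (loopOrder σ J) q.1)))) := by
  have h := fun n k => powDensity_nonneg n (hq.2 k).le
  rw [octCoeff_mul_expMonomial, ENNReal.ofReal_mul (by positivity),
    ENNReal.ofReal_mul (by positivity), ENNReal.ofReal_toReal (pathWeight_ne_top _ _),
    ENNReal.ofReal_natCast, ENNReal.ofReal_mul (h _ _), ENNReal.ofReal_mul (h _ _),
    ENNReal.ofReal_mul (h _ _)]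

lemma measurable_octTerm (lam : ℝ) (σ : Fin 3 → Bool) (J : OctIndex) :
    Measurable fun q =>
      ENNReal.ofReal (octCoeff lam σ J * expMonomial (octExponent σ J) (octCoord q)) := by
  simp_rw [octCoeff_mul_expMonomial]
  fun_prop

lemma measurable_octMap_cons (c : ℝ) (σ : Fin 3 → Bool) {F : SpaceTime → ℝ≥0∞}
    (hF : Measurable F) : Measurable fun q : ℝ × ℝ × ℝ × ℝ =>
      F (octMap c σ (q.1, ![q.2.1, q.2.2.1, q.2.2.2])) := by
  refine hF.comp ((measurable_octMap c σ).comp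
    (measurable_fst.prodMk (measurable_pi_iff.2 fun i => ?_)))
  fin_cases i <;> simp <;> fun_prop

lemma lintegral_octTerm (lam c : ℝ) (σ : Fin 3 → Bool) (J : OctIndex)
    {F : SpaceTime → ℝ≥0∞} (hF : Measurable F)
    (hF0 : ∀ q, ¬ (0 < q.1 ∧ ∀ k, 0 < q.2 k) → F (octMap c σ q) = 0) :
    ∫⁻ q, ENNReal.ofReal (octCoeff lam σ J * expMonomial (octExponent σ J) (octCoord q)) *
        F (octMap c σ q) =
      pathWeight lam J.1 * octMultiplicity σ J *
        ∫⁻ x, ∫⁻ y, ∫⁻ z, ∫⁻ r, F (octMap c σ (r, ![x, y, z]))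
          ∂halfLinePow (loopOrder σ J) ∂halfLinePow (axisOrder σ J 2)
          ∂halfLinePow (axisOrder σ J 1) ∂halfLinePow (axisOrder σ J 0) := by
  have hz : ∀ r x y z : ℝ, r ≤ 0 ∨ x ≤ 0 ∨ y ≤ 0 ∨ z ≤ 0 →
      F (octMap c σ (r, ![x, y, z])) = 0 := by
    intro r x y z h
    refine hF0 _ fun h' => ?_
    have h0 := h'.2 0
    have h1 := h'.2 1
    have h2 := h'.2 2
    have h3 := h'.1
    simp at h0 h1 h2 h3
    rcases h with h | h | h | h <;> linarith
  obtain ⟨H, hH, hHF⟩ : ∃ H : ℝ × ℝ × ℝ × ℝ → ℝ≥0∞, Measurable H ∧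
      ∀ r x y z, F (octMap c σ (r, ![x, y, z])) = H (r, x, y, z) :=
    ⟨_, measurable_octMap_cons c σ hF, fun _ _ _ _ => rfl⟩
  have hFH : ∀ q : SpaceTime, F (octMap c σ q) = H (q.1, q.2 0, q.2 1, q.2 2) := by
    intro q
    rw [← hHF]
    refine congrArg F (congrArg _ (Prod.ext rfl (funext fun k => ?_)))
    fin_cases k <;> rfl
  simp_rw [hHF] at hz ⊢
  have hl : ∀ q : SpaceTime, ENNReal.ofReal (octCoeff lam σ J *
      expMonomial (octExponent σ J) (octCoord q)) * F (octMap c σ q) =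
      pathWeight lam J.1 * octMultiplicity σ J *
        (ENNReal.ofReal (powDensity (axisOrder σ J 0) (q.2 0)) *
          (ENNReal.ofReal (powDensity (axisOrder σ J 1) (q.2 1)) *
            (ENNReal.ofReal (powDensity (axisOrder σ J 2) (q.2 2)) *
              (ENNReal.ofReal (powDensity (loopOrder σ J) q.1) *
                H (q.1, q.2 0, q.2 1, q.2 2))))) := by
    intro q
    by_cases hq : 0 < q.1 ∧ ∀ k, 0 < q.2 k
    · rw [ofReal_octTerm lam σ J hq, hFH]
      ring
    · rw [← hFH, hF0 q hq]
      simp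
  simp_rw [hl]
  rw [lintegral_const_mul' _ _ (ENNReal.mul_ne_top (pathWeight_ne_top _ _)
    (ENNReal.natCast_ne_top _)), lintegral_spaceTime (K := fun r x y z =>
      ENNReal.ofReal (powDensity (axisOrder σ J 0) x) *
          (ENNReal.ofReal (powDensity (axisOrder σ J 1) y) *
            (ENNReal.ofReal (powDensity (axisOrder σ J 2) z) *
              (ENNReal.ofReal (powDensity (loopOrder σ J) r) * H (r, x, y, z)))))
      (by fun_prop)]
  congr 1
  rw [lintegral_halfLinePow_eq _ (by fun_prop)
    (fun x hx => by simp [hz _ _ _ _ (Or.inr (Or.inl hx))])]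
  refine lintegral_congr fun x => ?_
  rw [lintegral_halfLinePow_eq _ (by fun_prop)
    (fun y hy => by simp [hz _ _ _ _ (Or.inr (Or.inr (Or.inl hy)))]),
    ← lintegral_const_mul' _ _ ENNReal.ofReal_ne_top]
  refine lintegral_congr fun y => ?_
  rw [lintegral_halfLinePow_eq _ (by fun_prop)
    (fun z hz' => by simp [hz _ _ _ _ (Or.inr (Or.inr (Or.inr hz')))]),
    ← lintegral_const_mul' _ _ ENNReal.ofReal_ne_top,
    ← lintegral_const_mul' _ _ ENNReal.ofReal_ne_top]
  refine lintegral_congr fun z => ?_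
  rw [lintegral_halfLinePow_eq _ (by fun_prop) (fun r hr => hz _ _ _ _ (Or.inl hr)),
    ← lintegral_const_mul' _ _ ENNReal.ofReal_ne_top,
    ← lintegral_const_mul' _ _ ENNReal.ofReal_ne_top,
    ← lintegral_const_mul' _ _ ENNReal.ofReal_ne_top]

lemma lintegral_pathMeasure_octant (lam c : ℝ) (σ : Fin 3 → Bool) (l : List (Fin 6))
    {F : SpaceTime → ℝ≥0∞} (hF : Measurable F)
    (hF0 : ∀ q, ¬ (0 < q.1 ∧ ∀ k, 0 < q.2 k) → F (octMap c σ q) = 0) :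
    pathWeight lam l * ∫⁻ z, F z ∂pathMeasure c l =
      ∑' j : ℕ × ℕ × ℕ, ∫⁻ q, ENNReal.ofReal (octCoeff lam σ (l, j) *
        expMonomial (octExponent σ (l, j)) (octCoord q)) * F (octMap c σ q) := by
  have hz : ∀ r x y z : ℝ, x ≤ 0 ∨ y ≤ 0 ∨ z ≤ 0 → F (octMap c σ (r, ![x, y, z])) = 0 := by
    intro r x y z h
    refine hF0 _ fun h' => ?_
    have h0 := h'.2 0
    have h1 := h'.2 1
    have h2 := h'.2 2
    simp at h0 h1 h2
    rcases h with h | h | h <;> linarith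
  rw [lintegral_pathMeasure_oct c σ l hF,
    lintegral_pair_sums (fun k => l.count (dirIndex k (σ k)))
      (fun k => l.count (dirIndex k (!σ k))) (G := fun r x y z => F (octMap c σ (r, ![x, y, z])))
      (measurable_octMap_cons c σ hF)
      (fun r x y z h => hz _ _ _ _ (by simp [h])) (fun r x y z h => hz _ _ _ _ (by simp [h]))
      (fun r x y z h => hz _ _ _ _ (by simp [h])),
    tsum_eq_sum (s := Finset.range (l.count (dirIndex 0 (σ 0))) ×ˢ
      (Finset.range (l.count (dirIndex 1 (σ 1))) ×ˢ Finset.range (l.count (dirIndex 2 (σ 2)))))]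
  · simp_rw [Finset.sum_product, Finset.mul_sum]
    refine Finset.sum_congr rfl fun i _ => Finset.sum_congr rfl fun j _ =>
      Finset.sum_congr rfl fun k _ => ?_
    rw [lintegral_octTerm lam c σ _ hF hF0]
    simp only [octMultiplicity, loopOrder, axisOrder, Nat.cast_mul, mul_assoc]
    rfl
  -- Outside the finite range of summation the truncated subtraction makes some axis order zero, so
  -- the coefficient vanishes and the sum may run over all triples.
  · rintro ⟨i, j, k⟩ hJ
    have : ∃ m, axisOrder σ (l, i, j, k) m = 0 := by
      by_contra! h
      have h0 := h 0
      have h1 := h 1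
      have h2 := h 2
      simp [axisOrder] at h0 h1 h2
      exact hJ (by simp; omega)
    simp [octCoeff, this]

/-- All terms are nonnegative, so sum and integral may be exchanged in the extended half-line; the
density is identified before its finiteness is known. -/
lemma lintegral_occupation_octant {Ω : Type*} [MeasurableSpace Ω] {P : Measure Ω}
    [IsProbabilityMeasure P] {lam : ℝ} {τ : ℕ → Ω → ℝ} {V : ℕ → Ω → Fin 6} (hlam : 0 < lam)
    (h : IsStandardMotion P lam τ V) (c : ℝ) (σ : Fin 3 → Bool)
    {F : SpaceTime → ℝ≥0∞} (hF : Measurable F)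
    (hF0 : ∀ q, ¬ (0 < q.1 ∧ ∀ k, 0 < q.2 k) → F (octMap c σ q) = 0) :
    ∫⁻ z, F z ∂occupation P τ V c = ∫⁻ q, (∑' J, ENNReal.ofReal (octCoeff lam σ J *
        expMonomial (octExponent σ J) (octCoord q))) *
          (ENNReal.ofReal (Real.exp (-lam * (octMap c σ q).1)) * F (octMap c σ q)) := by
  have hF' : Measurable fun z : SpaceTime => ENNReal.ofReal (Real.exp (-lam * z.1)) * F z := by
    fun_prop
  have hm := measurable_octMap c σ
  rw [h.lintegral_occupation hlam c hF]
  simp_rw [lintegral_pathMeasure_octant lam c σ _ hF' fun q hq => by simp [hF0 q hq]]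
  rw [← ENNReal.tsum_prod (f := fun l j => ∫⁻ q, ENNReal.ofReal (octCoeff lam σ (l, j) *
        expMonomial (octExponent σ (l, j)) (octCoord q)) *
          (ENNReal.ofReal (Real.exp (-lam * (octMap c σ q).1)) * F (octMap c σ q)))]
  have hmJ := measurable_octTerm lam σ
  have ht := lintegral_tsum (μ := (volume : Measure SpaceTime)) fun J =>
    ((hmJ J).mul (hF'.comp hm)).aemeasurable
  refine ht.symm.trans (lintegral_congr fun q => ?_)
  exact ENNReal.tsum_mul_right

/-! ### Inverse coordinates, convergence of the series and the smooth density in an octant. -/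

section

lemma sgn_mul_self (b : Bool) : sgn b * sgn b = 1 := by cases b <;> simp [sgn]

/-- The parameters of a point of space-time with respect to the octant with signs `σ`. -/
def octInv (c : ℝ) (σ : Fin 3 → Bool) : SpaceTime →ₗ[ℝ] SpaceTime where
  toFun w := ((w.1 - ∑ k, sgn (σ k) / c * w.2 k) / 2, fun k => sgn (σ k) / c * w.2 k)
  map_add' p q := by
    refine Prod.ext ?_ (funext fun k => ?_)
    · simp [Fin.sum_univ_three]; ring
    · simp; ring
  map_smul' r q := by
    refine Prod.ext ?_ (funext fun k => ?_)
    · simp [Fin.sum_univ_three]; ring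
    · simp; ring

lemma octInv_apply (c : ℝ) (σ : Fin 3 → Bool) (w : SpaceTime) : octInv c σ w =
    ((w.1 - ∑ k, sgn (σ k) / c * w.2 k) / 2, fun k => sgn (σ k) / c * w.2 k) := rfl

lemma octInv_octMap {c : ℝ} (hc : c ≠ 0) (σ : Fin 3 → Bool) (q : SpaceTime) :
    octInv c σ (octMap c σ q) = q := by
  have h : ∀ k, sgn (σ k) / c * (c * sgn (σ k) * q.2 k) = q.2 k := fun k => by
    field_simp
    rw [pow_two, sgn_mul_self, one_mul]
  rw [octInv_apply, octMap_apply]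
  simp only [h]
  refine Prod.ext ?_ rfl
  simp

lemma octMap_octInv {c : ℝ} (hc : c ≠ 0) (σ : Fin 3 → Bool) (w : SpaceTime) :
    octMap c σ (octInv c σ w) = w := by
  have h : ∀ k, c * sgn (σ k) * (sgn (σ k) / c * w.2 k) = w.2 k := fun k => by
    field_simp
    rw [pow_two, sgn_mul_self, one_mul]
  rw [octInv_apply, octMap_apply]
  simp only [h]
  refine Prod.ext ?_ rfl
  simp only
  ring

lemma contDiff_octInv (c : ℝ) (σ : Fin 3 → Bool) : ContDiff ℝ (⊤ : ℕ∞) (octInv c σ) :=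
  (LinearMap.toContinuousLinearMap (octInv c σ)).contDiff

lemma continuous_octInv (c : ℝ) (σ : Fin 3 → Bool) : Continuous (octInv c σ) :=
  (contDiff_octInv c σ).continuous

lemma contDiff_octCoord : ContDiff ℝ (⊤ : ℕ∞) octCoord := by
  refine contDiff_pi.2 fun i => ?_
  fin_cases i <;> simp [octCoord] <;> fun_prop

/-- The part of the region in the octant with signs `σ`. -/
def octant (c : ℝ) (σ : Fin 3 → Bool) : Set SpaceTime :=
  octInv c σ ⁻¹' {q | 0 < q.1 ∧ ∀ k, 0 < q.2 k}

lemma mem_octant {c : ℝ} {σ : Fin 3 → Bool} {w : SpaceTime} :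
    w ∈ octant c σ ↔ 0 < (octInv c σ w).1 ∧ ∀ k, 0 < (octInv c σ w).2 k := Iff.rfl

lemma isOpen_octant (c : ℝ) (σ : Fin 3 → Bool) : IsOpen (octant c σ) := by
  refine IsOpen.preimage (continuous_octInv c σ) ?_
  simp only [ofPred_and, ofPred_forall]
  exact (isOpen_lt continuous_const continuous_fst).inter
    (isOpen_iInter_of_finite fun k => isOpen_lt continuous_const (by fun_prop))

lemma expMonomial_mono {ι : Type*} [Fintype ι] (n : ι → ℕ) {u v : ι → ℝ} (hu : ∀ i, 0 ≤ u i)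
    (huv : ∀ i, u i ≤ v i) : expMonomial n u ≤ expMonomial n v := by
  refine Finset.prod_le_prod (fun i _ => ?_) fun i _ => ?_
  · have := hu i
    positivity
  · have := hu i
    have := huv i
    gcongr

variable {Ω : Type*} [MeasurableSpace Ω] {P : Measure Ω} {lam c : ℝ}
  {τ : ℕ → Ω → ℝ} {V : ℕ → Ω → Fin 6}

/-- On the box with all coordinates in (R, 2R) the series of nonnegative monomials is at least its
value at R. The occupation measure of the image of the box is finite, hence that value is finite. -/
theorem IsStandardMotion.isEntireSeries [IsProbabilityMeasure P] (hlam : 0 < lam)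
    (h : IsStandardMotion P lam τ V) (σ : Fin 3 → Bool) :
    IsEntireSeries (octCoeff lam σ) (octExponent σ) := by
  intro R hR
  set B : Set SpaceTime := {q | (R < q.1 ∧ q.1 < 2 * R) ∧ ∀ k, R < q.2 k ∧ q.2 k < 2 * R} with hB
  have hBo : IsOpen B := by
    simp only [hB, ofPred_and, ofPred_forall]
    exact ((isOpen_lt continuous_const continuous_fst).inter
      (isOpen_lt continuous_fst continuous_const)).inter
      (isOpen_iInter_of_finite fun k => (isOpen_lt continuous_const (by fun_prop)).inter
        (isOpen_lt (by fun_prop) continuous_const))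
  have hBne : B.Nonempty := ⟨(3 / 2 * R, fun _ => 3 / 2 * R), by
    rw [hB, mem_ofPred_eq]
    exact ⟨⟨by linarith, by linarith⟩, fun k => ⟨by simp; linarith, by simp; linarith⟩⟩⟩
  have hBpos : volume B ≠ 0 := (hBo.measure_pos volume hBne).ne'
  have hBm := hBo.measurableSet
  have hS : MeasurableSet (octInv 1 σ ⁻¹' B) := (continuous_octInv 1 σ).measurable hBm
  set s : ℝ≥0∞ := ∑' J, ENNReal.ofReal (octCoeff lam σ J *
    expMonomial (octExponent σ J) fun _ => R) with hs
  -- The coefficients do not involve the speed, so speed 1 may be used.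
  have key := lintegral_occupation_octant hlam h 1 σ
    (F := (octInv 1 σ ⁻¹' B).indicator 1) (measurable_one.indicator hS) (by
      intro q hq
      rw [indicator_of_notMem]
      rw [mem_preimage, octInv_octMap one_ne_zero]
      rintro ⟨⟨h1, -⟩, h2⟩
      exact hq ⟨hR.trans h1, fun k => hR.trans (h2 k).1⟩)
  have hfin : ∫⁻ z, (octInv 1 σ ⁻¹' B).indicator 1 z ∂occupation P τ V 1 < ∞ := by
    rw [lintegral_indicator_one hS]
    -- In the box the time x_0 + x_1 + x_2 + 2ρ is less than 3 · 2R + 2 · 2R = 10R.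
    refine (measure_mono (t := {z : SpaceTime | z.1 ≤ 10 * R}) fun z hz => ?_).trans_lt
      ((h.occupation_Iic_le 1 (10 * R)).trans_lt ENNReal.ofReal_lt_top)
    obtain ⟨⟨h1, h2⟩, h3⟩ := hz
    rw [mem_ofPred_eq, ← octMap_octInv one_ne_zero σ z, octMap_apply, Fin.sum_univ_three]
    have a0 := (h3 0).2
    have a1 := (h3 1).2
    have a2 := (h3 2).2
    simp only
    linarith
  have hle : s * ENNReal.ofReal (Real.exp (-lam * (10 * R))) * volume B ≤
      ∫⁻ z, (octInv 1 σ ⁻¹' B).indicator 1 z ∂occupation P τ V 1 := by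
    rw [key, ← setLIntegral_const, ← lintegral_indicator hBm]
    refine lintegral_mono fun q => ?_
    by_cases hq : q ∈ B
    · rw [indicator_of_mem hq, indicator_of_mem (by rwa [mem_preimage, octInv_octMap one_ne_zero])]
      obtain ⟨⟨h1, h2⟩, h3⟩ := hq
      simp only [Pi.one_apply, mul_one]
      refine mul_le_mul' (ENNReal.tsum_le_tsum fun J => ?_) (ENNReal.ofReal_le_ofReal ?_)
      · refine ENNReal.ofReal_le_ofReal (mul_le_mul_of_nonneg_left ?_ (octCoeff_nonneg _ _ _))
        refine expMonomial_mono _ (fun _ => hR.le) fun i => ?_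
        fin_cases i
        · exact h1.le
        · exact (h3 0).1.le
        · exact (h3 1).1.le
        · exact (h3 2).1.le
      · refine Real.exp_le_exp.2 ?_
        rw [octMap_apply, Fin.sum_univ_three]
        have a0 := (h3 0).2
        have a1 := (h3 1).2
        have a2 := (h3 2).2
        simp only [neg_mul, neg_le_neg_iff]
        exact mul_le_mul_of_nonneg_left (by linarith) hlam.le
    · rw [indicator_of_notMem hq]
      exact bot_le
  have hst : s ≠ ∞ := by
    intro hst
    rw [hst, ENNReal.top_mul (by simp [Real.exp_pos]), ENNReal.top_mul hBpos] at hle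
    exact absurd (hle.trans_lt hfin) (lt_irrefl _)
  have := ENNReal.summable_toReal hst
  refine this.congr fun J => ?_
  rw [ENNReal.toReal_ofReal (mul_nonneg (octCoeff_nonneg _ _ _)
    (expMonomial_nonneg _ fun _ => hR.le)), abs_of_nonneg (octCoeff_nonneg _ _ _)]

/-- The density of the law in the octant with signs `σ`. -/
def octDensity (c lam : ℝ) (σ : Fin 3 → Bool) (w : SpaceTime) : ℝ :=
  |(LinearMap.det (octMap c σ))⁻¹| * (Real.exp (-lam * w.1) *
    seriesSum (octCoeff lam σ) (octExponent σ) (octCoord (octInv c σ w)))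

lemma IsStandardMotion.contDiff_octDensity [IsProbabilityMeasure P] (hlam : 0 < lam)
    (h : IsStandardMotion P lam τ V) (c : ℝ) (σ : Fin 3 → Bool) :
    ContDiff ℝ (⊤ : ℕ∞) (octDensity c lam σ) := by
  have h1 := (h.isEntireSeries hlam σ).contDiff.comp
    (contDiff_octCoord.comp (contDiff_octInv c σ))
  unfold octDensity
  exact contDiff_const.mul ((by fun_prop : ContDiff ℝ (⊤ : ℕ∞)
    fun w : SpaceTime => Real.exp (-lam * w.1)).mul h1)

lemma seriesSum_oct_nonneg (lam : ℝ) (σ : Fin 3 → Bool) {q : SpaceTime}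
    (hq : 0 < q.1 ∧ ∀ k, 0 < q.2 k) :
    0 ≤ seriesSum (octCoeff lam σ) (octExponent σ) (octCoord q) := by
  refine tsum_nonneg fun J => mul_nonneg (octCoeff_nonneg _ _ _) (expMonomial_nonneg _ fun i => ?_)
  fin_cases i
  · exact hq.1.le
  · exact (hq.2 0).le
  · exact (hq.2 1).le
  · exact (hq.2 2).le

lemma octDensity_nonneg (c lam : ℝ) (σ : Fin 3 → Bool) {w : SpaceTime} (hw : w ∈ octant c σ) :
    0 ≤ octDensity c lam σ w :=
  mul_nonneg (abs_nonneg _) (mul_nonneg (Real.exp_nonneg _) (seriesSum_oct_nonneg lam σ hw))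

lemma det_octMap_ne_zero (hc : c ≠ 0) (σ : Fin 3 → Bool) : LinearMap.det (octMap c σ) ≠ 0 := by
  have : octInv c σ ∘ₗ octMap c σ = LinearMap.id := LinearMap.ext fun q => octInv_octMap hc σ q
  have h := congrArg LinearMap.det this
  rw [LinearMap.det_comp, LinearMap.det_id] at h
  exact right_ne_zero_of_mul_eq_one h

/-- Linear change of variables by `octMap`, whose Jacobian is the constant in `octDensity`. -/
theorem IsStandardMotion.setLIntegral_octant [IsProbabilityMeasure P] (hlam : 0 < lam)
    (hc : c ≠ 0) (h : IsStandardMotion P lam τ V) (σ : Fin 3 → Bool)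
    {F : SpaceTime → ℝ≥0∞} (hF : Measurable F) :
    ∫⁻ w in octant c σ, F w ∂occupation P τ V c =
      ∫⁻ w in octant c σ, ENNReal.ofReal (octDensity c lam σ w) * F w := by
  have hO := (isOpen_octant c σ).measurableSet
  have hd := (h.contDiff_octDensity hlam c σ).continuous.measurable
  have hmem : ∀ q, octMap c σ q ∈ octant c σ ↔ 0 < q.1 ∧ ∀ k, 0 < q.2 k := fun q => by
    rw [mem_octant, octInv_octMap hc]
  rw [← lintegral_indicator hO, ← lintegral_indicator hO,
    lintegral_occupation_octant hlam h c σ (hF.indicator hO) fun q hq =>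
      indicator_of_notMem (fun h' => hq ((hmem q).1 h')) _]
  have hG : Measurable ((octant c σ).indicator fun w => ENNReal.ofReal (Real.exp (-lam * w.1) *
    seriesSum (octCoeff lam σ) (octExponent σ) (octCoord (octInv c σ w))) * F w) := by
    have h1 := ((h.isEntireSeries hlam σ).contDiff.comp
      (contDiff_octCoord.comp (contDiff_octInv c σ))).continuous.measurable
    refine Measurable.indicator (Measurable.mul (Measurable.ennreal_ofReal ?_) hF) hO
    exact Measurable.mul (by fun_prop) h1
  have hcv : ∫⁻ q, ((octant c σ).indicator fun w => ENNReal.ofReal (Real.exp (-lam * w.1) *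
      seriesSum (octCoeff lam σ) (octExponent σ) (octCoord (octInv c σ w))) * F w)
        (octMap c σ q) = ENNReal.ofReal |(LinearMap.det (octMap c σ))⁻¹| *
      ∫⁻ w, ((octant c σ).indicator fun w => ENNReal.ofReal (Real.exp (-lam * w.1) *
      seriesSum (octCoeff lam σ) (octExponent σ) (octCoord (octInv c σ w))) * F w) w := by
    rw [← lintegral_map hG (measurable_octMap c σ),
      Measure.map_linearMap_addHaar_eq_smul_addHaar _ (det_octMap_ne_zero hc σ),
      lintegral_smul_measure]
    rfl
  have hl : ∀ q, (∑' J, ENNReal.ofReal (octCoeff lam σ J *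
        expMonomial (octExponent σ J) (octCoord q))) *
          (ENNReal.ofReal (Real.exp (-lam * (octMap c σ q).1)) *
            (octant c σ).indicator F (octMap c σ q)) =
      ((octant c σ).indicator fun w => ENNReal.ofReal (Real.exp (-lam * w.1) *
      seriesSum (octCoeff lam σ) (octExponent σ) (octCoord (octInv c σ w))) * F w)
        (octMap c σ q) := by
    intro q
    by_cases hq : 0 < q.1 ∧ ∀ k, 0 < q.2 k
    · rw [indicator_of_mem ((hmem q).2 hq), indicator_of_mem ((hmem q).2 hq), octInv_octMap hc,
        ENNReal.ofReal_mul (Real.exp_nonneg _), seriesSum, ENNReal.ofReal_tsum_of_nonneg]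
      · ring
      · intro J
        refine mul_nonneg (octCoeff_nonneg _ _ _) (expMonomial_nonneg _ fun i => ?_)
        fin_cases i
        · exact hq.1.le
        · exact (hq.2 0).le
        · exact (hq.2 1).le
        · exact (hq.2 2).le
      · exact (h.isEntireSeries hlam σ).summable _
    · rw [indicator_of_notMem (mt (hmem q).1 hq), indicator_of_notMem (mt (hmem q).1 hq)]
      simp
  simp_rw [hl]
  rw [hcv, ← lintegral_const_mul' _ _ ENNReal.ofReal_ne_top]
  refine lintegral_congr fun w => ?_
  by_cases hw : w ∈ octant c σ
  · rw [indicator_of_mem hw, indicator_of_mem hw, octDensity,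
      ENNReal.ofReal_mul (abs_nonneg _), mul_assoc]
  · rw [indicator_of_notMem hw, indicator_of_notMem hw, mul_zero]

end

section

/-! ### The density in the region -/

lemma sum_axis_eq (c : ℝ) {σ : Fin 3 → Bool} {x : Fin 3 → ℝ} (hx : ∀ k, 0 < sgn (σ k) * x k) :
    ∑ k, sgn (σ k) / c * x k = (∑ k, |x k|) / c := by
  rw [Finset.sum_div]
  refine Finset.sum_congr rfl fun k _ => ?_
  have h : |x k| = sgn (σ k) * x k := by
    rw [← abs_of_pos (hx k), abs_mul]
    cases σ k <;> simp [sgn]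
  rw [h]
  ring

/-- With matching signs the first inverse coordinate is (t - Σ|x_k|/c)/2; its positivity expresses
being strictly inside the octahedron. -/
lemma mem_octant_iff {c : ℝ} (hc : 0 < c) {σ : Fin 3 → Bool} {w : SpaceTime} :
    w ∈ octant c σ ↔ w ∈ region c ∧ ∀ k, 0 < sgn (σ k) * w.2 k := by
  have h2 : ∀ k, 0 < (octInv c σ w).2 k ↔ 0 < sgn (σ k) * w.2 k := fun k => by
    have : (octInv c σ w).2 k = sgn (σ k) * w.2 k / c := by rw [octInv_apply]; ring
    rw [this]
    exact div_pos_iff_of_pos_right hc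
  rw [mem_octant]
  simp_rw [h2]
  refine and_congr_left fun hk => ?_
  have h1 : 0 < (octInv c σ w).1 ↔ ∑ k, |w.2 k| < c * w.1 := by
    rw [octInv_apply]
    simp only
    rw [sum_axis_eq c hk, div_pos_iff_of_pos_right two_pos, sub_pos, div_lt_iff₀ hc, mul_comm c]
  rw [h1]
  refine ⟨fun h => ⟨?_, h, fun i hi => ?_⟩, fun h => h.2.1⟩
  · have h0 : 0 ≤ ∑ k, |w.2 k| := Finset.sum_nonneg fun k _ => abs_nonneg _
    exact pos_of_mul_pos_right (h0.trans_lt h) hc.le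
  · have := hk i
    rw [hi, mul_zero] at this
    exact lt_irrefl _ this

lemma exists_mem_octant {c : ℝ} (hc : 0 < c) {w : SpaceTime} (hw : w ∈ region c) :
    ∃ σ, w ∈ octant c σ := by
  refine ⟨fun k => decide (0 < w.2 k), (mem_octant_iff hc).2 ⟨hw, fun k => ?_⟩⟩
  rcases lt_or_gt_of_ne (hw.2.2 k) with h | h
  · simp [sgn, h, not_lt.2 h.le]
  · simp [sgn, h]

lemma octant_subset_region {c : ℝ} (hc : 0 < c) (σ : Fin 3 → Bool) : octant c σ ⊆ region c :=
  fun _ hw => ((mem_octant_iff hc).1 hw).1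

lemma region_eq_iUnion {c : ℝ} (hc : 0 < c) : region c = ⋃ σ, octant c σ :=
  Subset.antisymm (fun _ hw => mem_iUnion.2 (exists_mem_octant hc hw))
    (iUnion_subset (octant_subset_region hc))

lemma isOpen_region {c : ℝ} (hc : 0 < c) : IsOpen (region c) := by
  rw [region_eq_iUnion hc]
  exact isOpen_iUnion fun σ => isOpen_octant c σ

lemma octant_unique {c : ℝ} (hc : 0 < c) {σ σ' : Fin 3 → Bool} {w : SpaceTime}
    (h : w ∈ octant c σ) (h' : w ∈ octant c σ') : σ = σ' := by
  funext k
  have h1 := ((mem_octant_iff hc).1 h).2 k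
  have h2 := ((mem_octant_iff hc).1 h').2 k
  cases hs : σ k <;> cases hs' : σ' k <;> simp [sgn, hs, hs'] at h1 h2 ⊢ <;> linarith

/-- The density of the law in the region. -/
def regionDensity (c lam : ℝ) (w : SpaceTime) : ℝ :=
  ∑ σ, (octant c σ).indicator (octDensity c lam σ) w

lemma regionDensity_nonneg (c lam : ℝ) (w : SpaceTime) : 0 ≤ regionDensity c lam w :=
  Finset.sum_nonneg fun σ _ => indicator_nonneg (fun _ hw => octDensity_nonneg c lam σ hw) w

lemma regionDensity_eq {c : ℝ} (hc : 0 < c) (lam : ℝ) {σ : Fin 3 → Bool} {w : SpaceTime}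
    (hw : w ∈ octant c σ) : regionDensity c lam w = octDensity c lam σ w := by
  rw [regionDensity, Finset.sum_eq_single σ, indicator_of_mem hw]
  · exact fun σ' _ hσ => indicator_of_notMem (fun hw' => hσ (octant_unique hc hw' hw)) _
  · exact fun h => absurd (Finset.mem_univ _) h

lemma regionDensity_eventuallyEq {c : ℝ} (hc : 0 < c) (lam : ℝ) {σ : Fin 3 → Bool}
    {w : SpaceTime} (hw : w ∈ octant c σ) : regionDensity c lam =ᶠ[𝓝 w] octDensity c lam σ :=
  eventually_of_mem ((isOpen_octant c σ).mem_nhds hw) fun _ h => regionDensity_eq hc lam h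

variable {Ω : Type*} [MeasurableSpace Ω] {P : Measure Ω} [IsProbabilityMeasure P] {lam c : ℝ}
  {τ : ℕ → Ω → ℝ} {V : ℕ → Ω → Fin 6}

lemma IsStandardMotion.contDiffAt_regionDensity (hlam : 0 < lam)
    (h : IsStandardMotion P lam τ V) (hc : 0 < c) {w : SpaceTime} (hw : w ∈ region c) :
    ContDiffAt ℝ (⊤ : ℕ∞) (regionDensity c lam) w := by
  obtain ⟨σ, hσ⟩ := exists_mem_octant hc hw
  exact (h.contDiff_octDensity hlam c σ).contDiffAt.congr_of_eventuallyEq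
    (regionDensity_eventuallyEq hc lam hσ)

lemma IsStandardMotion.measurable_regionDensity (hlam : 0 < lam)
    (h : IsStandardMotion P lam τ V) (c : ℝ) : Measurable (regionDensity c lam) :=
  Finset.measurable_fun_sum _ fun σ _ =>
    (h.contDiff_octDensity hlam c σ).continuous.measurable.indicator
      (isOpen_octant c σ).measurableSet

lemma IsStandardMotion.setLIntegral_region (hlam : 0 < lam)
    (h : IsStandardMotion P lam τ V) (hc : 0 < c) {F : SpaceTime → ℝ≥0∞} (hF : Measurable F) :
    ∫⁻ w in region c, F w ∂occupation P τ V c =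
      ∫⁻ w in region c, ENNReal.ofReal (regionDensity c lam w) * F w := by
  have hd : Pairwise (Function.onFun Disjoint (octant c)) := fun σ σ' hne =>
    disjoint_left.2 fun w hw hw' => hne (octant_unique hc hw hw')
  have hm := fun σ => (isOpen_octant c σ).measurableSet
  rw [region_eq_iUnion hc, lintegral_iUnion hm hd, lintegral_iUnion hm hd]
  refine tsum_congr fun σ => ?_
  rw [h.setLIntegral_octant hlam hc.ne' σ hF]
  refine setLIntegral_congr_fun (hm σ) fun w hw => ?_
  rw [regionDensity_eq hc lam hw]

/-- Bounds hold up to the boundary of the octants, since each `octDensity` is continuous on the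
whole of space-time. They provide the majorant for dominated convergence. -/
lemma IsStandardMotion.exists_regionDensity_le (hlam : 0 < lam)
    (h : IsStandardMotion P lam τ V) (c : ℝ) {K : Set SpaceTime} (hK : IsCompact K) :
    ∃ M, ∀ w ∈ K, regionDensity c lam w ≤ M := by
  have hσ : ∀ σ, ∃ M, ∀ w ∈ K, |octDensity c lam σ w| ≤ M := fun σ =>
    hK.exists_bound_of_continuousOn (h.contDiff_octDensity hlam c σ).continuous.continuousOn
  choose M hM using hσ
  refine ⟨∑ σ, M σ, fun w hw => Finset.sum_le_sum fun σ _ => ?_⟩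
  refine le_trans ?_ (hM σ w hw)
  by_cases hwσ : w ∈ octant c σ
  · rw [indicator_of_mem hwσ]
    exact le_abs_self _
  · rw [indicator_of_notMem hwσ]
    exact abs_nonneg _

/-! ### The law at a fixed time -/

lemma isOpen_slice (c t : ℝ) : IsOpen (slice c t) := by
  simp only [slice, ofPred_and, ofPred_forall]
  exact (isOpen_lt (by fun_prop) continuous_const).inter
    (isOpen_iInter_of_finite fun i => isOpen_ne_fun (by fun_prop) continuous_const)

lemma slice_mono {c : ℝ} (hc : 0 < c) {s t : ℝ} (hst : s ≤ t) : slice c s ⊆ slice c t :=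
  fun _ hx => ⟨hx.1.trans_le (mul_le_mul_of_nonneg_left hst hc.le), hx.2⟩

lemma slice_subset_closedBall (c t : ℝ) : slice c t ⊆ Metric.closedBall 0 |c * t| := by
  intro x hx
  rw [mem_closedBall_zero_iff, pi_norm_le_iff_of_nonneg (abs_nonneg _)]
  intro i
  exact (Finset.single_le_sum (f := fun i => |x i|) (fun i _ => abs_nonneg _)
    (Finset.mem_univ i)).trans (hx.1.le.trans (le_abs_self _))

/-- From time t until the next switch the motion is linear. Limits from the right suffice, and they
suit the slices, which grow with time. -/
lemma tendsto_position {Ω : Type*} {τ : ℕ → Ω → ℝ} {V : ℕ → Ω → Fin 6} {ω : Ω}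
    (c : ℝ) (h : ∀ k, 0 < τ k ω) (hf : ∃ᶠ k in atTop, 1 < τ k ω) {t : ℝ} (ht : 0 ≤ t) :
    Tendsto (fun s => position c τ V s ω) (𝓝[>] t) (𝓝 (position c τ V t ω)) := by
  classical
  have hex := exists_lt_switchTime h hf t
  obtain ⟨n, hn1, hn2⟩ : ∃ n, switchTime τ n ω ≤ t ∧ t < switchTime τ (n + 1) ω := by
    set m := Nat.find hex with hm
    have hm1 : t < switchTime τ m ω := Nat.find_spec hex
    have hm0 : m ≠ 0 := by
      intro h0
      rw [h0, switchTime_zero] at hm1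
      exact absurd hm1 (not_lt.2 ht)
    obtain ⟨n, hn⟩ := Nat.exists_eq_succ_of_ne_zero hm0
    refine ⟨n, not_lt.1 (Nat.find_min hex (by omega)), ?_⟩
    rwa [hn] at hm1
  have hpos : ∀ s, t ≤ s → s < switchTime τ (n + 1) ω → position c τ V s ω =
      (pathSum c (fun k => τ k ω) (fun k => V k ω) n +
        (s - switchTime τ n ω) • velocity c (V n ω)).2 := fun s h1 h2 =>
    congrArg Prod.snd (mk_position_eq c h (hn1.trans h1) h2)
  rw [hpos t le_rfl hn2]
  have hcont : Continuous fun s : ℝ => (pathSum c (fun k => τ k ω) (fun k => V k ω) n +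
        (s - switchTime τ n ω) • velocity c (V n ω)).2 := by fun_prop
  refine (hcont.continuousAt.tendsto.mono_left nhdsWithin_le_nhds).congr' ?_
  filter_upwards [Ioo_mem_nhdsGT hn2] with s hs
  exact (hpos s hs.1.le hs.2).symm

lemma IsStandardMotion.tendsto_lintegral_position (hlam : 0 < lam)
    (h : IsStandardMotion P lam τ V) (c : ℝ) {g : (Fin 3 → ℝ) → NNReal} (hg : Continuous g)
    {C : NNReal} (hgC : ∀ x, g x ≤ C) {t : ℝ} (ht : 0 ≤ t) :
    Tendsto (fun s => ∫⁻ ω, g (position c τ V s ω) ∂P) (𝓝[>] t)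
      (𝓝 (∫⁻ ω, g (position c τ V t ω) ∂P)) := by
  refine tendsto_lintegral_filter_of_dominated_convergence (fun _ => (C : ℝ≥0∞))
    (Eventually.of_forall fun s => ?_) (Eventually.of_forall fun s => ?_) (by simp) ?_
  · exact measurable_coe_nnreal_ennreal.comp
      (hg.measurable.comp (h.measurable_position_apply c s))
  · exact Eventually.of_forall fun ω => ENNReal.coe_le_coe.2 (hgC _)
  · filter_upwards [h.ae_wait_pos, h.ae_frequently_one_lt_wait hlam] with ω h1 h2
    exact ENNReal.tendsto_coe.2 ((hg.tendsto _).comp (tendsto_position c h1 h2 ht))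

lemma IsStandardMotion.tendsto_lintegral_regionDensity (hlam : 0 < lam)
    (h : IsStandardMotion P lam τ V) (hc : 0 < c) {g : (Fin 3 → ℝ) → NNReal} (hg : Continuous g)
    {C : NNReal} (hgC : ∀ x, g x ≤ C) {t : ℝ} (ht : 0 < t) (hg0 : ∀ x ∉ slice c t, g x = 0) :
    Tendsto (fun s => ∫⁻ x, ENNReal.ofReal (regionDensity c lam (s, x)) * g x) (𝓝[>] t)
      (𝓝 (∫⁻ x, ENNReal.ofReal (regionDensity c lam (t, x)) * g x)) := by
  obtain ⟨M, hM⟩ := h.exists_regionDensity_le hlam c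
    (K := Icc t (t + 1) ×ˢ Metric.closedBall 0 |c * t|)
    (isCompact_Icc.prod (isCompact_closedBall _ _))
  have hp := h.measurable_regionDensity hlam c
  refine tendsto_lintegral_filter_of_dominated_convergence
    ((Metric.closedBall 0 |c * t|).indicator fun _ => ENNReal.ofReal M * C)
    (Eventually.of_forall fun s => ?_) ?_ ?_ (Eventually.of_forall fun x => ?_)
  · have := hg.measurable
    exact Measurable.mul ((hp.comp measurable_prodMk_left).ennreal_ofReal)
      (measurable_coe_nnreal_ennreal.comp this)
  · filter_upwards [Ioo_mem_nhdsGT (show t < t + 1 by linarith)] with s hs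
    refine Eventually.of_forall fun x => ?_
    by_cases hx : x ∈ slice c t
    · have hx' := slice_subset_closedBall c t hx
      rw [indicator_of_mem hx']
      exact mul_le_mul' (ENNReal.ofReal_le_ofReal (hM _ ⟨⟨hs.1.le, hs.2.le⟩, hx'⟩))
        (ENNReal.coe_le_coe.2 (hgC x))
    · simp [hg0 x hx]
  · rw [lintegral_indicator measurableSet_closedBall, setLIntegral_const]
    exact ENNReal.mul_ne_top (ENNReal.mul_ne_top ENNReal.ofReal_ne_top ENNReal.coe_ne_top)
      measure_closedBall_lt_top.ne
  · by_cases hx : x ∈ slice c t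
    · refine ENNReal.Tendsto.mul_const (ENNReal.tendsto_ofReal ?_) (Or.inr ENNReal.coe_ne_top)
      have h1 := (h.contDiffAt_regionDensity hlam hc (w := (t, x)) ⟨ht, hx⟩).continuousAt
      have h2 : ContinuousAt (fun s : ℝ => (s, x)) t := by fun_prop
      exact (ContinuousAt.comp (f := fun s : ℝ => (s, x)) h1 h2).tendsto.mono_left
        nhdsWithin_le_nhds
    · simp [hg0 x hx]

/-- Both sides have the same integral over every measurable set of times after t, by the formula for
the occupation measure in the region. For s > t the support of g stays in the slice at time s, so no
singular part is met. -/
lemma IsStandardMotion.ae_lintegral_position_eq (hlam : 0 < lam)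
    (h : IsStandardMotion P lam τ V) (hc : 0 < c) {g : (Fin 3 → ℝ) → ℝ≥0∞} (hg : Measurable g)
    {t : ℝ} (ht : 0 < t) (hg0 : ∀ x ∉ slice c t, g x = 0) :
    ∀ᵐ s ∂volume.restrict (Ioi t), ∫⁻ ω, g (position c τ V s ω) ∂P =
      ∫⁻ x, ENNReal.ofReal (regionDensity c lam (s, x)) * g x := by
  have hp := h.measurable_regionDensity hlam c
  have hpos := h.measurable_position c
  have hm1 : Measurable fun s => ∫⁻ ω, g (position c τ V s ω) ∂P :=
    Measurable.lintegral_prod_right' (f := fun q : ℝ × Ω => g (position c τ V q.1 q.2))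
      (hg.comp hpos)
  have hm2' : Measurable fun w : SpaceTime => ENNReal.ofReal (regionDensity c lam w) * g w.2 := by
    fun_prop
  have hm2 : Measurable fun s => ∫⁻ x, ENNReal.ofReal (regionDensity c lam (s, x)) * g x :=
    Measurable.lintegral_prod_right' hm2'
  refine ae_eq_of_forall_setLIntegral_eq_of_sigmaFinite hm1 hm2 fun A hA _ => ?_
  rw [Measure.restrict_restrict hA]
  set B := A ∩ Ioi t with hB
  have hBm : MeasurableSet B := hA.inter measurableSet_Ioi
  have hB0 : B ⊆ Ioi 0 := fun s hs => ht.trans hs.2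
  have hS : MeasurableSet (B ×ˢ (univ : Set (Fin 3 → ℝ))) := hBm.prod MeasurableSet.univ
  have hF : Measurable ((B ×ˢ (univ : Set (Fin 3 → ℝ))).indicator fun w : SpaceTime => g w.2) :=
    (hg.comp measurable_snd).indicator hS
  have hFr : ∀ w ∉ region c,
      (B ×ˢ (univ : Set (Fin 3 → ℝ))).indicator (fun w : SpaceTime => g w.2) w = 0 := by
    intro w hw
    by_cases hwB : w ∈ B ×ˢ (univ : Set (Fin 3 → ℝ))
    · rw [indicator_of_mem hwB]
      refine hg0 _ fun hx => hw ⟨hB0 hwB.1, slice_mono hc (le_of_lt hwB.1.2) hx⟩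
    · exact indicator_of_notMem hwB _
  have key := h.setLIntegral_region hlam hc hF
  rw [setLIntegral_eq_of_support_subset fun w hw => not_not.1 fun hw' => hw (hFr w hw'),
    setLIntegral_eq_of_support_subset
      fun w hw => not_not.1 fun hw' => hw (by simp only [hFr w hw', mul_zero]),
    h.lintegral_occupation' c hF, volume_eq_prod, lintegral_prod (fun w =>
      ENNReal.ofReal (regionDensity c lam w) *
        (B ×ˢ (univ : Set (Fin 3 → ℝ))).indicator (fun w : SpaceTime => g w.2) w)
      (Measurable.aemeasurable (hp.ennreal_ofReal.mul hF))] at key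
  have hBi : ∀ f : ℝ → ℝ≥0∞, ∫⁻ s in B, f s = ∫⁻ s in Ioi 0, B.indicator f s := fun f => by
    rw [setLIntegral_indicator hBm, inter_eq_self_of_subset_left hB0]
  rw [hBi, ← lintegral_indicator hBm]
  refine Eq.trans (lintegral_congr fun s => ?_) (key.trans (lintegral_congr fun s => ?_))
  · by_cases hs : s ∈ B
    · rw [indicator_of_mem hs]
      refine lintegral_congr fun ω => ?_
      have hsω : (s, position c τ V s ω) ∈ B ×ˢ (univ : Set (Fin 3 → ℝ)) := ⟨hs, mem_univ _⟩
      rw [indicator_of_mem hsω]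
    · rw [indicator_of_notMem hs, ← lintegral_zero (μ := P)]
      refine lintegral_congr fun ω => ?_
      rw [indicator_of_notMem fun h' : (s, position c τ V s ω) ∈ B ×ˢ univ => hs h'.1]
  · by_cases hs : s ∈ B
    · rw [indicator_of_mem hs]
      refine lintegral_congr fun x => ?_
      have hsx : (s, x) ∈ B ×ˢ (univ : Set (Fin 3 → ℝ)) := ⟨hs, mem_univ _⟩
      rw [indicator_of_mem hsx]
    · rw [indicator_of_notMem hs, ← lintegral_zero (μ := (volume : Measure (Fin 3 → ℝ)))]
      refine lintegral_congr fun x => ?_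
      rw [indicator_of_notMem fun h' : (s, x) ∈ B ×ˢ univ => hs h'.1, mul_zero]

lemma IsStandardMotion.lintegral_position_eq (hlam : 0 < lam)
    (h : IsStandardMotion P lam τ V) (hc : 0 < c) {g : (Fin 3 → ℝ) → NNReal} (hg : Continuous g)
    {C : NNReal} (hgC : ∀ x, g x ≤ C) {t : ℝ} (ht : 0 < t) (hg0 : ∀ x ∉ slice c t, g x = 0) :
    ∫⁻ ω, g (position c τ V t ω) ∂P =
      ∫⁻ x, ENNReal.ofReal (regionDensity c lam (t, x)) * g x := by
  have h1 := h.tendsto_lintegral_position hlam c hg hgC ht.le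
  have h2 := h.tendsto_lintegral_regionDensity hlam hc hg hgC ht hg0
  have h3 := h.ae_lintegral_position_eq hlam hc (g := fun x => g x)
    (measurable_coe_nnreal_ennreal.comp hg.measurable) ht fun x hx => by simp [hg0 x hx]
  -- If the two functions were not frequently equal to the right of t, they would differ on an
  -- interval (t, b), contradicting almost everywhere equality.
  refine tendsto_nhds_unique_of_frequently_eq h1 h2 fun hne => ?_
  obtain ⟨b, hb, hsub⟩ := mem_nhdsGT_iff_exists_Ioo_subset.1 hne
  rw [ae_restrict_iff' measurableSet_Ioi, ae_iff] at h3
  refine absurd (measure_mono_null (fun s hs => ?_) h3 : volume (Ioo t b) = 0) ?_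
  · exact fun h' => hsub hs (h' hs.1)
  · rw [Real.volume_Ioo]
    simpa using hb

/-- Multiplication by a cut-off that is positive exactly on the slice makes every bounded continuous
test function admissible. The weighted measures then agree, and dividing by the cut-off gives
equality on the slice. -/
theorem IsStandardMotion.isInteriorDensity (hlam : 0 < lam)
    (h : IsStandardMotion P lam τ V) (hc : 0 < c) :
    IsInteriorDensity P c τ V (regionDensity c lam) := by
  refine ⟨fun w _ => regionDensity_nonneg c lam w, fun t ht => ?_⟩
  set S := slice c t with hS
  have hSo := isOpen_slice c t
  have hSm := hSo.measurableSet
  -- The distance to the complement of the open slice, truncated at 1 to be bounded.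
  set d : (Fin 3 → ℝ) → NNReal := fun x => min (Metric.infNndist x Sᶜ) 1 with hd
  have hdc : Continuous d := (Metric.continuous_infNndist_pt _).min continuous_const
  have hne : (Sᶜ).Nonempty := ⟨0, fun h0 => h0.2 0 rfl⟩
  have hd0 : ∀ x, d x = 0 ↔ x ∉ S := by
    intro x
    have h1 : x ∈ Sᶜ ↔ Metric.infDist x Sᶜ = 0 := hSo.isClosed_compl.mem_iff_infDist_zero hne
    rw [← mem_compl_iff, h1, ← Metric.coe_infNndist, NNReal.coe_eq_zero, hd]
    simp
  have hdm : Measurable fun x => (d x : ℝ≥0∞) := measurable_coe_nnreal_ennreal.comp hdc.measurable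
  have hpm : Measurable fun x => ENNReal.ofReal (regionDensity c lam (t, x)) :=
    ((h.measurable_regionDensity hlam c).comp measurable_prodMk_left).ennreal_ofReal
  have hposm := h.measurable_position_apply c t
  have : IsProbabilityMeasure (positionLaw P c τ V t) :=
    isProbabilityMeasure_map hposm.aemeasurable
  have hdfin : IsFiniteMeasure ((positionLaw P c τ V t).withDensity fun x => d x) := by
    refine isFiniteMeasure_withDensity ?_
    refine ((lintegral_mono (g := fun _ => 1) fun x => ?_).trans_lt (by simp)).ne
    exact ENNReal.coe_le_one_iff.2 (min_le_right _ _)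
  have heq : (positionLaw P c τ V t).withDensity (fun x => (d x : ℝ≥0∞)) =
      (volume.withDensity fun x => ENNReal.ofReal (regionDensity c lam (t, x))).withDensity
        fun x => (d x : ℝ≥0∞) := by
    refine ext_of_forall_lintegral_eq_of_IsFiniteMeasure fun f => ?_
    have hf : Measurable fun x => (f x : ℝ≥0∞) :=
      measurable_coe_nnreal_ennreal.comp f.continuous.measurable
    obtain ⟨C, hC⟩ : ∃ C, ∀ x, f x ≤ C := ⟨_, fun x => f.apply_le_nndist_zero x⟩
    have key := h.lintegral_position_eq hlam hc (g := fun x => d x * f x)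
      (hdc.mul f.continuous) (C := 1 * C) (fun x => mul_le_mul' (min_le_right _ _) (hC x)) ht
      fun x hx => by rw [(hd0 x).2 hx, zero_mul]
    simp only [ENNReal.coe_mul] at key
    rw [lintegral_withDensity_eq_lintegral_mul _ hdm hf,
      lintegral_withDensity_eq_lintegral_mul _ hdm hf,
      lintegral_withDensity_eq_lintegral_mul _ hpm (hdm.mul hf), positionLaw,
      lintegral_map (hdm.mul hf) hposm]
    exact key
  ext A hA
  -- Integrating the inverse of d over A ∩ S against the weighted measure gives back the unweighted
  -- mass of A ∩ S.
  have hval := fun μ : Measure (Fin 3 → ℝ) => lintegral_withDensity_eq_lintegral_mul μ hdm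
    (g := (A ∩ S).indicator fun x => (d x : ℝ≥0∞)⁻¹) (hdm.inv.indicator (hA.inter hSm))
  have hone : ((fun x => (d x : ℝ≥0∞)) * (A ∩ S).indicator fun x => (d x : ℝ≥0∞)⁻¹) =
      (A ∩ S).indicator 1 := by
    funext x
    by_cases hx : x ∈ A ∩ S
    · rw [Pi.mul_apply, indicator_of_mem hx, indicator_of_mem hx]
      refine ENNReal.mul_inv_cancel ?_ ENNReal.coe_ne_top
      rw [ENNReal.coe_ne_zero]
      exact fun h0 => (hd0 x).1 h0 hx.2
    · rw [Pi.mul_apply, indicator_of_notMem hx, indicator_of_notMem hx, mul_zero]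
  have e1 := hval (positionLaw P c τ V t)
  have e2 := hval (volume.withDensity fun x => ENNReal.ofReal (regionDensity c lam (t, x)))
  rw [hone, lintegral_indicator_one (hA.inter hSm)] at e1 e2
  rw [Measure.restrict_apply hA, ← restrict_withDensity hSm, Measure.restrict_apply hA, ← e1,
    heq, e2]

end

section

/-! ### The differential operators are local -/

section Local

variable {U : Set SpaceTime} {f g : SpaceTime → ℝ}

lemma eqOn_lineDeriv (hU : IsOpen U) (h : EqOn f g U) (v : SpaceTime) :
    EqOn (fun w => lineDeriv ℝ f w v) (fun w => lineDeriv ℝ g w v) U := fun _ hw =>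
  (h.eventuallyEq_of_mem (hU.mem_nhds hw)).lineDeriv_eq

lemma eqOn_dt (hU : IsOpen U) (h : EqOn f g U) : EqOn (dt f) (dt g) U := eqOn_lineDeriv hU h _

lemma eqOn_dxx (hU : IsOpen U) (h : EqOn f g U) (i : Fin 3) : EqOn (dxx i f) (dxx i g) U :=
  eqOn_lineDeriv hU (eqOn_lineDeriv hU h _) _

lemma eqOn_laplace (hU : IsOpen U) (h : EqOn f g U) : EqOn (laplace f) (laplace g) U :=
  fun _ hw => Finset.sum_congr rfl fun i _ => eqOn_dxx hU h i hw

lemma eqOn_mixedFourth (hU : IsOpen U) (h : EqOn f g U) :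
    EqOn (mixedFourth f) (mixedFourth g) U := fun w hw => by
  have hd := fun i j => eqOn_dxx hU (eqOn_dxx hU h j) i hw
  simp only [mixedFourth, hd]

lemma eqOn_dtPlus (lam : ℝ) (hU : IsOpen U) (h : EqOn f g U) :
    EqOn (dtPlus lam f) (dtPlus lam g) U := fun w hw => by
  simp only [dtPlus, eqOn_dt hU h hw, h hw]

lemma eqOn_iterate_dtPlus (lam : ℝ) (hU : IsOpen U) (h : EqOn f g U) (n : ℕ) :
    EqOn ((dtPlus lam)^[n] f) ((dtPlus lam)^[n] g) U := by
  induction n with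
  | zero => exact h
  | succ n ih =>
    rw [Function.iterate_succ_apply', Function.iterate_succ_apply']
    exact eqOn_dtPlus lam hU ih

lemma eqOn_sixthOrder (c lam : ℝ) (hU : IsOpen U) (h : EqOn f g U) :
    EqOn (sixthOrder (dtPlus lam) c lam f) (sixthOrder (dtPlus lam) c lam g) U := fun w hw => by
  have h1 := fun n => eqOn_iterate_dtPlus lam hU h n hw
  have h2 := fun n => eqOn_iterate_dtPlus lam hU (eqOn_mixedFourth hU h) n hw
  have h3 := fun n => eqOn_iterate_dtPlus lam hU (eqOn_laplace hU h) n hw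
  have h4 := eqOn_dxx hU (eqOn_dxx hU (eqOn_dxx hU h 2) 1) 0 hw
  simp only [sixthOrder, h1, h2, h3, h4]

lemma eqOn_dAlembert (c : ℝ) (hU : IsOpen U) (h : EqOn f g U) (i : Fin 3) :
    EqOn (dAlembert c i f) (dAlembert c i g) U := fun w hw => by
  simp only [dAlembert, eqOn_dt hU (eqOn_dt hU h) hw, eqOn_dxx hU h i hw]

lemma eqOn_telegraph (c lam : ℝ) (hU : IsOpen U) (h : EqOn f g U) :
    EqOn (telegraph c lam f) (telegraph c lam g) U := fun w hw => by
  simp only [telegraph, eqOn_dt hU (eqOn_dt hU h) hw, eqOn_dt hU h hw, eqOn_laplace hU h hw]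

end Local

/-! ### The equation for the density -/

variable {Ω : Type*} [MeasurableSpace Ω] {P : Measure Ω} [IsProbabilityMeasure P] {lam c : ℝ}
  {τ : ℕ → Ω → ℝ} {V : ℕ → Ω → Fin 6}

lemma IsStandardMotion.restrict_octant (hlam : 0 < lam) (h : IsStandardMotion P lam τ V)
    (hc : c ≠ 0) (σ : Fin 3 → Bool) :
    (occupation P τ V c).restrict (octant c σ) = (volume.restrict (octant c σ)).withDensity
      fun w => ENNReal.ofReal (octDensity c lam σ w) := by
  have hd := (h.contDiff_octDensity hlam c σ).continuous.measurable
  refine ext_of_lintegral _ fun F hF => ?_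
  rw [h.setLIntegral_octant hlam hc σ hF,
    lintegral_withDensity_eq_lintegral_mul _ hd.ennreal_ofReal hF]
  rfl

lemma IsStandardMotion.integral_octDensity_mul (hlam : 0 < lam) (h : IsStandardMotion P lam τ V)
    (hc : c ≠ 0) (σ : Fin 3 → Bool) {f : SpaceTime → ℝ} (hf : Function.support f ⊆ octant c σ) :
    ∫ w, octDensity c lam σ w * f w = ∫ w, f w ∂occupation P τ V c := by
  have hd := (h.contDiff_octDensity hlam c σ).continuous.measurable
  have hO := (isOpen_octant c σ).measurableSet
  have hf0 : ∀ w, w ∉ octant c σ → f w = 0 := fun w hw => not_not.1 fun h' => hw (hf h')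
  rw [← setIntegral_eq_integral_of_forall_compl_eq_zero hf0, h.restrict_octant hlam hc σ,
    integral_withDensity_eq_integral_toReal_smul hd.ennreal_ofReal (by simp),
    ← setIntegral_eq_integral_of_forall_compl_eq_zero (s := octant c σ)
      fun w hw => by rw [hf0 w hw, mul_zero]]
  refine setIntegral_congr_fun hO fun w hw => ?_
  rw [ENNReal.toReal_ofReal (octDensity_nonneg c lam σ hw), smul_eq_mul]

/-- The smooth extension of the density in an octant solves the equation there. -/
lemma IsStandardMotion.op_sixthPoly_octDensity (hlam : 0 < lam) (h : IsStandardMotion P lam τ V)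
    (hc : 0 < c) (σ : Fin 3 → Bool) {w : SpaceTime} (hw : w ∈ octant c σ) :
    op (sixthPoly c lam (timeOp + algebraMap ℝ diffOps lam) spaceOp)
      (SmoothFun.mk _ (h.contDiff_octDensity hlam c σ)) w = 0 := by
  set L := sixthPoly c lam (timeOp + algebraMap ℝ diffOps lam) spaceOp with hL
  set u := SmoothFun.mk _ (h.contDiff_octDensity hlam c σ) with hu
  have hO := isOpen_octant c σ
  have hcont : Continuous ⇑(op L u) := (op L u).contDiff.continuous
  -- Fundamental lemma of the calculus of variations: for a test function g supported in the octant,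
  -- ∫ (Lu) g = ∫ u L*g, which is the integral of L*g against the occupation measure and vanishes.
  have hae := hO.ae_eq_zero_of_integral_contDiff_smul_eq_zero (μ := volume) (f := ⇑(op L u))
    (hcont.locallyIntegrable.locallyIntegrableOn _) fun g hg hgc hgs => by
      set v := SmoothFun.mk g hg with hv
      have h1 : ∫ z, op L u z * v z = ∫ z, octDensity c lam σ z *
          op (sixthPoly c lam (-timeOp + algebraMap ℝ diffOps lam) spaceOp) v z :=
        sixthPoly_mem_adjointPairs c lam u v hgc
      have h2 := h.integral_sixthOrder_occupation hlam c v hgc fun z hz =>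
        (octant_subset_region hc σ (hgs hz)).1
      rw [sixthOrder_coe (dtPlusAdj_coe lam)] at h2
      have h3 := h.integral_octDensity_mul hlam hc.ne' σ
        ((subset_tsupport _).trans ((tsupport_op_subset
          (sixthPoly c lam (-timeOp + algebraMap ℝ diffOps lam) spaceOp) v).trans hgs))
      rw [h2] at h3
      rw [← h3, ← h1]
      exact integral_congr_ae (ae_of_all _ fun z => mul_comm _ _)
  have hae' : ⇑(op L u) =ᵐ[volume.restrict (octant c σ)] fun _ => 0 :=
    (ae_restrict_iff' hO.measurableSet).2 hae
  -- Continuity of Lu turns vanishing almost everywhere into vanishing at every point of the octant.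
  exact eqOn_open_of_ae_eq hae' hO hcont.continuousOn continuousOn_const hw

/-- The operator is local, and on the octant of the given point the density coincides with a
globally smooth function. -/
theorem IsStandardMotion.sixthOrder_regionDensity (hlam : 0 < lam)
    (h : IsStandardMotion P lam τ V) (hc : 0 < c) {w : SpaceTime} (hw : w ∈ region c) :
    sixthOrder (dtPlus lam) c lam (regionDensity c lam) w = 0 := by
  obtain ⟨σ, hσ⟩ := exists_mem_octant hc hw
  have heq : EqOn (regionDensity c lam) (SmoothFun.mk _ (h.contDiff_octDensity hlam c σ))
    (octant c σ) := fun z hz => regionDensity_eq hc lam hz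
  rw [eqOn_sixthOrder c lam (isOpen_octant c σ) heq hσ, sixthOrder_coe (dtPlus_coe lam)]
  exact h.op_sixthPoly_octDensity hlam hc σ hσ

/-- On the octant, q is e^{λt} times the smooth density, so conjugation turns ∂_t + λ into ∂_t; the
factorized form of the operator then gives the equation. -/
theorem IsStandardMotion.dAlembert_eq_telegraph (hlam : 0 < lam)
    (h : IsStandardMotion P lam τ V) (hc : 0 < c) {q : SpaceTime → ℝ}
    (hq : ∀ w ∈ region c, regionDensity c lam w = Real.exp (-lam * w.1) * q w)
    {w : SpaceTime} (hw : w ∈ region c) :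
    dAlembert c 0 (dAlembert c 1 (dAlembert c 2 q)) w =
      3 * lam ^ 2 / 4 * dt (dt (telegraph c lam q)) w := by
  obtain ⟨σ, hσ⟩ := exists_mem_octant hc hw
  set u := SmoothFun.mk _ (h.contDiff_octDensity hlam c σ) with hu
  have hO := isOpen_octant c σ
  have heq : EqOn q (expMul lam u) (octant c σ) := fun z hz => by
    have h1 := hq z (octant_subset_region hc σ hz)
    rw [regionDensity_eq hc lam hz] at h1
    rw [expMul_apply, hu, SmoothFun.coe_mk, h1, ← mul_assoc, ← Real.exp_add]
    simp
  have hz : op (sixthPoly c lam timeOp spaceOp) (expMul lam u) w = 0 := by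
    rw [← sixthPoly_mem_conjugatePairs c lam u, expMul_apply,
      h.op_sixthPoly_octDensity hlam hc σ hσ, mul_zero]
  rw [eqOn_dAlembert c hO (eqOn_dAlembert c hO (eqOn_dAlembert c hO heq 2) 1) 0 hσ,
    eqOn_dt hO (eqOn_dt hO (eqOn_telegraph c lam hO heq)) hσ, dAlembert_coe, dAlembert_coe,
    dAlembert_coe, telegraph_coe, dt_coe, dt_coe]
  rw [sixthPoly_eq_dAlembert, op_sub, SmoothFun.coe_sub, Pi.sub_apply, sub_eq_zero, op_smul,
    SmoothFun.coe_smul, Pi.smul_apply, smul_eq_mul, pow_two timeOp] at hz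
  rw [pow_two timeOp]
  exact hz

theorem IsStandardMotion.integral_sixthOrder_positionLaw (hlam : 0 < lam)
    (h : IsStandardMotion P lam τ V) (c : ℝ) {φ : SpaceTime → ℝ}
    (hφ : ContDiff ℝ (⊤ : ℕ∞) φ) (hφc : HasCompactSupport φ)
    (hφ0 : tsupport φ ⊆ {w : SpaceTime | 0 < w.1}) :
    ∫ t in Ioi (0 : ℝ),
      ∫ x, sixthOrder (dtPlusAdj lam) c lam φ (t, x) ∂positionLaw P c τ V t = 0 := by
  have h1 := h.integral_sixthOrder_occupation hlam c (SmoothFun.mk φ hφ) hφc hφ0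
  have h2 := sixthOrder_coe (dtPlusAdj_coe lam) c lam (SmoothFun.mk φ hφ)
  rw [SmoothFun.coe_mk] at h1 h2
  rw [h2] at h1 ⊢
  rw [← h.integral_occupation c (op _ _).contDiff.continuous
    (hasCompactSupport_op _ (u := SmoothFun.mk φ hφ) hφc)]
  exact h1

end

end

end OrthogonalMotion

open OrthogonalMotion in
theorem theorem5p1 {Ω : Type*} [MeasurableSpace Ω] (P : Measure Ω) [IsProbabilityMeasure P]
    (c lam : ℝ) (hc : 0 < c) (hlam : 0 < lam) (τ : ℕ → Ω → ℝ) (V : ℕ → Ω → Fin 6)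
    (hmotion : IsStandardMotion P lam τ V) :
    -- the law has, inside the octahedron, a density of class `C⁶`, which solves the equation
    (∃ p : SpaceTime → ℝ,
      IsInteriorDensity P c τ V p ∧
      ContDiffOn ℝ 6 p (region c) ∧
      (∀ w ∈ region c, sixthOrder (dtPlus lam) c lam p w = 0) ∧
      -- the equivalent form for `q`, where `p = e^{-lam t} q`
      (∀ q : SpaceTime → ℝ, (∀ w ∈ region c, p w = Real.exp (-lam * w.1) * q w) →
        ∀ w ∈ region c,
          dAlembert c 0 (dAlembert c 1 (dAlembert c 2 q)) w =
            3 * lam ^ 2 / 4 * dt (dt (telegraph c lam q)) w)) ∧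
    -- the whole law of the motion solves the equation in the sense of distributions
    (∀ φ : SpaceTime → ℝ, ContDiff ℝ (⊤ : ℕ∞) φ → HasCompactSupport φ →
      tsupport φ ⊆ {w : SpaceTime | 0 < w.1} →
      ∫ t in Set.Ioi (0 : ℝ),
        ∫ x, sixthOrder (dtPlusAdj lam) c lam φ (t, x) ∂(positionLaw P c τ V t) = 0) :=
  ⟨⟨regionDensity c lam, hmotion.isInteriorDensity hlam hc,
    fun _ hw => ((hmotion.contDiffAt_regionDensity hlam hc hw).of_le
      (WithTop.coe_le_coe.2 (le_top : (6 : ℕ∞) ≤ ⊤))).contDiffWithinAt,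
    fun _ hw => hmotion.sixthOrder_regionDensity hlam hc hw,
    fun _ hq _ hw => hmotion.dAlembert_eq_telegraph hlam hc hq hw⟩,
    fun _ h1 h2 h3 => hmotion.integral_sixthOrder_positionLaw hlam c h1 h2 h3⟩
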